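/- **Setting.** Let $k$ be a field of characteristic $0$. For a numerical semigroup $H\subseteq\mathbb N_0$ (a submonoid with finite complement) let $R(H)\subseteq k[[t]]$ be the ring of all power series whose exponents lie in $H$; it is local. Fix an even integer $n\ge 6$ and an integer $a$ with $\frac{3n}{2}+1\le a\le 2n-1$. For $i\ge 1$ let $A(i)=R(H_i)$, where $$H_1=\{0,n\}\cup\{x: x\ge \tfrac{3n}{2}\},\qquad H_i=\{0\}\cup\{\tfrac{jn}{2}: 2\le j\le i+1\}\cup\{x: x\ge a+1+(i-2)\tfrac n2\}\quad(i\ge 2).$$ For a local ring $R$ with $k\subseteq R\subseteq k[[t]]$ and maximal ideal $m$ write $\operatorname{End}(m)=\{f\in k[[t]]: fm\subseteq m\}$. A *radical chain* starting from a numerical semigroup ring $R\ne k[[t]]$ is a chain $R=R_1\subseteq R_2\subseteq\dots\subseteq R_l=k[[t]]$ of numerical semigroup rings with maximal ideals $m_j$ such that $R_{l-1}\neq k[[t]]$ and $R_{j+1}\subseteq \operatorname{End}(m_j)$ for $1\le j<l$. Its endomorphism ring is $E=\operatorname{End}_{R_1}(M)$, $M=\bigoplus_{j=1}^l R_j$.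 Modules over $E$ are right modules, and $\operatorname{gldim}(E)$ is the supremum of the projective dimensions of all right $E$-modules. If $e_j\in E$ is the projection of $M$ onto $R_j$ and $J(E)$ is the Jacobson radical, put $P_j=e_jE$, $S_j=P_j/e_jJ(E)$, and let $\pi_j:P_j\to S_j$ be the quotient map. Elements of $P_j$ are identified with $R_1$-linear maps $M\to R_j\subseteq k[[t]]$, so that multiplication by a power of $t$ makes sense on them. The *global spectrum* of $R$ is the set of all finite values of $\operatorname{gldim}(E)$ over all radical chains starting from $R$. The *greedy* chain of $A(i)$ is $A(i)_1=A(i)$, $A(i)_{j+1}=\operatorname{End}(m_j)$, stopped at the first $l_i$ with $A(i)_{l_i}=k[[t]]$. Let $E^i$, $P^i_j$, $S^i_j$, $\pi^i_j$ be the objects attached to it. **Theorem.** (a) For $i\ge 3$ and $3\le j\le l_i-2$ the $E^i$-module $S^i_j$ is simple and $$0\longleftarrow S^i_j\xleftarrow{\ \pi^i_j\ }P^i_j\xleftarrow{\ f_9\ }P^i_{j-1}\oplus P^i_{j+1}\xleftarrow{\ f_{10}\ }P^i_j\longleftarrow 0,\qquad f_9(x,y)=x+t^{n/2}y,\quad f_{10}(x)=(t^{n/2}x,\,-x),$$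 is a (well-defined) minimal projective resolution of $S_j^i$. (b) $\operatorname{gldim}(E^i)=2$ for all $i\ge 1$. Consequently the global spectrum of a single numerical semigroup ring can have arbitrarily large spread: for every $N\in\mathbb N_0$ there is an $i\ge 1$ such that the global spectrum of $A(i)$ contains $2$ and also some integer $d\ge N+2$. -/

import Mathlib

open scoped PowerSeries

universe u

noncomputable section

/-! ### Homological algebra over an arbitrary ring -/

/-- The (left) global dimension of a ring `R`: the supremum of the projective dimensions of all
left `R`-modules. The right global dimension of `R` is `globalDim Rᵐᵒᵖ`, since right `R`-modules
are the same as left `Rᵐᵒᵖ`-modules. -/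
def globalDim (R : Type u) [Ring R] : WithBot ℕ∞ :=
  ⨆ X : ModuleCat.{u} R, CategoryTheory.projectiveDimension X

/-- A submodule `K` of `W` is superfluous (small) if `N + K = W` forces `N = W`. -/
def IsSuperfluous {R W : Type*} [Ring R] [AddCommGroup W] [Module R W] (K : Submodule R W) :
    Prop :=
  ∀ N : Submodule R W, N ⊔ K = ⊤ → N = ⊤

/-- `0 ← S ← W₀ ← W₁ ← W₂ ← 0` (with maps `π`, `d₁`, `d₂`) is a minimal projective resolution of
`S`: it is exact, the `Wᵢ` are projective, and each `Wᵢ` is a projective cover of its image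
(i.e. the kernel of the map out of `Wᵢ` is superfluous; for `W₂` this kernel is zero). -/
structure IsMinimalProjectiveResolution {R S W₀ W₁ W₂ : Type*} [Ring R]
    [AddCommGroup S] [Module R S] [AddCommGroup W₀] [Module R W₀]
    [AddCommGroup W₁] [Module R W₁] [AddCommGroup W₂] [Module R W₂]
    (π : W₀ →ₗ[R] S) (d₁ : W₁ →ₗ[R] W₀) (d₂ : W₂ →ₗ[R] W₁) : Prop where
  projective₀ : Module.Projective R W₀
  projective₁ : Module.Projective R W₁
  projective₂ : Module.Projective R W₂
  surjective : Function.Surjective π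
  exact₀ : Function.Exact d₁ π
  exact₁ : Function.Exact d₂ d₁
  injective : Function.Injective d₂
  minimal₀ : IsSuperfluous (LinearMap.ker π)
  minimal₁ : IsSuperfluous (LinearMap.ker d₁)

/-- The principal right ideal `x A` of a ring `A`, as a right `A`-module. -/
def principalRight {A : Type*} [Ring A] (x : A) : Submodule Aᵐᵒᵖ A := Submodule.span Aᵐᵒᵖ {x}

/-- The Jacobson radical `J(A)` (a two-sided ideal), viewed as a right ideal. -/
def rightJacobson (A : Type*) [Ring A] : Submodule Aᵐᵒᵖ A where
  carrier := Ring.jacobson A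
  add_mem' := (Ring.jacobson A).add_mem
  zero_mem' := (Ring.jacobson A).zero_mem
  smul_mem' := fun r _ hx => Ideal.mul_mem_right r.unop (Ring.jacobson A) hx

/-- The right module `xA / (xA ∩ J(A))`. For an idempotent `x` one has `xA ∩ J(A) = x J(A)`. -/
abbrev RadQuotient {A : Type*} [Ring A] (x : A) :=
  principalRight x ⧸ (rightJacobson A).comap (principalRight x).subtype

/-- The quotient map `xA → xA / (xA ∩ J(A))`. -/
def radQuotientMk {A : Type*} [Ring A] (x : A) : principalRight x →ₗ[Aᵐᵒᵖ] RadQuotient x :=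
  ((rightJacobson A).comap (principalRight x).subtype).mkQ

/-! ### Numerical semigroup rings and chains of subrings of `k⟦t⟧` -/

section Chains

variable {k : Type u} [Field k]

/-- The ring `R(H) ⊆ k⟦t⟧` of a set of exponents `H` closed under addition and containing `0`:
all power series whose exponents lie in `H`. -/
def semigroupRing (k : Type u) [Field k] (H : AddSubmonoid ℕ) : Subalgebra k k⟦X⟧ where
  carrier := {f | ∀ m : ℕ, m ∉ H → PowerSeries.coeff m f = 0}
  add_mem' := by
    intro f g hf hg m hm
    rw [map_add, hf m hm, hg m hm, add_zero]
  mul_mem' := by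
    intro f g hf hg m hm
    rw [PowerSeries.coeff_mul]
    refine Finset.sum_eq_zero fun p hp => ?_
    have hp : p.1 + p.2 = m := by simpa using hp
    by_cases h1 : p.1 ∈ H
    · by_cases h2 : p.2 ∈ H
      · exact absurd (hp ▸ H.add_mem h1 h2) hm
      · rw [hg _ h2, mul_zero]
    · rw [hf _ h1, zero_mul]
  algebraMap_mem' := by
    intro c m hm
    have h0 : m ≠ 0 := fun h => hm (h ▸ H.zero_mem)
    rw [PowerSeries.algebraMap_apply, PowerSeries.coeff_C, if_neg h0]

/-- `A` is a numerical semigroup ring: `A = R(H)` for a submonoid `H` of `ℕ` with finite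
complement. -/
def IsNumericalSemigroupRing (A : Subalgebra k k⟦X⟧) : Prop :=
  ∃ H : AddSubmonoid ℕ, ((H : Set ℕ)ᶜ).Finite ∧ A = semigroupRing k H

/-- The Jacobson radical of `A` (for local `A`: its maximal ideal) as a set of power series. -/
def radSet (A : Subalgebra k k⟦X⟧) : Set k⟦X⟧ :=
  {f | ∃ h : f ∈ A, (⟨f, h⟩ : A) ∈ Ring.jacobson A}

/-- The ring `End_A(m)`, where `m` is the maximal ideal of the local ring `A ⊆ k⟦t⟧`, realized as
usual inside `k⟦t⟧`: all `f` such that multiplication by `f` is an endomorphism of `m`. -/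
def endMax (A : Subalgebra k k⟦X⟧) : Subalgebra k k⟦X⟧ where
  carrier := {f | ∀ g ∈ radSet A, f * g ∈ radSet A}
  add_mem' := by
    intro f f' hf hf' g hg
    obtain ⟨h1, h1'⟩ := hf g hg
    obtain ⟨h2, h2'⟩ := hf' g hg
    rw [add_mul]
    exact ⟨A.add_mem h1 h2, (Ring.jacobson A).add_mem h1' h2'⟩
  mul_mem' := by
    intro f f' hf hf' g hg
    rw [mul_assoc]
    exact hf _ (hf' g hg)
  algebraMap_mem' := by
    intro c g hg
    obtain ⟨h, h'⟩ := hg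
    exact ⟨A.mul_mem (A.algebraMap_mem c) h,
      (Ring.jacobson A).mul_mem_left (⟨_, A.algebraMap_mem c⟩ : A) h'⟩

theorem le_endMax (A : Subalgebra k k⟦X⟧) : A ≤ endMax A := by
  rintro f hf g ⟨h, h'⟩
  exact ⟨A.mul_mem hf h, (Ring.jacobson A).mul_mem_left (⟨f, hf⟩ : A) h'⟩

/-- An increasing chain `R_1 ⊆ R_2 ⊆ ⋯ ⊆ R_len` of `k`-subalgebras of `k⟦t⟧`
(only the values of `ring` at `1, …, len` matter). -/
structure RingChain (k : Type u) [Field k] where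
  len : ℕ
  ring : ℕ → Subalgebra k k⟦X⟧
  mono : ∀ i j : ℕ, 1 ≤ i → i ≤ j → j ≤ len → ring i ≤ ring j

namespace RingChain

variable (C : RingChain k)

/-- A radical chain of numerical semigroup rings: `R_{j+1} ⊆ End(m_j)` for all `j`, the last ring
is the normalization `k⟦t⟧`, and it occurs only at the last place. -/
structure IsRadicalChain : Prop where
  two_le : 2 ≤ C.len
  semigroup : ∀ j, 1 ≤ j → j ≤ C.len → IsNumericalSemigroupRing (C.ring j)
  step : ∀ j, 1 ≤ j → j + 1 ≤ C.len → C.ring (j + 1) ≤ endMax (C.ring j)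
  last : C.ring C.len = ⊤
  before_last : C.ring (C.len - 1) ≠ ⊤

/-- The indices `1, …, len`. -/
abbrev Idx : Type := {j : ℕ // 1 ≤ j ∧ j ≤ C.len}

/-- The summand `R_j` of `M`, as an abelian group; `R_1 ⊆ R_j` acts on it by multiplication. -/
abbrev Piece (j : C.Idx) : Type u := C.ring j

instance (j : C.Idx) : Module (C.ring 1) (C.Piece j) :=
  Module.compHom (C.ring j)
    (Subalgebra.inclusion (C.mono 1 j le_rfl j.2.1 j.2.2)).toRingHom

/-- The `R_1`-module `M = R_1 ⊕ ⋯ ⊕ R_len`. -/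
abbrev M : Type u := ∀ j : C.Idx, C.Piece j

/-- The endomorphism ring `E = End_{R_1}(M)`. -/
def E : Type u := Module.End (C.ring 1) C.M

instance : Ring C.E := inferInstanceAs (Ring (Module.End (C.ring 1) C.M))

/-- `E` is by definition the ring of `R_1`-linear endomorphisms of `M`. -/
def toEnd : C.E ≃+* Module.End (C.ring 1) C.M := RingEquiv.refl _

/-- The idempotent `e_j` of `E`: the projection of `M` onto its summand `R_j`. -/
def e (j : C.Idx) : C.E :=
  C.toEnd.symm
    (LinearMap.single (C.ring 1) (fun b => C.Piece b) j ∘ₗ LinearMap.proj j)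

/-- The right ideal `P_j = e_j E`, a right `E`-module. -/
abbrev P (j : C.Idx) : Submodule C.Eᵐᵒᵖ C.E := principalRight (C.e j)

/-- The right `E`-module `S_j = P_j / e_j J(E)`. -/
abbrev S (j : C.Idx) : Type u := RadQuotient (C.e j)

/-- The quotient map `π_j : P_j → S_j`. -/
abbrev π (j : C.Idx) : C.P j →ₗ[C.Eᵐᵒᵖ] C.S j := radQuotientMk (C.e j)

/-- The matrix entry in row `j`, applied to `v ∈ M`: the `R_j`-component of `φ v`. An element of
`P_j = e_j E` is determined by these components in row `j`, as its other rows vanish. -/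
def row {j : C.Idx} (φ : C.P j) (v : C.M) : k⟦X⟧ := (C.toEnd (φ : C.E) v j : k⟦X⟧)

end RingChain

/-- The rings of the greedy construction, `R_1 = A` and `R_{j+1} = End(m_j)`
(the index `0` is not used). -/
def greedyRing (A : Subalgebra k k⟦X⟧) : ℕ → Subalgebra k k⟦X⟧
  | 0 => A
  | 1 => A
  | j + 2 => endMax (greedyRing A (j + 1))

theorem greedyRing_mono (A : Subalgebra k k⟦X⟧) : Monotone (greedyRing A) := by
  refine monotone_nat_of_le_succ fun j => ?_
  cases j with
  | zero => exact le_rfl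
  | succ j => exact le_endMax _

/-- The greedy chain starting from `A`; it stops at the first index `l` with `R_l = k⟦t⟧`. -/
def greedyChain (A : Subalgebra k k⟦X⟧) : RingChain k where
  len := sInf {l : ℕ | 1 ≤ l ∧ greedyRing A l = ⊤}
  ring := greedyRing A
  mono := fun _ _ _ hij _ => greedyRing_mono A hij

/-- The set of the finite values of `gldim End_{R_1}(R_1 ⊕ ⋯ ⊕ R_l)` over all radical chains
(of numerical semigroup rings) starting from `A`. -/
def globalSpectrum (A : Subalgebra k k⟦X⟧) : Set ℕ :=
  {d | ∃ C : RingChain k, C.IsRadicalChain ∧ C.ring 1 = A ∧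
    globalDim C.Eᵐᵒᵖ = ((d : ℕ∞) : WithBot ℕ∞)}

end Chains

/-! ### The family of starting rings -/

/-- The exponent from which on all exponents occur in `A_n^a(i)`. -/
def familyConductor (n a i : ℕ) : ℕ :=
  if i = 1 then 3 * (n / 2) else a + 1 + (i - 2) * (n / 2)

/-- The numerical semigroup of `A_n^a(i)`: it consists of `0`, the numbers `j n / 2` with
`2 ≤ j ≤ i + 1`, and all integers `≥ 3 n / 2` (if `i = 1`),
resp. `≥ a + 1 + (i - 2) n / 2` (if `i ≥ 2`). -/
def familySemigroup (n a i : ℕ) (hn : Even n) (hn6 : 6 ≤ n) (ha : a ≤ 2 * n - 1)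
    (hi : 1 ≤ i) : AddSubmonoid ℕ where
  carrier := {x | x = 0 ∨ (∃ j, 2 ≤ j ∧ j ≤ i + 1 ∧ x = j * (n / 2)) ∨ familyConductor n a i ≤ x}
  zero_mem' := Or.inl rfl
  add_mem' := by
    have key : familyConductor n a i ≤ (i + 2) * (n / 2) := by
      obtain ⟨h, rfl⟩ := hn
      have hh : (h + h) / 2 = h := by omega
      unfold familyConductor
      rw [hh]
      split_ifs with h1
      · subst h1; omega
      · obtain ⟨i, rfl⟩ : ∃ i', i = i' + 2 := ⟨i - 2, by omega⟩
        have h1 : (i + 2 + 2) * h = i * h + 4 * h := by ring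
        have h2 : i + 2 - 2 = i := by omega
        rw [h1, h2]
        omega
    rintro x y (rfl | ⟨j, hj, hj', rfl⟩ | hx) hy
    · simpa using hy
    · rcases hy with rfl | ⟨j', hj2, hj2', rfl⟩ | hy
      · exact Or.inr (Or.inl ⟨j, hj, hj', by simp⟩)
      · rw [← add_mul]
        by_cases hle : j + j' ≤ i + 1
        · exact Or.inr (Or.inl ⟨j + j', by omega, hle, rfl⟩)
        · exact Or.inr (Or.inr (key.trans (Nat.mul_le_mul_right _ (by omega))))
      · exact Or.inr (Or.inr (hy.trans (Nat.le_add_left _ _)))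
    · exact Or.inr (Or.inr (hx.trans (Nat.le_add_right _ _)))

/-- The starting ring `A(i) = A_n^a(i)`. -/
def startingRing (k : Type u) [Field k] (n a i : ℕ) (hn : Even n) (hn6 : 6 ≤ n) (ha : a ≤ 2 * n - 1)
    (hi : 1 ≤ i) : Subalgebra k k⟦X⟧ :=
  semigroupRing k (familySemigroup n a i hn hn6 ha hi)

end

/-! For a subspace X of k⟦t⟧ write (X) for the right E-module Hom_{R_1}(M, X). All modules that
matter are submodules of Hom_{R_1}(M, k⟦t⟧): P_j = (R_j), multiplication by a nonzero series g gives
(gX) ≅ (X), and e_jJ(E) = (R_{j-1}) + (m_j) for j ≥ 2, with intersection (m_{j-1})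
(`radRows_eq_sup`, `homInto_inf_maxSpace`). Projective dimensions of such sums come from the
sequence 0 → U ∩ W → U × W → U + W → 0.

Upper bounds. Inverting t turns E into a semisimple matrix ring over Laurent series, and modules
with t-torsion contain one of the simples S_j. Baer's criterion then shows that vanishing of Ext
from the S_j detects injectivity, so gldim E is bounded by the projective dimensions of the S_j
(`DetectsTorsion.globalDim_le`, `Strict.detectsTorsion`).

Greedy chains. Here m_j = t^s R_{j+1} with s depending on j (`PrincipalSequence`), so (m_j) ≅
P_{j+1} is projective. The sequence above becomes 0 → P_j → P_{j-1} ⊕ P_{j+1} → e_jJ(E) → 0 for 2 ≤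
j < l, which is the resolution of (a); hence gldim ≤ 2. Equality holds because the sequence for the
last simple does not split: the intersection lies too deep in the t-adic filtration
(`not_projective_sup`).

Large values. Put h = n/2, let L_m be the semigroup `ladder` and Q_m = L_{m+1} \ {h} the semigroup
`punctured`, so that A(i) = R(Q_i) for i ≥ 2. The chain with semigroups Q_i, Q_{i-1}, …, Q_2, L_1,
L_0, ℕ is radical, and every radical chain has finite global dimension (`Radical.globalDim_le`). For
this chain (R(L_{r+4})) is the sum of the projectives (R(Q_{r+3})) and (t^h R(Q_{r+2})), with
intersection t^{3h}(R(L_{r+1})). Each such step moves the index by 3 and raises the projective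
dimension by one, so gldim grows without bound with i (`homInto_ladder`, `punctured_inf_scale`,
`not_projDimLT_ladder`). -/

noncomputable section

/-! ### Projective dimension of modules -/

section Homological

open CategoryTheory

/-- The module `X` has projective dimension `< n`. -/
def ProjDimLT (A : Type u) [Ring A] (X : Type u) [AddCommGroup X] [Module A X] (n : ℕ) : Prop :=
  HasProjectiveDimensionLT (ModuleCat.of A X) n

variable {A : Type u} [Ring A]
variable {X Y Z : Type u} [AddCommGroup X] [Module A X] [AddCommGroup Y] [Module A Y]
  [AddCommGroup Z] [Module A Z]

namespace ProjDimLT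

theorem mono {m n : ℕ} (h : ProjDimLT A X m) (hmn : m ≤ n) : ProjDimLT A X n :=
  haveI : HasProjectiveDimensionLT (ModuleCat.of A X) m := h
  hasProjectiveDimensionLT_of_ge _ m n hmn

theorem of_equiv {n : ℕ} (h : ProjDimLT A X n) (e : X ≃ₗ[A] Y) : ProjDimLT A Y n :=
  haveI : HasProjectiveDimensionLT (ModuleCat.of A X) n := h
  hasProjectiveDimensionLT_of_iso e.toModuleIso n

theorem of_projective (h : Module.Projective A X) : ProjDimLT A X 1 := by
  have := (IsProjective.iff_projective (R := A) X).1 h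
  exact inferInstanceAs (HasProjectiveDimensionLT (ModuleCat.of A X) 1)

theorem projective (h : ProjDimLT A X 1) : Module.Projective A X := by
  have : HasProjectiveDimensionLT (ModuleCat.of A X) 1 := h
  exact (IsProjective.iff_projective (R := A) X).2 inferInstance

theorem third {f : X →ₗ[A] Y} {g : Y →ₗ[A] Z} (hf : Function.Injective f)
    (hfg : Function.Exact f g) (hg : Function.Surjective g) {n : ℕ} (hX : ProjDimLT A X n)
    (hY : ProjDimLT A Y (n + 1)) : ProjDimLT A Z (n + 1) :=
  (ModuleCat.shortComplex_shortExact
    (ModuleCat.shortComplexOfCompEqZero f g hfg.linearMap_comp_eq_zero) hfg hf hg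
    ).hasProjectiveDimensionLT_X₃ n hX hY

theorem first {f : X →ₗ[A] Y} {g : Y →ₗ[A] Z} (hf : Function.Injective f)
    (hfg : Function.Exact f g) (hg : Function.Surjective g) {n : ℕ}
    (hY : ProjDimLT A Y n) (hZ : ProjDimLT A Z (n + 1)) : ProjDimLT A X n :=
  (ModuleCat.shortComplex_shortExact
    (ModuleCat.shortComplexOfCompEqZero f g hfg.linearMap_comp_eq_zero) hfg hf hg
    ).hasProjectiveDimensionLT_X₁ n hY hZ

theorem second {f : X →ₗ[A] Y} {g : Y →ₗ[A] Z} (hf : Function.Injective f)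
    (hfg : Function.Exact f g) (hg : Function.Surjective g) {n : ℕ}
    (hX : ProjDimLT A X n) (hZ : ProjDimLT A Z n) : ProjDimLT A Y n :=
  (ModuleCat.shortComplex_shortExact
    (ModuleCat.shortComplexOfCompEqZero f g hfg.linearMap_comp_eq_zero) hfg hf hg
    ).hasProjectiveDimensionLT_X₂ n hX hZ

theorem prod {n : ℕ} (hX : ProjDimLT A X n) (hY : ProjDimLT A Y n) : ProjDimLT A (X × Y) n :=
  second (f := LinearMap.inl A X Y) (g := LinearMap.snd A X Y) LinearMap.inl_injective
    Function.Exact.inl_snd LinearMap.snd_surjective hX hY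

end ProjDimLT

theorem globalDim_le_iff {d : ℕ} :
    globalDim A ≤ ((d : ℕ∞) : WithBot ℕ∞) ↔
      ∀ (X : Type u) [AddCommGroup X] [Module A X], ProjDimLT A X (d + 1) := by
  unfold globalDim
  rw [iSup_le_iff]
  refine ⟨fun h X _ _ => (projectiveDimension_le_iff _ d).1 (h (ModuleCat.of A X)), fun h X => ?_⟩
  exact (projectiveDimension_le_iff _ d).2 (h X)

/-! ### Bounding the global dimension by a family of test modules -/

variable {ι : Type*} {S : ι → Type u} [∀ s, AddCommGroup (S s)] [∀ s, Module A (S s)]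

/-- A map defined on a submodule extends to the whole module if every proper intermediate quotient
contains a copy of a module `S s` with `Ext¹(S s, Q) = 0`. -/
theorem exists_extension_of_ext_one_eq_zero {Q : Type u} [AddCommGroup Q] [Module A Q]
    (hQ : ∀ s, Subsingleton (Abelian.Ext (ModuleCat.of A (S s)) (ModuleCat.of A Q) 1))
    (i : X →ₗ[A] Y) (hi : Function.Injective i) (f : X →ₗ[A] Q)
    (hD : ∀ D : Submodule A Y, LinearMap.range i ≤ D → D ≠ ⊤ →
      ∃ s, ∃ φ : S s →ₗ[A] Y ⧸ D, Function.Injective φ ∧ ∃ x, φ x ≠ 0) :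
    ∃ g : Y →ₗ[A] Q, ∀ x, g (i x) = f x := by
  have : Fact (Function.Injective i) := ⟨hi⟩
  set m := Module.Baer.extensionOfMax i f with hm
  by_cases htop : m.domain = ⊤
  · refine ⟨m.toLinearPMap.toFun ∘ₗ (LinearEquiv.ofTop m.domain htop).symm.toLinearMap,
      fun x => ?_⟩
    exact (m.is_extension x).symm
  exfalso
  obtain ⟨s, φ, hφ, x₀, hx₀⟩ := hD m.domain m.le htop
  -- `D'` is the preimage of the copy of `S s` in Y/D, which gives an exact sequence 0 → D → D' → S
  -- s → 0.
  let D' : Submodule A Y := (LinearMap.range φ).comap m.domain.mkQ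
  have hle : m.domain ≤ D' := fun x hx =>
    ⟨0, by rw [map_zero]; exact ((Submodule.Quotient.mk_eq_zero _).2 hx).symm⟩
  let q : D' →ₗ[A] S s := (LinearEquiv.ofInjective φ hφ).symm.toLinearMap ∘ₗ
    (m.domain.mkQ.restrict (p := D') (q := LinearMap.range φ) fun x hx => hx)
  have hqφ : ∀ x : D', φ (q x) = m.domain.mkQ x := fun x => by
    have := congrArg Subtype.val ((LinearEquiv.ofInjective φ hφ).apply_symm_apply
      ((m.domain.mkQ.restrict (p := D') (q := LinearMap.range φ) fun x hx => hx) x))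
    simp [q] 
  have hq : Function.Surjective q := fun y => by
    obtain ⟨x, hx⟩ := m.domain.mkQ_surjective (φ y)
    refine ⟨⟨x, y, hx.symm⟩, hφ ?_⟩
    rw [hqφ]; exact hx
  let j : m.domain →ₗ[A] D' := Submodule.inclusion hle
  have hj : Function.Injective j := Submodule.inclusion_injective hle
  have hjq : Function.Exact j q := fun x => by
    rw [← hφ.eq_iff, map_zero, hqφ, Submodule.mkQ_apply, Submodule.Quotient.mk_eq_zero]
    refine ⟨fun h => ⟨⟨x, h⟩, rfl⟩, ?_⟩
    rintro ⟨y, rfl⟩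
    exact y.2
  have hS := ModuleCat.shortComplex_shortExact
    (ModuleCat.shortComplexOfCompEqZero j q hjq.linearMap_comp_eq_zero) hjq hj hq
  -- The obstruction to extending the maximal partial map from D to D' lies in Ext¹(S s, Q) = 0; the
  -- extension contradicts maximality, since D' is strictly larger.
  obtain ⟨x₂, hx₂⟩ := Abelian.Ext.contravariant_sequence_exact₁ hS _
    (Abelian.Ext.mk₀ (ModuleCat.ofHom m.toLinearPMap.toFun)) (add_zero 1)
    (@Subsingleton.elim _ (hQ s) _ _)
  obtain ⟨g, rfl⟩ := (Abelian.Ext.mk₀_bijective _ _).2 x₂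
  rw [Abelian.Ext.mk₀_comp_mk₀, (Abelian.Ext.mk₀_bijective _ _).1.eq_iff] at hx₂
  have hg : ∀ x : m.domain, g.hom (j x) = m.toLinearPMap.toFun x := fun x =>
    congrArg (fun t => t.hom x) hx₂
  let m' : Module.Baer.ExtensionOf i f :=
    { domain := D'
      toFun := g.hom
      le := m.le.trans hle
      is_extension := fun x => (m.is_extension x).trans (hg _).symm }
  have hmm : m ≤ m' := by
    change m.toLinearPMap ≤ m'.toLinearPMap
    refine ⟨hle, fun x y hxy => ?_⟩
    rw [show y = j x from Subtype.ext hxy.symm]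
    exact (hg x).symm
  have heq := Module.Baer.extensionOfMax_is_max i f m' hmm
  have hdom : D' = m.domain := congrArg (fun t => t.domain) heq
  obtain ⟨y, hy⟩ := m.domain.mkQ_surjective (φ x₀)
  have : y ∈ D' := ⟨x₀, hy.symm⟩
  rw [hdom] at this
  exact hx₀ (hy.symm.trans ((Submodule.Quotient.mk_eq_zero _).2 this))

/-- The ring `A` has a regular central element `z` such that every left ideal is, up to powers
of `z`, generated by an idempotent, and every module with `z`-torsion contains one of the nonzero
modules `S s`. -/
structure DetectsTorsion (A : Type u) [Ring A] {ι : Type*} (S : ι → Type u)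
    [∀ s, AddCommGroup (S s)] [∀ s, Module A (S s)] (z : A) : Prop where
  comm : ∀ a : A, a * z = z * a
  regular : ∀ a : A, z * a = 0 → a = 0
  almost_idempotent : ∀ I : Ideal A, ∃ p ∈ I, ∃ m : ℕ, ∀ x ∈ I, x * p = z ^ m * x
  nontrivial : ∀ s, Nontrivial (S s)
  embeds : ∀ (Y : Type u) [AddCommGroup Y] [Module A Y] (y : Y) (m : ℕ), y ≠ 0 → z ^ m • y = 0 →
    ∃ s, ∃ φ : S s →ₗ[A] Y, Function.Injective φ

namespace DetectsTorsion

variable {z : A} (h : DetectsTorsion A S z)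
include h

theorem pow_comm (m : ℕ) (a : A) : a * z ^ m = z ^ m * a := by
  have : Commute a z := h.comm a
  exact (this.pow_right m)

theorem pow_regular (m : ℕ) (a : A) (ha : z ^ m * a = 0) : a = 0 := by
  induction m with
  | zero => simpa using ha
  | succ m ih => exact ih (h.regular _ (by rwa [pow_succ', mul_assoc] at ha))

/-- By Baer's criterion it suffices to extend f : I → Q to A. The cokernel of z^m on I is torsion,
so f extends along z^m : I → I to some g with g(z^m x) = f(x). Since z^m x = x p, this gives f(x) =
g(x p) = x g(p), and a ↦ a g(p) is the required extension. -/
theorem injective_of_ext_one_eq_zero (Q : Type u) [AddCommGroup Q] [Module A Q]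
    (hQ : ∀ s, Subsingleton (Abelian.Ext (ModuleCat.of A (S s)) (ModuleCat.of A Q) 1)) :
    Module.Injective A Q := by
  refine Module.Baer.injective fun I f => ?_
  obtain ⟨p, hp, m, hpm⟩ := h.almost_idempotent I
  let i : I →ₗ[A] I :=
    { toFun := fun x => z ^ m • x
      map_add' := fun x y => smul_add _ _ _
      map_smul' := fun a x => by
        rw [RingHom.id_apply, smul_smul, smul_smul, h.pow_comm] }
  have hi : Function.Injective i := by
    rw [injective_iff_map_eq_zero]
    intro x hx
    exact Subtype.ext (h.pow_regular m _ (congrArg Subtype.val hx))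
  obtain ⟨g, hg⟩ := exists_extension_of_ext_one_eq_zero hQ i hi f fun D hD htop => by
    obtain ⟨y, hy⟩ : ∃ y, y ∉ D := by
      by_contra! hcon
      exact htop (eq_top_iff.2 fun y _ => hcon y)
    obtain ⟨s, φ, hφ⟩ := h.embeds (I ⧸ D) (D.mkQ y) m
      (fun h0 => hy ((Submodule.Quotient.mk_eq_zero _).1 h0)) (by
        rw [← map_smul]
        exact (Submodule.Quotient.mk_eq_zero _).2 (hD ⟨y, rfl⟩))
    have := h.nontrivial s
    obtain ⟨x, hx⟩ := exists_ne (0 : S s)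
    exact ⟨s, φ, hφ, x, fun h0 => hx (hφ (h0.trans (map_zero φ).symm))⟩
  refine ⟨g ∘ₗ (LinearMap.toSpanSingleton A I ⟨p, hp⟩), fun x hx => ?_⟩
  rw [← hg ⟨x, hx⟩]
  exact congrArg g (Subtype.ext (hpm x hx))

/-- Dimension shifting along an embedding of X into an injective module reduces to the injectivity
test. -/
theorem hasInjectiveDimensionLT (d : ℕ) (X : ModuleCat.{u} A)
    (hX : ∀ s, Subsingleton (Abelian.Ext (ModuleCat.of A (S s)) X (d + 1))) :
    HasInjectiveDimensionLT X (d + 1) := by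
  induction d generalizing X with
  | zero =>
    have := h.injective_of_ext_one_eq_zero X hX
    have : Injective X := (Module.injective_iff_injective_object A X).1 this
    infer_instance
  | succ d ih =>
    obtain ⟨I, _, f, _⟩ := EnoughInjectives.presentation X
    have hS : (ShortComplex.mk _ _ (Limits.cokernel.condition f)).ShortExact :=
      { exact := ShortComplex.exact_cokernel f }
    refine (hS.hasInjectiveDimensionLT_X₃_iff d ‹_›).1 (ih _ fun s => ⟨fun a b => ?_⟩)
    rw [← sub_eq_zero]
    obtain ⟨x₂, hx₂⟩ := Abelian.Ext.covariant_sequence_exact₃ _ hS (a - b) rfl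
      (@Subsingleton.elim _ (hX s) _ _)
    rw [← hx₂, Abelian.Ext.eq_zero_of_injective x₂, Abelian.Ext.zero_comp]

/-- The global dimension of `A` is bounded by the projective dimensions of the test modules. -/
theorem globalDim_le (d : ℕ) (hd : ∀ s, ProjDimLT A (S s) (d + 1)) :
    globalDim A ≤ ((d : ℕ∞) : WithBot ℕ∞) := by
  rw [globalDim_le_iff]
  intro Y _ _
  -- The condition on Y is vanishing of Ext^{d+1}(Y, X) for every X, which is read off the injective
  -- dimension of X.
  refine hasProjectiveDimensionLT_of_enoughInjectives _ _ fun X => ?_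
  have hX := h.hasInjectiveDimensionLT d X fun s => by
    have : HasProjectiveDimensionLT (ModuleCat.of A (S s)) (d + 1) := hd s
    exact HasProjectiveDimensionLT.subsingleton _ (d + 1) _ le_rfl _
  exact HasInjectiveDimensionLT.subsingleton _ (d + 1) _ le_rfl _

end DetectsTorsion

end Homological


/-! ### Rows: homomorphisms from `M` into `k⟦t⟧` as a right module over `E` -/

section RowModules

variable {k : Type u} [Field k]

namespace RingChain

variable (C : RingChain k)

instance : Fintype C.Idx := Fintype.subtype (Finset.Icc 1 C.len) (by simp)

/-- The `R_1`-linear maps `M → k⟦t⟧`, a right `E`-module by precomposition. -/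
def Rows : Type u := C.M →ₗ[C.ring 1] k⟦X⟧

instance : AddCommGroup C.Rows := inferInstanceAs (AddCommGroup (C.M →ₗ[C.ring 1] k⟦X⟧))

instance : FunLike C.Rows C.M k⟦X⟧ := inferInstanceAs (FunLike (C.M →ₗ[C.ring 1] k⟦X⟧) _ _)

instance : LinearMapClass C.Rows (C.ring 1) C.M k⟦X⟧ :=
  inferInstanceAs (LinearMapClass (C.M →ₗ[C.ring 1] k⟦X⟧) (C.ring 1) C.M k⟦X⟧)

instance : Module C.Eᵐᵒᵖ C.Rows where
  smul x φ := LinearMap.comp (φ : C.M →ₗ[C.ring 1] k⟦X⟧) (C.toEnd x.unop)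
  one_smul _ := rfl
  mul_smul _ _ _ := rfl
  smul_zero _ := rfl
  smul_add _ _ _ := rfl
  add_smul x y φ := LinearMap.ext fun v => map_add φ (C.toEnd x.unop v) (C.toEnd y.unop v)
  zero_smul φ := LinearMap.ext fun _ => map_zero φ

namespace Rows

variable {C}

@[ext] theorem ext {φ ψ : C.Rows} (h : ∀ v, φ v = ψ v) : φ = ψ := DFunLike.ext _ _ h

@[simp] theorem zero_apply (v : C.M) : (0 : C.Rows) v = 0 := rfl
@[simp] theorem sub_apply (φ ψ : C.Rows) (v : C.M) : (φ - ψ) v = φ v - ψ v := rfl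
@[simp] theorem smul_apply (x : C.Eᵐᵒᵖ) (φ : C.Rows) (v : C.M) :
    (x • φ) v = φ (C.toEnd x.unop v) := rfl

/-- Multiplication by a power series, as an endomorphism of the right `E`-module of rows. -/
def mulBy (g : k⟦X⟧) : C.Rows →ₗ[C.Eᵐᵒᵖ] C.Rows where
  toFun φ :=
    { toFun := fun v => g * φ v
      map_add' := fun v w => by rw [map_add, mul_add]
      map_smul' := fun r v => by rw [map_smul, RingHom.id_apply, mul_smul_comm] }
  map_add' _ _ := LinearMap.ext fun _ => mul_add _ _ _
  map_smul' _ _ := rfl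

@[simp] theorem mulBy_apply (g : k⟦X⟧) (φ : C.Rows) (v : C.M) : mulBy g φ v = g * φ v := rfl

end Rows

/-- The standard generator of the summand `R_b` of `M`. -/
def gen (b : C.Idx) : C.M := Pi.single b 1

/-- The right `E`-module `Hom_{R_1}(M, X)` for a subspace `X ⊆ k⟦t⟧`. -/
def homInto (X : Submodule k k⟦X⟧) : Submodule C.Eᵐᵒᵖ C.Rows where
  carrier := {φ | ∀ v, φ v ∈ X}
  add_mem' h h' v := X.add_mem (h v) (h' v)
  zero_mem' _ := X.zero_mem
  smul_mem' _ _ h _ := h _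

theorem homInto_mono {X Y : Submodule k k⟦X⟧} (h : X ≤ Y) : C.homInto X ≤ C.homInto Y :=
  fun _ hφ v => h (hφ v)

theorem homInto_inf (X Y : Submodule k k⟦X⟧) :
    C.homInto (X ⊓ Y) = C.homInto X ⊓ C.homInto Y := by
  ext φ
  exact forall_and

/-- The summand `R_j`, as a subspace of `k⟦t⟧`. -/
def pieceSpace (j : C.Idx) : Submodule k k⟦X⟧ := Subalgebra.toSubmodule (C.ring j)

/-- The `j`-th row of an endomorphism of `M`. -/
def rowOf (x : C.E) (j : C.Idx) : C.Rows where
  toFun v := (C.toEnd x v j : k⟦X⟧)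
  map_add' v w := by rw [map_add]; rfl
  map_smul' r v := by rw [map_smul]; rfl

@[simp] theorem rowOf_apply (x : C.E) (j : C.Idx) (v : C.M) :
    C.rowOf x j v = (C.toEnd x v j : k⟦X⟧) := rfl

theorem rowOf_mem (x : C.E) (j : C.Idx) : C.rowOf x j ∈ C.homInto (C.pieceSpace j) :=
  fun v => (C.toEnd x v j).2

/-- The endomorphism of `M` with given rows. -/
def ofRows (ψ : ∀ j, C.homInto (C.pieceSpace j)) : C.E :=
  C.toEnd.symm
    { toFun := fun v j => ⟨(ψ j : C.Rows) v, (ψ j).2 v⟩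
      map_add' := fun v w => funext fun j => Subtype.ext (map_add (ψ j : C.Rows) v w)
      map_smul' := fun r v => funext fun j => Subtype.ext (map_smul (ψ j : C.Rows) r v) }

@[simp] theorem toEnd_ofRows (ψ : ∀ j, C.homInto (C.pieceSpace j)) (v : C.M) (j : C.Idx) :
    (C.toEnd (C.ofRows ψ) v j : k⟦X⟧) = (ψ j : C.Rows) v := rfl

@[simp] theorem rowOf_ofRows (ψ : ∀ j, C.homInto (C.pieceSpace j)) (j : C.Idx) :
    C.rowOf (C.ofRows ψ) j = ψ j := rfl

variable {C} in
theorem E_ext {x y : C.E} (h : ∀ j, C.rowOf x j = C.rowOf y j) : x = y := by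
  apply C.toEnd.injective
  refine LinearMap.ext fun v => funext fun j => Subtype.ext ?_
  exact DFunLike.congr_fun (h j) v

theorem rowOf_mul (x y : C.E) (j : C.Idx) :
    C.rowOf (x * y) j = MulOpposite.op y • C.rowOf x j := rfl

/-- The linear map taking an endomorphism to its `j`-th row. -/
def rowLinear (j : C.Idx) : C.E →ₗ[C.Eᵐᵒᵖ] C.homInto (C.pieceSpace j) where
  toFun x := ⟨C.rowOf x j, C.rowOf_mem x j⟩
  map_add' _ _ := rfl
  map_smul' _ _ := rfl

theorem rowOf_e_self (j : C.Idx) (v : C.M) : C.rowOf (C.e j) j v = (v j : k⟦X⟧) := by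
  simp [e]

theorem toEnd_e (j : C.Idx) (v : C.M) : C.toEnd (C.e j) v = Pi.single j (v j) := by
  simp [e]

theorem e_mul_apply (j : C.Idx) (x : C.E) (v : C.M) :
    C.toEnd (C.e j * x) v = Pi.single j (C.toEnd x v j) := by
  rw [map_mul, Module.End.mul_apply, toEnd_e]

theorem e_mul_e (j : C.Idx) : C.e j * C.e j = C.e j := by
  apply C.toEnd.injective
  refine LinearMap.ext fun v => ?_
  rw [e_mul_apply, toEnd_e, Pi.single_eq_same]

theorem mem_P {j : C.Idx} {x : C.E} : x ∈ C.P j ↔ C.e j * x = x := by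
  constructor
  · intro h
    obtain ⟨a, rfl⟩ := Submodule.mem_span_singleton.1 h
    rw [← MulOpposite.op_unop a, op_smul_eq_mul, ← mul_assoc, e_mul_e]
  · intro h
    exact Submodule.mem_span_singleton.2 ⟨MulOpposite.op x, by rw [op_smul_eq_mul, h]⟩

theorem e_mem_P (j : C.Idx) : C.e j ∈ C.P j := C.mem_P.2 (C.e_mul_e j)

theorem sum_e : ∑ j, C.e j = 1 := by
  apply C.toEnd.injective
  refine LinearMap.ext fun v => ?_
  rw [map_sum, map_one, LinearMap.sum_apply]
  simp_rw [toEnd_e]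
  exact Finset.univ_sum_single v

theorem projective_P (j : C.Idx) : Module.Projective C.Eᵐᵒᵖ (C.P j) := by
  let p : C.E →ₗ[C.Eᵐᵒᵖ] C.P j :=
    { toFun := fun x => ⟨C.e j * x, C.mem_P.2 (by rw [← mul_assoc, e_mul_e])⟩
      map_add' := fun x y => Subtype.ext (mul_add _ _ _)
      map_smul' := fun a x => Subtype.ext (by
        rw [← MulOpposite.op_unop a, op_smul_eq_mul]
        simp [mul_assoc]) }
  have hE : Module.Projective C.Eᵐᵒᵖ C.E :=
    Module.Projective.of_equiv (MulOpposite.opLinearEquiv C.Eᵐᵒᵖ : C.E ≃ₗ[C.Eᵐᵒᵖ] C.Eᵐᵒᵖ).symm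
  refine Module.Projective.of_split (C.P j).subtype p (LinearMap.ext fun x => Subtype.ext ?_)
  exact C.mem_P.1 x.2

/-- The right module `P_j = e_j E` is `Hom_{R_1}(M, R_j)`. -/
def rowEquiv (j : C.Idx) : C.P j ≃ₗ[C.Eᵐᵒᵖ] C.homInto (C.pieceSpace j) :=
  LinearEquiv.ofBijective ((C.rowLinear j).domRestrict (C.P j)) (by
    constructor
    · intro x y h
      refine Subtype.ext (C.toEnd.injective (LinearMap.ext fun v => ?_))
      rw [← C.mem_P.1 x.2, ← C.mem_P.1 y.2, e_mul_apply, e_mul_apply]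
      congr 1
      exact Subtype.ext (DFunLike.congr_fun (congrArg Subtype.val h) v)
    · intro ψ
      classical
      refine ⟨⟨C.e j * C.ofRows (Pi.single j ψ), C.mem_P.2 (by rw [← mul_assoc, e_mul_e])⟩, ?_⟩
      refine Subtype.ext (Rows.ext fun v => ?_)
      change (C.toEnd (C.e j * _) v j : k⟦X⟧) = _
      rw [e_mul_apply, Pi.single_eq_same, toEnd_ofRows, Pi.single_eq_same])

theorem rowEquiv_apply {j : C.Idx} (φ : C.P j) (v : C.M) :
    (C.rowEquiv j φ : C.Rows) v = C.row φ v := rfl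

end RingChain

end RowModules


/-! ### The matrix description of E and its Jacobson radical. -/

section Radical

variable {k : Type u} [Field k]

namespace RingChain

variable (C : RingChain k)

/-- A strictly increasing chain of local subrings of `k⟦t⟧` of finite codimension. -/
structure Strict : Prop where
  conductor : ∃ c, 1 ≤ c ∧ ∀ f : k⟦X⟧, PowerSeries.X ^ c * f ∈ C.ring 1
  inv_mem : ∀ j : C.Idx, ∀ f ∈ C.ring j, PowerSeries.constantCoeff f ≠ 0 → f⁻¹ ∈ C.ring j
  lt : ∀ i j : C.Idx, i < j → ∃ f ∈ C.ring j, f ∉ C.ring i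

theorem smul_single (u : C.ring 1) (b : C.Idx) (r : C.ring b) :
    u • (Pi.single b r : C.M) = Pi.single b (u • r : C.Piece b) := by
  funext i
  rw [Pi.smul_apply]
  by_cases h : i = b
  · subst h
    rw [Pi.single_eq_same, Pi.single_eq_same]
  · rw [Pi.single_eq_of_ne h, Pi.single_eq_of_ne h]
    exact smul_zero u

theorem coe_smul_piece (u : C.ring 1) (b : C.Idx) (r : C.Piece b) :
    ((u • r : C.Piece b) : k⟦X⟧) = u * r := rfl

theorem ring_one_le (b : C.Idx) : C.ring 1 ≤ C.ring b := C.mono 1 b le_rfl b.2.1 b.2.2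

/-- The row with prescribed components. -/
def ofComponents (g : C.Idx → k⟦X⟧) : C.Rows where
  toFun v := ∑ b, (v b : k⟦X⟧) * g b
  map_add' v w := by
    rw [← Finset.sum_add_distrib]
    exact Finset.sum_congr rfl fun b _ => add_mul _ _ _
  map_smul' r v := by
    rw [RingHom.id_apply, Finset.smul_sum]
    exact Finset.sum_congr rfl fun b _ => mul_assoc _ _ _

theorem ofComponents_apply (g : C.Idx → k⟦X⟧) (v : C.M) :
    C.ofComponents g v = ∑ b, (v b : k⟦X⟧) * g b := rfl

@[simp] theorem ofComponents_gen (g : C.Idx → k⟦X⟧) (b : C.Idx) :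
    C.ofComponents g (C.gen b) = g b := by
  rw [ofComponents_apply, Finset.sum_eq_single b]
  · simp [gen]
  · intro i _ hi
    simp [gen, Pi.single_eq_of_ne hi]
  · simp

/-- Scalar multiplication by an element of `R_1`, as an element of `E`. -/
def scalar (u : C.ring 1) : C.E :=
  C.toEnd.symm (algebraMap (C.ring 1) (Module.End (C.ring 1) C.M) u)

theorem toEnd_scalar (u : C.ring 1) (v : C.M) : C.toEnd (C.scalar u) v = u • v := by
  simp [scalar]

theorem scalar_comm (u : C.ring 1) (x : C.E) : C.scalar u * x = x * C.scalar u := by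
  apply C.toEnd.injective
  refine LinearMap.ext fun v => ?_
  rw [map_mul, map_mul, Module.End.mul_apply, Module.End.mul_apply, toEnd_scalar, toEnd_scalar,
    map_smul]

namespace Strict

variable {C} (hC : C.Strict)
include hC

/-- An R_1-linear map on R_b is automatically R_b-linear: t^c k⟦t⟧ ⊆ R_1, so the identity holds
after multiplication by t^c, which can be cancelled. -/
theorem apply_single (φ : C.Rows) (b : C.Idx) (r : C.ring b) :
    φ (Pi.single b r) = r * φ (C.gen b) := by
  obtain ⟨c, -, hc⟩ := hC.conductor
  have h1 : (PowerSeries.X : k⟦X⟧) ^ c ∈ C.ring 1 := by simpa using hc 1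
  have h : (⟨_, h1⟩ : C.ring 1) • (Pi.single b r : C.M) = (⟨_, hc r⟩ : C.ring 1) • C.gen b := by
    rw [gen, smul_single, smul_single]
    congr 1
    apply Subtype.ext
    rw [coe_smul_piece, coe_smul_piece]
    simp
  have h' := congrArg φ h
  rw [map_smul, map_smul, Subalgebra.smul_def, Subalgebra.smul_def, smul_eq_mul, smul_eq_mul,
    mul_assoc] at h'
  exact mul_left_cancel₀ (pow_ne_zero _ PowerSeries.X_ne_zero) h'

theorem apply_eq_sum (φ : C.Rows) (v : C.M) : φ v = ∑ b, (v b : k⟦X⟧) * φ (C.gen b) := by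
  conv_lhs => rw [← Finset.univ_sum_single v, map_sum]
  exact Finset.sum_congr rfl fun b _ => hC.apply_single φ b (v b)

theorem rows_ext {φ ψ : C.Rows} (h : ∀ b, φ (C.gen b) = ψ (C.gen b)) : φ = ψ := by
  refine Rows.ext fun v => ?_
  rw [hC.apply_eq_sum, hC.apply_eq_sum]
  simp_rw [h]

theorem mem_homInto_iff {X : Submodule k k⟦X⟧} {φ : C.Rows} :
    φ ∈ C.homInto X ↔ ∀ b : C.Idx, ∀ r ∈ C.ring b, r * φ (C.gen b) ∈ X := by
  constructor
  · intro h b r hr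
    rw [← hC.apply_single φ b ⟨r, hr⟩]
    exact h _
  · intro h v
    rw [hC.apply_eq_sum]
    exact X.sum_mem fun b _ => h b _ (v b).2

/-- If the value at 1 ∈ R_b were a unit, it would be a unit of R_i, and then R_b ⊆ R_i, against
strictness of the chain. -/
theorem constantCoeff_eq_zero {i b : C.Idx} (hib : i < b) {φ : C.Rows}
    (hφ : φ ∈ C.homInto (C.pieceSpace i)) : PowerSeries.constantCoeff (φ (C.gen b)) = 0 := by
  by_contra h0
  obtain ⟨f, hf, hf'⟩ := hC.lt i b hib
  have h := hC.mem_homInto_iff.1 hφ b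
  have hinv := hC.inv_mem i _ (hφ (C.gen b)) h0
  refine hf' ?_
  have := (C.ring i).mul_mem (h f hf) hinv
  rwa [mul_assoc, PowerSeries.mul_inv_cancel _ h0, mul_one] at this

/-- The matrix of an endomorphism of `M`. -/
def toMatrix : C.E →+* Matrix C.Idx C.Idx k⟦X⟧ where
  toFun x := Matrix.of fun j b => C.rowOf x j (C.gen b)
  map_one' := by
    ext1 j b
    rw [Matrix.of_apply, rowOf_apply, map_one, Module.End.one_apply, gen]
    by_cases h : j = b
    · subst h; simp
    · simp [h]
  map_zero' := rfl
  map_add' _ _ := rfl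
  map_mul' x y := by
    ext1 j b
    rw [Matrix.mul_apply, Matrix.of_apply, rowOf_mul, Rows.smul_apply, hC.apply_eq_sum]
    exact Finset.sum_congr rfl fun i _ => mul_comm _ _

theorem toMatrix_apply (x : C.E) (j b : C.Idx) :
    hC.toMatrix x j b = C.rowOf x j (C.gen b) := rfl

theorem toMatrix_injective : Function.Injective hC.toMatrix := fun _ _ h =>
  E_ext fun j => hC.rows_ext fun b => congrFun (congrFun h j) b

theorem exists_toMatrix_eq (m : Matrix C.Idx C.Idx k⟦X⟧)
    (hm : ∀ j b : C.Idx, ∀ r ∈ C.ring b, r * m j b ∈ C.ring j) : ∃ x, hC.toMatrix x = m := by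
  refine ⟨C.ofRows fun j => ⟨C.ofComponents (m j), ?_⟩, ?_⟩
  · rw [hC.mem_homInto_iff]
    intro b r hr
    rw [ofComponents_gen]
    exact hm j b r hr
  · ext1 j b
    rw [toMatrix_apply, rowOf_ofRows, ofComponents_gen]

theorem exists_toMatrix_eq_of_dvd {c : ℕ} (hc : ∀ f : k⟦X⟧, PowerSeries.X ^ c * f ∈ C.ring 1)
    (m : Matrix C.Idx C.Idx k⟦X⟧) (hm : ∀ j b : C.Idx, PowerSeries.X ^ c ∣ m j b) :
    ∃ x, hC.toMatrix x = m := by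
  refine hC.exists_toMatrix_eq m fun j b r _ => ?_
  obtain ⟨g, hg⟩ := hm j b
  rw [hg, mul_left_comm]
  exact C.ring_one_le j (hc _)

theorem toMatrix_scalar (u : C.ring 1) (x : C.E) (j b : C.Idx) :
    hC.toMatrix (C.scalar u * x) j b = u * hC.toMatrix x j b := by
  rw [toMatrix_apply, toMatrix_apply, rowOf_apply, map_mul, Module.End.mul_apply, toEnd_scalar]
  rfl

/-! ### Weights -/

theorem coeff_zero_toMatrix (x : C.E) {j b : C.Idx} (h : j < b) :
    PowerSeries.constantCoeff (hC.toMatrix x j b) = 0 :=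
  hC.constantCoeff_eq_zero h (C.rowOf_mem x j)

/-- The `(j, b)` entry of `x`, given weight `len · order + j - b`, has weight at least `N`. -/
def HasWeight (N : ℕ) (x : C.E) : Prop :=
  ∀ (j b : C.Idx) (d : ℕ), C.len * d + j < N + b → PowerSeries.coeff d (hC.toMatrix x j b) = 0

/-- Entries of positive order have positive weight because |j - b| < `len`; in order 0 only the
entries with j < b have negative weight, and their constant terms vanish. -/
theorem hasWeight_zero (x : C.E) : hC.HasWeight 0 x := by
  intro j b d h
  have hb := b.2.2
  have hj := j.2.1
  rcases Nat.eq_zero_or_pos d with rfl | hd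
  · rw [PowerSeries.coeff_zero_eq_constantCoeff_apply]
    exact hC.coeff_zero_toMatrix x (Subtype.coe_lt_coe.1 (by omega))
  · have := Nat.le_mul_of_pos_right C.len hd
    omega

theorem hasWeight_one {x : C.E} (hx : ∀ j, PowerSeries.constantCoeff (hC.toMatrix x j j) = 0) :
    hC.HasWeight 1 x := by
  intro j b d h
  have hb := b.2.2
  have hj := j.2.1
  rcases Nat.eq_zero_or_pos d with rfl | hd
  · rw [PowerSeries.coeff_zero_eq_constantCoeff_apply]
    rcases (show (j : ℕ) ≤ b by omega).lt_or_eq with hlt | heq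
    · exact hC.coeff_zero_toMatrix x hlt
    · rw [Subtype.ext heq]; exact hx b
  · have := Nat.le_mul_of_pos_right C.len hd
    omega

theorem HasWeight.mul {x y : C.E} {N N' : ℕ} (hx : hC.HasWeight N x) (hy : hC.HasWeight N' y) :
    hC.HasWeight (N + N') (x * y) := by
  intro j b d h
  rw [map_mul, Matrix.mul_apply, map_sum]
  refine Finset.sum_eq_zero fun i _ => ?_
  rw [PowerSeries.coeff_mul]
  refine Finset.sum_eq_zero fun p hp => ?_
  have hp : p.1 + p.2 = d := by simpa using hp
  by_cases h1 : C.len * p.1 + j < N + i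
  · rw [hx _ _ _ h1, zero_mul]
  · rw [hy _ _ _ (by rw [← hp, mul_add] at h; omega), mul_zero]

theorem HasWeight.pow {x : C.E} (hx : hC.HasWeight 1 x) (N : ℕ) : hC.HasWeight N (x ^ N) := by
  induction N with
  | zero => exact hC.hasWeight_zero _
  | succ N ih => rw [pow_succ]; exact ih.mul hC hx

theorem HasWeight.dvd {x : C.E} {N e : ℕ} (hx : hC.HasWeight N x) (h : C.len * e ≤ N)
    (j b : C.Idx) : PowerSeries.X ^ e ∣ hC.toMatrix x j b := by
  rw [PowerSeries.X_pow_dvd_iff]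
  intro d hd
  refine hx j b d ?_
  have h1 : C.len * (d + 1) ≤ C.len * e := Nat.mul_le_mul_left _ hd
  have hj := j.2.2
  have hb := b.2.1
  rw [mul_add] at h1
  omega

/-! ### Units and the Jacobson radical -/

theorem isUnit_of_toMatrix {x y : C.E} (h : hC.toMatrix x * hC.toMatrix y = 1) : IsUnit x :=
  isUnit_iff_exists.2 ⟨y, hC.toMatrix_injective (by rw [map_mul, h, map_one]),
    hC.toMatrix_injective (by rw [map_mul, mul_eq_one_comm.1 h, map_one])⟩

/-- Such an x has weight at least 1, so y = x^(len·c) has all entries divisible by t^c. Over k⟦t⟧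
the matrix 1 - y has an inverse w, and w = 1 + yw. The entries of yw are divisible by t^c, so w lies
in E. -/
theorem isUnit_one_sub {x : C.E}
    (hx : ∀ j, PowerSeries.constantCoeff (hC.toMatrix x j j) = 0) : IsUnit (1 - x) := by
  obtain ⟨c, hc1, hc⟩ := hC.conductor
  set y := x ^ (C.len * c) with hy
  have hdvd := ((hC.hasWeight_one hx).pow hC (C.len * c)).dvd hC le_rfl
  rw [← hy] at hdvd
  have hunit : IsUnit (1 - y) := by
    have hdet : IsUnit (1 - hC.toMatrix y).det := by
      rw [PowerSeries.isUnit_iff_constantCoeff, RingHom.map_det, map_sub, map_one]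
      have : (PowerSeries.constantCoeff (R := k)).mapMatrix (hC.toMatrix y) = 0 := by
        ext j b
        obtain ⟨g, hg⟩ := hdvd j b
        simp [hg, zero_pow (by omega : c ≠ 0)]
      rw [this, sub_zero, Matrix.det_one]
      exact isUnit_one
    obtain ⟨w, hw⟩ := ((Matrix.isUnit_iff_isUnit_det _).2 hdet).exists_right_inv
    obtain ⟨v, hv⟩ := hC.exists_toMatrix_eq_of_dvd hc (hC.toMatrix y * w) fun j b => by
      rw [Matrix.mul_apply]
      exact Finset.dvd_sum fun i _ => Dvd.dvd.mul_right (hdvd j i) _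
    refine hC.isUnit_of_toMatrix (y := 1 + v) ?_
    rw [map_sub, map_add, map_one, hv]
    have : 1 + hC.toMatrix y * w = w := by
      rw [sub_mul, one_mul, sub_eq_iff_eq_add] at hw
      exact hw.symm
    rw [this, hw]
  -- 1 - x^N is the product of 1 - x and a geometric sum; the factors commute, so both are units.
  rw [hy, ← mul_neg_geom_sum] at hunit
  refine ((Commute.isUnit_mul_iff ?_).1 hunit).1
  exact Commute.sum_right _ _ _ fun i _ =>
    (((Commute.one_left x).sub_left (Commute.refl x)).pow_right i)

theorem constantCoeff_toMatrix_mul (x y : C.E) (j : C.Idx) :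
    PowerSeries.constantCoeff (hC.toMatrix (x * y) j j) =
      PowerSeries.constantCoeff (hC.toMatrix x j j) *
        PowerSeries.constantCoeff (hC.toMatrix y j j) := by
  rw [map_mul, Matrix.mul_apply, map_sum, Finset.sum_eq_single j]
  · rw [map_mul]
  · intro i _ hi
    rw [map_mul]
    rcases lt_or_gt_of_ne hi with h | h
    · rw [hC.coeff_zero_toMatrix y h, mul_zero]
    · rw [hC.coeff_zero_toMatrix x h, zero_mul]
  · simp

/-- The constant term of a diagonal entry is multiplicative in x, since one of the entries (j, i)
and (i, j) has zero constant term for i ≠ j. These constant terms are therefore characters E → k,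
and their common kernel is quasi-regular by `isUnit_one_sub`. -/
theorem mem_jacobson_iff {x : C.E} : x ∈ Ring.jacobson C.E ↔
    ∀ j, PowerSeries.constantCoeff (hC.toMatrix x j j) = 0 := by
  rw [← Ideal.jacobson_bot, Ideal.mem_jacobson_iff]
  constructor
  · intro h j
    by_contra h0
    set a := PowerSeries.constantCoeff (hC.toMatrix x j j) with ha
    -- The scalar -a⁻¹ makes the (j, j) constant term of w(-a⁻¹)x + w - 1 equal to -w + w - 1 = -1,
    -- although the element is zero.
    obtain ⟨w, hw⟩ := h (C.scalar (algebraMap k (C.ring 1) (-a⁻¹)))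
    rw [Ideal.mem_bot] at hw
    have h1 := congrArg (fun t => PowerSeries.constantCoeff (hC.toMatrix t j j)) hw
    simp only [map_sub, map_add, Matrix.sub_apply, Matrix.add_apply, mul_assoc] at h1
    rw [hC.constantCoeff_toMatrix_mul, hC.toMatrix_scalar, map_mul, ← ha] at h1
    have h2 : PowerSeries.constantCoeff ((algebraMap k (C.ring 1) (-a⁻¹) : C.ring 1) : k⟦X⟧) =
        -a⁻¹ := by
      change PowerSeries.constantCoeff (algebraMap k k⟦X⟧ (-a⁻¹)) = -a⁻¹
      rw [PowerSeries.algebraMap_apply]; simp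
    rw [h2] at h1
    simp [h0] at h1
  · intro h y
    have : IsUnit (1 - -(y * x)) := hC.isUnit_one_sub fun j => by
      rw [map_neg, Matrix.neg_apply, map_neg, hC.constantCoeff_toMatrix_mul, h, mul_zero, neg_zero]
    obtain ⟨w, hw⟩ := this.exists_left_inv
    refine ⟨w, ?_⟩
    rw [Ideal.mem_bot, mul_assoc, sub_eq_zero, ← hw, sub_neg_eq_add, mul_add, mul_one, add_comm]

end Strict

end RingChain

end Radical


/-! ### Superfluous submodules -/

section Superfluous

variable {R V W : Type*} [Ring R] [AddCommGroup V] [Module R V] [AddCommGroup W] [Module R W]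

theorem IsSuperfluous.mono {K L : Submodule R V} (hL : IsSuperfluous L) (h : K ≤ L) :
    IsSuperfluous K := fun N hN => hL N (top_le_iff.1 (hN ▸ sup_le_sup_left h N))

theorem IsSuperfluous.sup {K L : Submodule R V} (hK : IsSuperfluous K) (hL : IsSuperfluous L) :
    IsSuperfluous (K ⊔ L) := fun N hN => hK N (hL _ (by rwa [sup_assoc]))

theorem IsSuperfluous.map {K : Submodule R V} (hK : IsSuperfluous K) (f : V →ₗ[R] W) :
    IsSuperfluous (K.map f) := by
  intro N hN
  have h : N.comap f = ⊤ := by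
    refine hK _ (eq_top_iff.2 fun v _ => ?_)
    have hv : f v ∈ N ⊔ K.map f := hN ▸ Submodule.mem_top
    obtain ⟨n, hn, _, ⟨κ, hκ, rfl⟩, hnk⟩ := Submodule.mem_sup.1 hv
    refine Submodule.mem_sup.2 ⟨v - κ, ?_, κ, hκ, sub_add_cancel _ _⟩
    rw [Submodule.mem_comap, map_sub, ← hnk, add_sub_cancel_right]
    exact hn
  rw [eq_top_iff, ← hN, sup_le_iff]
  refine ⟨le_rfl, ?_⟩
  rw [Submodule.map_le_iff_le_comap, h]
  exact le_top

theorem IsSuperfluous.prod {K : Submodule R V} {L : Submodule R W} (hK : IsSuperfluous K)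
    (hL : IsSuperfluous L) : IsSuperfluous (K.prod L) := by
  refine ((hK.map (LinearMap.inl R V W)).sup (hL.map (LinearMap.inr R V W))).mono ?_
  rintro ⟨x, y⟩ ⟨hx, hy⟩
  exact Submodule.mem_sup.2 ⟨(x, 0), ⟨x, hx, rfl⟩, (0, y), ⟨y, hy, rfl⟩, by simp⟩

end Superfluous

/-! ### The modules S_j are simple and detect t-torsion. -/

section SimpleModules

variable {k : Type u} [Field k]

namespace RingChain

variable (C : RingChain k)

/-- The submodule `e_j J(E)` of `P_j`. -/
abbrev radP (j : C.Idx) : Submodule C.Eᵐᵒᵖ (C.P j) := (rightJacobson C.E).comap (C.P j).subtype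

theorem mem_radP {j : C.Idx} {p : C.P j} : p ∈ C.radP j ↔ (p : C.E) ∈ Ring.jacobson C.E := Iff.rfl

theorem ker_π (j : C.Idx) : LinearMap.ker (C.π j) = C.radP j := Submodule.ker_mkQ _

namespace Strict

variable {C} (hC : C.Strict)
include hC

theorem toMatrix_e_mul_of_ne {i j : C.Idx} (h : i ≠ j) (x : C.E) (b : C.Idx) :
    hC.toMatrix (C.e j * x) i b = 0 := by
  rw [toMatrix_apply, rowOf_apply, e_mul_apply, Pi.single_eq_of_ne h]
  rfl

theorem toMatrix_e_self (j : C.Idx) : hC.toMatrix (C.e j) j j = 1 := by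
  rw [toMatrix_apply, rowOf_e_self, gen, Pi.single_eq_same]
  rfl

theorem mem_radP_iff {j : C.Idx} {p : C.P j} :
    p ∈ C.radP j ↔ PowerSeries.constantCoeff (C.row p (C.gen j)) = 0 := by
  rw [mem_radP, hC.mem_jacobson_iff]
  refine ⟨fun h => h j, fun h i => ?_⟩
  by_cases hij : i = j
  · subst hij; exact h
  · rw [← C.mem_P.1 p.2, hC.toMatrix_e_mul_of_ne hij, map_zero]

/-- An element of `P_j` outside of the radical generates `e_j` modulo the radical. -/
theorem exists_mul_sub_e_mem {j : C.Idx} {p : C.P j} (hp : p ∉ C.radP j) :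
    ∃ a : C.E, MulOpposite.op a • p - ⟨C.e j, C.e_mem_P j⟩ ∈ C.radP j := by
  rw [hC.mem_radP_iff] at hp
  set c := PowerSeries.constantCoeff (C.row p (C.gen j)) with hc
  have hcoe : PowerSeries.constantCoeff ((algebraMap k (C.ring 1) c⁻¹ : C.ring 1) : k⟦X⟧) =
      c⁻¹ := by
    change PowerSeries.constantCoeff (algebraMap k k⟦X⟧ c⁻¹) = c⁻¹
    rw [PowerSeries.algebraMap_apply]; simp
  refine ⟨C.scalar (algebraMap k (C.ring 1) c⁻¹), ?_⟩
  rw [hC.mem_radP_iff]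
  change PowerSeries.constantCoeff (hC.toMatrix ((p : C.E) * C.scalar _ - C.e j) j j) = 0
  rw [← scalar_comm, map_sub, Matrix.sub_apply, hC.toMatrix_scalar, map_sub, map_mul, hcoe,
    hC.toMatrix_e_self, map_one, sub_eq_zero]
  exact inv_mul_cancel₀ hp

theorem e_notMem_radP (j : C.Idx) : (⟨C.e j, C.e_mem_P j⟩ : C.P j) ∉ C.radP j := by
  rw [hC.mem_radP_iff]
  change PowerSeries.constantCoeff (hC.toMatrix (C.e j) j j) ≠ 0
  rw [hC.toMatrix_e_self, map_one]
  exact one_ne_zero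

theorem isSimpleModule_S (j : C.Idx) : IsSimpleModule C.Eᵐᵒᵖ (C.S j) := by
  refine isSimpleModule_iff_isCoatom.2 ⟨fun h => ?_, fun N hN => ?_⟩
  · refine hC.e_notMem_radP j ?_
    change _ ∈ (rightJacobson C.E).comap (C.P j).subtype
    rw [h]; trivial
  · obtain ⟨p, hpN, hp⟩ := SetLike.exists_of_lt hN
    obtain ⟨a, ha⟩ := hC.exists_mul_sub_e_mem (p := p) hp
    have he : (⟨C.e j, C.e_mem_P j⟩ : C.P j) ∈ N := by
      have := N.sub_mem (N.smul_mem (MulOpposite.op a) hpN) (hN.le ha)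
      rwa [sub_sub_cancel] at this
    refine eq_top_iff.2 fun x _ => ?_
    have := N.smul_mem (MulOpposite.op (x : C.E)) he
    convert this using 1
    exact Subtype.ext (C.mem_P.1 x.2).symm

/-- Nakayama: if e_j = n + r with r radical, then n = e_j(1 - r) with 1 - r a unit, so n already
generates P_j. -/
theorem isSuperfluous_radP (j : C.Idx) : IsSuperfluous (C.radP j) := by
  intro N hN
  have h : (⟨C.e j, C.e_mem_P j⟩ : C.P j) ∈ N ⊔ C.radP j := hN ▸ Submodule.mem_top
  obtain ⟨n, hn, r, hr, hnr⟩ := Submodule.mem_sup.1 h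
  have hunit : IsUnit (1 - (r : C.E)) := hC.isUnit_one_sub (hC.mem_jacobson_iff.1 hr)
  obtain ⟨w, hw⟩ := hunit.exists_right_inv
  refine eq_top_iff.2 fun x _ => ?_
  have hx := N.smul_mem (MulOpposite.op (w * (x : C.E))) hn
  convert hx using 1
  refine Subtype.ext ?_
  have hn' : (n : C.E) = C.e j * (1 - r) := by
    rw [mul_sub, mul_one, C.mem_P.1 r.2]
    exact eq_sub_of_add_eq (congrArg Subtype.val hnr)
  change (x : C.E) = n * (w * x)
  rw [hn', mul_assoc, ← mul_assoc _ w, hw, one_mul, C.mem_P.1 x.2]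

/-! ### Detecting torsion -/

/-- Multiplying y repeatedly by radical elements raises the weight by one each time, so the process
must stop at a nonzero y' killed by J(E). Some y'e_j is nonzero as the e_j sum to 1, and p ↦ y'p on
P_j has kernel exactly e_jJ(E). -/
theorem embeds_of_torsion {Y : Type u} [AddCommGroup Y] [Module C.Eᵐᵒᵖ Y] (y : Y) (hy : y ≠ 0)
    (N : ℕ) (hN : ∀ x, hC.HasWeight N x → MulOpposite.op x • y = 0) :
    ∃ j, ∃ φ : C.S j →ₗ[C.Eᵐᵒᵖ] Y, Function.Injective φ := by
  have h1 : ∃ y' : Y, y' ≠ 0 ∧ ∀ x ∈ Ring.jacobson C.E, MulOpposite.op x • y' = 0 := by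
    by_contra! hcon
    have : ∀ n, ∃ x, hC.HasWeight n x ∧ MulOpposite.op x • y ≠ 0 := fun n => by
      induction n with
      | zero => exact ⟨1, hC.hasWeight_zero 1, by simpa using hy⟩
      | succ n ih =>
        obtain ⟨x, hx, hxy⟩ := ih
        obtain ⟨x', hx', hxy'⟩ := hcon _ hxy
        refine ⟨x * x', hx.mul hC (hC.hasWeight_one (hC.mem_jacobson_iff.1 hx')), ?_⟩
        rwa [MulOpposite.op_mul, mul_smul]
    obtain ⟨x, hx, hxy⟩ := this N
    exact hxy (hN x hx)
  obtain ⟨y', hy', hJ⟩ := h1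
  obtain ⟨j, hj⟩ : ∃ j, MulOpposite.op (C.e j) • y' ≠ 0 := by
    by_contra! hcon
    refine hy' ?_
    rw [← one_smul C.Eᵐᵒᵖ y', ← MulOpposite.op_one, ← C.sum_e, Finset.op_sum, Finset.sum_smul]
    exact Finset.sum_eq_zero fun j _ => hcon j
  let φ : C.P j →ₗ[C.Eᵐᵒᵖ] Y :=
    { toFun := fun p => MulOpposite.op (p : C.E) • y'
      map_add' := fun p q => by
        rw [Submodule.coe_add, MulOpposite.op_add, add_smul]
      map_smul' := fun a p => by
        rw [RingHom.id_apply, smul_smul]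
        rfl }
  have hker : LinearMap.ker φ = C.radP j := by
    ext p
    refine ⟨fun hp => ?_, fun hp => hJ _ hp⟩
    by_contra hp'
    obtain ⟨a, ha⟩ := hC.exists_mul_sub_e_mem hp'
    refine hj ?_
    have h2 : φ (MulOpposite.op a • p - ⟨C.e j, C.e_mem_P j⟩) = 0 := hJ _ ha
    rw [map_sub, map_smul, LinearMap.mem_ker.1 hp, smul_zero, zero_sub, neg_eq_zero] at h2
    exact h2
  refine ⟨j, Submodule.liftQ (C.radP j) φ hker.ge, ?_⟩
  exact LinearMap.ker_eq_bot.1 (Submodule.ker_liftQ_eq_bot _ _ _ hker.le)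

/-- The ring homomorphism from `E` into the matrices over the field of Laurent series. -/
def toLaurentMatrix : C.E →+* Matrix C.Idx C.Idx (LaurentSeries k) :=
  (algebraMap k⟦X⟧ (LaurentSeries k)).mapMatrix.comp hC.toMatrix

theorem toLaurentMatrix_injective : Function.Injective hC.toLaurentMatrix := by
  intro x y h
  refine hC.toMatrix_injective (Matrix.ext fun j b => ?_)
  have : Function.Injective (algebraMap k⟦X⟧ (LaurentSeries k)) :=
    HahnSeries.ofPowerSeries_injective
  exact this (congrFun (congrFun h j) b)

theorem toLaurentMatrix_scalar (u : C.ring 1) : hC.toLaurentMatrix (C.scalar u) =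
    Matrix.scalar C.Idx (algebraMap k⟦X⟧ (LaurentSeries k) u) := by
  ext1 j b
  change algebraMap k⟦X⟧ (LaurentSeries k) (hC.toMatrix (C.scalar u) j b) = _
  rw [← mul_one (C.scalar u), hC.toMatrix_scalar, map_one]
  by_cases h : j = b
  · subst h; simp
  · simp [h]

theorem exists_toLaurentMatrix_eq {u : C.ring 1} {c : ℕ} (hc1 : 1 ≤ c)
    (hu : (u : k⟦X⟧) = PowerSeries.X ^ c) (hc : ∀ f : k⟦X⟧, PowerSeries.X ^ c * f ∈ C.ring 1)
    (q : Matrix C.Idx C.Idx (LaurentSeries k)) :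
    ∃ (m : ℕ) (x : C.E), hC.toLaurentMatrix x = hC.toLaurentMatrix (C.scalar u) ^ m * q := by
  obtain ⟨⟨_, N, rfl⟩, hN⟩ := IsLocalization.exist_integer_multiples_of_finite
    (Submonoid.powers (PowerSeries.X : k⟦X⟧)) (fun p : C.Idx × C.Idx => q p.1 p.2)
  choose g hg using hN
  have hle := Nat.le_mul_of_pos_left N hc1
  have hexp : c * (N + 1) = (c * (N + 1) - N) + N := by rw [mul_add]; omega
  -- After clearing the denominator t^N, the factor t^(c(N+1)-N) remains; its exponent is at least c
  -- because c ≥ 1, which brings the matrix into E.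
  obtain ⟨x, hx⟩ := hC.exists_toMatrix_eq_of_dvd hc
    (Matrix.of fun j b => PowerSeries.X ^ (c * (N + 1) - N) * g (j, b)) fun j b => by
      refine Dvd.dvd.mul_right (pow_dvd_pow _ ?_) _
      rw [mul_add]; omega
  refine ⟨N + 1, x, ?_⟩
  rw [toLaurentMatrix_scalar, ← map_pow, ← map_pow, hu, ← pow_mul]
  ext1 j b
  rw [Matrix.scalar_apply, Matrix.diagonal_mul]
  have hgq : algebraMap k⟦X⟧ (LaurentSeries k) (g (j, b)) =
    algebraMap k⟦X⟧ (LaurentSeries k) (PowerSeries.X ^ N) * q j b := by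
    rw [hg (j, b), Algebra.smul_def]
  change algebraMap k⟦X⟧ (LaurentSeries k) (hC.toMatrix x j b) = _
  rw [hx, Matrix.of_apply, map_mul, hgq, ← mul_assoc, ← map_mul, ← pow_add, ← hexp]

/-- The central element is z = t^c. Its inversion embeds E in the matrix ring over k((t)), where
every one-sided ideal is generated by an idempotent; clearing denominators produces p. -/
theorem detectsTorsion : ∃ z, DetectsTorsion C.Eᵐᵒᵖ C.S z := by
  obtain ⟨c, hc1, hc⟩ := hC.conductor
  let u : C.ring 1 := ⟨PowerSeries.X ^ c, by simpa using hc 1⟩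
  have hreg : ∀ a : C.E, C.scalar u * a = 0 → a = 0 := fun a ha => by
    refine hC.toMatrix_injective (Matrix.ext fun j b => ?_)
    have := hC.toMatrix_scalar u a j b
    rw [ha, map_zero, Matrix.zero_apply] at this
    rw [map_zero, Matrix.zero_apply]
    exact (mul_eq_zero.1 this.symm).resolve_left (pow_ne_zero _ PowerSeries.X_ne_zero)
  have hscal : ∀ (m : ℕ) (x : C.E) (j b : C.Idx), hC.toMatrix (C.scalar u ^ m * x) j b =
      PowerSeries.X ^ (c * m) * hC.toMatrix x j b := fun m x j b => by
    induction m with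
    | zero => simp
    | succ m ih => rw [pow_succ', mul_assoc, hC.toMatrix_scalar, ih, mul_add, pow_add]; ring
  refine ⟨MulOpposite.op (C.scalar u), ?_, ?_, ?_, ?_, ?_⟩
  · intro a
    rw [← MulOpposite.op_unop a, ← MulOpposite.op_mul, ← MulOpposite.op_mul, scalar_comm]
  · intro a ha
    rw [← MulOpposite.op_unop a, ← MulOpposite.op_mul, ← scalar_comm] at ha
    exact MulOpposite.unop_injective (hreg _ (MulOpposite.op_injective ha))
  · intro I
    let ρ : C.Eᵐᵒᵖ →+* (Matrix C.Idx C.Idx (LaurentSeries k))ᵐᵒᵖ := RingHom.op hC.toLaurentMatrix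
    have hρ : Function.Injective ρ := fun x y h =>
      MulOpposite.unop_injective (hC.toLaurentMatrix_injective (MulOpposite.op_injective h))
    set z : C.Eᵐᵒᵖ := MulOpposite.op (C.scalar u) with hz
    have hcent : ∀ m q, q * ρ z ^ m = ρ z ^ m * q := fun m q => by
      refine (Commute.pow_right (?_ : Commute q (ρ z)) m)
      refine MulOpposite.unop_injective ?_
      change hC.toLaurentMatrix (C.scalar u) * q.unop = q.unop * hC.toLaurentMatrix (C.scalar u)
      rw [toLaurentMatrix_scalar]
      exact Matrix.scalar_commute _ (fun _ => Commute.all _ _) _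
    have hclear : ∀ q, ∃ (m : ℕ) (x : C.Eᵐᵒᵖ), ρ x = ρ z ^ m * q := fun q => by
      obtain ⟨m, x, hx⟩ := hC.exists_toLaurentMatrix_eq (u := u) hc1 rfl hc q.unop
      refine ⟨m, MulOpposite.op x, ?_⟩
      rw [← hcent]
      exact MulOpposite.unop_injective hx
    obtain ⟨e, he, hIe⟩ := IsSemisimpleRing.ideal_eq_span_idempotent (I.map ρ)
    have hmem : e ∈ I.map ρ := hIe ▸ Ideal.mem_span_singleton_self e
    -- Every element of the ideal generated by I in the matrix ring becomes, after multiplication by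
    -- a power of z, an element of I.
    have key : ∀ q ∈ I.map ρ, ∃ p ∈ I, ∃ m : ℕ, ρ p = ρ z ^ m * q := fun q hq => by
      refine Submodule.span_induction ?_ ?_ ?_ ?_ hq
      · rintro _ ⟨x, hx, rfl⟩
        exact ⟨x, hx, 0, by rw [pow_zero, one_mul]⟩
      · exact ⟨0, I.zero_mem, 0, by rw [map_zero, mul_zero]⟩
      · rintro x y - - ⟨p, hp, m, h⟩ ⟨p', hp', m', h'⟩
        refine ⟨z ^ m' * p + z ^ m * p', I.add_mem (I.mul_mem_left _ hp) (I.mul_mem_left _ hp'),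
          m + m', ?_⟩
        rw [map_add, map_mul, map_mul, map_pow, map_pow, h, h', ← mul_assoc, ← mul_assoc,
          ← pow_add, ← pow_add, add_comm m', mul_add]
      · rintro a x - ⟨p, hp, m, h⟩
        obtain ⟨m', a', ha'⟩ := hclear a
        refine ⟨a' * p, I.mul_mem_left _ hp, m' + m, ?_⟩
        rw [map_mul, ha', h, mul_assoc, ← mul_assoc a, hcent, smul_eq_mul, pow_add]
        simp only [mul_assoc]
    obtain ⟨p, hp, m, hpm⟩ := key e hmem
    refine ⟨p, hp, m, fun x hx => hρ ?_⟩
    have hxe : ρ x * e = ρ x := by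
      have : ρ x ∈ Ideal.span {e} := hIe ▸ Ideal.mem_map_of_mem ρ hx
      obtain ⟨a, ha⟩ := Ideal.mem_span_singleton'.1 this
      rw [← ha, mul_assoc, he.eq]
    rw [map_mul, map_mul, map_pow, hpm, ← mul_assoc, hcent, mul_assoc, hxe]
  · intro j
    have := hC.isSimpleModule_S j
    exact IsSimpleModule.nontrivial C.Eᵐᵒᵖ (C.S j)
  · intro Y _ _ y m hy hzy
    -- An element of this weight has entries divisible by t^(cm + c): the factor t^(cm) is z^m,
    -- which kills y, and the remaining t^c keeps the cofactor in E.
    refine hC.embeds_of_torsion y hy (C.len * (c * m + c)) fun x hx => ?_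
    have hdvd := hx.dvd hC le_rfl
    choose g hg using hdvd
    obtain ⟨x', hx'⟩ := hC.exists_toMatrix_eq_of_dvd hc
      (Matrix.of fun j b => PowerSeries.X ^ c * g j b) fun j b => Dvd.intro _ rfl
    have hxx : x = C.scalar u ^ m * x' := hC.toMatrix_injective (Matrix.ext fun j b => by
      rw [hscal, hx', Matrix.of_apply, hg, pow_add, mul_assoc])
    rw [hxx, MulOpposite.op_mul, mul_smul, MulOpposite.op_pow, hzy, smul_zero]

end Strict

end RingChain

end SimpleModules


/-! ### The Mayer–Vietoris sequence of two submodules. -/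

section Lattice

variable {A : Type u} [Ring A] {V : Type u} [AddCommGroup V] [Module A V] (U W : Submodule A V)

/-- The antidiagonal inclusion `U ∩ W → U × W`. -/
def infToProd : ↥(U ⊓ W) →ₗ[A] U × W :=
  (Submodule.inclusion inf_le_left).prod (-Submodule.inclusion inf_le_right)

/-- The sum map `U × W → U + W`. -/
def prodToSup : U × W →ₗ[A] ↥(U ⊔ W) :=
  (Submodule.inclusion le_sup_left).coprod (Submodule.inclusion le_sup_right)

theorem infToProd_injective : Function.Injective (infToProd U W) := fun _ _ h =>
  Subtype.ext (congrArg (fun p => (p.1 : V)) h)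

theorem prodToSup_surjective : Function.Surjective (prodToSup U W) := by
  rintro ⟨x, hx⟩
  obtain ⟨u, hu, w, hw, rfl⟩ := Submodule.mem_sup.1 hx
  exact ⟨(⟨u, hu⟩, ⟨w, hw⟩), rfl⟩

theorem infToProd_exact : Function.Exact (infToProd U W) (prodToSup U W) := by
  rintro ⟨u, w⟩
  constructor
  · intro h
    have h : (u : V) + w = 0 := congrArg Subtype.val h
    have hw : (w : V) = -u := (neg_eq_of_add_eq_zero_right h).symm
    refine ⟨⟨u, u.2, by rw [← neg_neg (u : V), ← hw]; exact W.neg_mem w.2⟩, ?_⟩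
    exact Prod.ext (Subtype.ext rfl) (Subtype.ext hw.symm)
  · rintro ⟨z, hz⟩
    rw [← hz]
    exact Subtype.ext (add_neg_cancel (z : V))

variable {U W}

theorem ProjDimLT.sup {n : ℕ} (h : ProjDimLT A ↥(U ⊓ W) n) (hU : ProjDimLT A U (n + 1))
    (hW : ProjDimLT A W (n + 1)) : ProjDimLT A ↥(U ⊔ W) (n + 1) :=
  .third (infToProd_injective U W) (infToProd_exact U W) (prodToSup_surjective U W) h (hU.prod hW)

theorem ProjDimLT.inf {n : ℕ} (h : ProjDimLT A ↥(U ⊔ W) (n + 1)) (hU : ProjDimLT A U n)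
    (hW : ProjDimLT A W n) : ProjDimLT A ↥(U ⊓ W) n :=
  .first (infToProd_injective U W) (infToProd_exact U W) (prodToSup_surjective U W) (hU.prod hW) h

/-- If U + W is projective the sequence 0 → U ∩ W → U × W → U + W → 0 splits; ρ and -σ are the
components of a retraction onto U ∩ W, the sign coming from the antidiagonal inclusion. -/
theorem exists_retraction_of_projective_sup (h : Module.Projective A ↥(U ⊔ W)) :
    ∃ (ρ : U →ₗ[A] ↥(U ⊓ W)) (σ : W →ₗ[A] ↥(U ⊓ W)), ∀ z : ↥(U ⊓ W),
      ρ ⟨z, z.2.1⟩ + σ ⟨z, z.2.2⟩ = z := by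
  obtain ⟨s, hs⟩ := Module.projective_lifting_property (prodToSup U W) LinearMap.id
    (prodToSup_surjective U W)
  have hs' : ∀ y, prodToSup U W (s y) = y := fun y => LinearMap.congr_fun hs y
  have hker : ∀ x, ∃ z, infToProd U W z = x - s (prodToSup U W x) := fun x =>
    (infToProd_exact U W _).1 (by rw [map_sub, hs', sub_self])
  choose r hr using hker
  have hinj := infToProd_injective U W
  let R : U × W →ₗ[A] ↥(U ⊓ W) :=
    { toFun := r
      map_add' := fun x y => hinj (by rw [map_add, hr, hr, hr, map_add, map_add]; abel)
      map_smul' := fun a x => hinj (by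
        rw [RingHom.id_apply, map_smul, hr, hr, map_smul, map_smul, smul_sub]) }
  refine ⟨R ∘ₗ LinearMap.inl A U W, -(R ∘ₗ LinearMap.inr A U W), fun z => ?_⟩
  have h1 : R (infToProd U W z) = z := hinj (by
    change infToProd U W (r _) = _
    rw [hr, (infToProd_exact U W _).2 ⟨z, rfl⟩, map_zero, sub_zero])
  have h2 : infToProd U W z = LinearMap.inl A U W ⟨z, z.2.1⟩ - LinearMap.inr A U W ⟨z, z.2.2⟩ := by
    refine Prod.ext (Subtype.ext ?_) (Subtype.ext ?_) <;> simp [infToProd]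
  rw [h2, map_sub] at h1
  rw [LinearMap.neg_apply, ← sub_eq_add_neg]
  exact h1

theorem projDimLT_quotient_iff (hV : Module.Projective A V) (U : Submodule A V) {n : ℕ} :
    ProjDimLT A (V ⧸ U) (n + 2) ↔ ProjDimLT A U (n + 1) :=
  ⟨fun h => .first U.subtype_injective (LinearMap.exact_subtype_mkQ U) U.mkQ_surjective
    ((ProjDimLT.of_projective hV).mono (by omega)) h,
  fun h => .third U.subtype_injective (LinearMap.exact_subtype_mkQ U) U.mkQ_surjective h
    ((ProjDimLT.of_projective hV).mono (by omega))⟩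

end Lattice

/-! ### Radicals of the projectives P_j and a criterion for non-projectivity. -/

section Resolutions

variable {k : Type u} [Field k]

/-- The multiples `g X` of the elements of a subspace `X` of `k⟦t⟧`. -/
def scale (g : k⟦X⟧) (X : Submodule k k⟦X⟧) : Submodule k k⟦X⟧ := X.map (LinearMap.mulLeft k g)

theorem mem_scale {g : k⟦X⟧} {X : Submodule k k⟦X⟧} {f : k⟦X⟧} :
    f ∈ scale g X ↔ ∃ x ∈ X, g * x = f := Iff.rfl

namespace RingChain

variable (C : RingChain k)

/-- The maximal ideal of `R_j`, as a subspace of `k⟦t⟧`. -/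
def maxSpace (j : C.Idx) : Submodule k k⟦X⟧ where
  carrier := {f | f ∈ C.ring j ∧ PowerSeries.constantCoeff f = 0}
  add_mem' h h' := ⟨(C.ring j).add_mem h.1 h'.1, by rw [map_add, h.2, h'.2, add_zero]⟩
  zero_mem' := ⟨(C.ring j).zero_mem, map_zero _⟩
  smul_mem' c f h := ⟨(C.ring j).smul_mem h.1 c, by
    rw [← PowerSeries.coeff_zero_eq_constantCoeff_apply, map_smul,
      PowerSeries.coeff_zero_eq_constantCoeff_apply, h.2, smul_zero]⟩

theorem mem_maxSpace {j : C.Idx} {f : k⟦X⟧} :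
    f ∈ C.maxSpace j ↔ f ∈ C.ring j ∧ PowerSeries.constantCoeff f = 0 := Iff.rfl

theorem pieceSpace_mono {i j : C.Idx} (h : i ≤ j) : C.pieceSpace i ≤ C.pieceSpace j :=
  C.mono i j i.2.1 h j.2.2

theorem maxSpace_le (j : C.Idx) : C.maxSpace j ≤ C.pieceSpace j := fun _ h => h.1

theorem pieceSpace_inf_maxSpace {i j : C.Idx} (h : i ≤ j) :
    C.pieceSpace i ⊓ C.maxSpace j = C.maxSpace i := by
  ext f
  exact ⟨fun hf => ⟨hf.1, hf.2.2⟩, fun hf => ⟨hf.1, C.pieceSpace_mono h hf.1, hf.2⟩⟩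

/-- The submodule `e_j J(E)` of `P_j`, in terms of rows. -/
def radRows (j : C.Idx) : Submodule C.Eᵐᵒᵖ C.Rows :=
  ((C.radP j).map (C.rowEquiv j).toLinearMap).map (C.homInto (C.pieceSpace j)).subtype

/-- The identification of `e_j J(E)` with its module of rows. -/
def radEquiv (j : C.Idx) : C.radP j ≃ₗ[C.Eᵐᵒᵖ] C.radRows j :=
  ((C.rowEquiv j).submoduleMap (C.radP j)).trans
    (Submodule.equivMapOfInjective _ (Submodule.subtype_injective _) _)

/-- The row `M → R_j` given by the projection. -/
def idRow (j : C.Idx) : C.homInto (C.pieceSpace j) :=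
  ⟨C.rowOf (C.e j) j, C.rowOf_mem _ _⟩

theorem idRow_apply (j : C.Idx) (v : C.M) : (C.idRow j : C.Rows) v = v j := C.rowOf_e_self j v

theorem projDimLT_P (j : C.Idx) : ProjDimLT C.Eᵐᵒᵖ (C.P j) 1 := .of_projective (C.projective_P j)

theorem projDimLT_piece (j : C.Idx) : ProjDimLT C.Eᵐᵒᵖ (C.homInto (C.pieceSpace j)) 1 :=
  (C.projDimLT_P j).of_equiv (C.rowEquiv j)

namespace Strict

variable {C} (hC : C.Strict)
include hC

theorem mem_radRows {j : C.Idx} {φ : C.Rows} : φ ∈ C.radRows j ↔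
    φ ∈ C.homInto (C.pieceSpace j) ∧ PowerSeries.constantCoeff (φ (C.gen j)) = 0 := by
  constructor
  · rintro ⟨_, ⟨p, hp, rfl⟩, rfl⟩
    exact ⟨(C.rowEquiv j p).2, hC.mem_radP_iff.1 hp⟩
  · rintro ⟨h, h0⟩
    refine ⟨⟨φ, h⟩, ⟨(C.rowEquiv j).symm ⟨φ, h⟩, ?_, ?_⟩, rfl⟩
    · refine hC.mem_radP_iff.2 ?_
      rw [← rowEquiv_apply, LinearEquiv.apply_symm_apply]
      exact h0
    · exact LinearEquiv.apply_symm_apply _ _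

theorem mem_homInto_maxSpace {j : C.Idx} {φ : C.Rows} : φ ∈ C.homInto (C.maxSpace j) ↔
    φ ∈ C.homInto (C.pieceSpace j) ∧ ∀ b, PowerSeries.constantCoeff (φ (C.gen b)) = 0 := by
  constructor
  · exact fun h => ⟨C.homInto_mono (C.maxSpace_le j) h, fun b => (h _).2⟩
  · rintro ⟨h, h0⟩
    rw [hC.mem_homInto_iff] at h ⊢
    exact fun b r hr => ⟨h b r hr, by rw [map_mul, h0, mul_zero]⟩

theorem constantCoeff_radRows {j b : C.Idx} (hjb : j ≤ b) {φ : C.Rows} (hφ : φ ∈ C.radRows j) :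
    PowerSeries.constantCoeff (φ (C.gen b)) = 0 := by
  rw [hC.mem_radRows] at hφ
  rcases hjb.eq_or_lt with rfl | h
  · exact hφ.2
  · exact hC.constantCoeff_eq_zero h hφ.1

theorem radRows_of_isMin {j : C.Idx} (hj : ∀ b, j ≤ b) :
    C.radRows j = C.homInto (C.maxSpace j) := by
  ext φ
  rw [hC.mem_homInto_maxSpace]
  exact ⟨fun h => ⟨(hC.mem_radRows.1 h).1, fun b => hC.constantCoeff_radRows (hj b) h⟩,
    fun h => hC.mem_radRows.2 ⟨h.1, h.2 j⟩⟩

/-- Every element of `e_j J(E)` is the sum of a map into `R_{j-1}` and a map into `m_j`. -/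
theorem radRows_eq_sup {i j : C.Idx} (hij : (i : ℕ) + 1 = j) :
    C.radRows j = C.homInto (C.pieceSpace i) ⊔ C.homInto (C.maxSpace j) := by
  have hij' : i ≤ j := Subtype.coe_le_coe.1 (by omega)
  apply le_antisymm
  · intro φ hφ
    -- `x` collects the constant terms of φ. They vanish on the components b ≥ j, and for b ≤ i a
    -- constant maps R_b into R_i; the rest of φ has no constant terms and so lands in m_j.
    set x : C.Rows := C.ofComponents fun b =>
      algebraMap k k⟦X⟧ (PowerSeries.constantCoeff (φ (C.gen b))) with hx
    have hxmem : x ∈ C.homInto (C.pieceSpace i) := by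
      rw [hC.mem_homInto_iff]
      intro b r hr
      rw [hx, ofComponents_gen]
      by_cases hb : b ≤ i
      · exact (C.ring i).mul_mem (C.pieceSpace_mono hb hr) ((C.ring i).algebraMap_mem _)
      · have hjb : j ≤ b := by
          rw [not_le, ← Subtype.coe_lt_coe] at hb
          exact Subtype.coe_le_coe.1 (by omega)
        rw [hC.constantCoeff_radRows hjb hφ, map_zero, mul_zero]
        exact zero_mem _
    refine Submodule.mem_sup.2 ⟨x, hxmem, φ - x, ?_, add_sub_cancel _ _⟩
    rw [hC.mem_homInto_maxSpace]
    refine ⟨Submodule.sub_mem _ (hC.mem_radRows.1 hφ).1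
      (C.homInto_mono (C.pieceSpace_mono hij') hxmem), fun b => ?_⟩
    rw [Rows.sub_apply, hx, ofComponents_gen, map_sub, PowerSeries.algebraMap_apply]
    simp
  · refine sup_le (fun φ hφ => ?_) fun φ hφ => ?_
    · refine hC.mem_radRows.2 ⟨C.homInto_mono (C.pieceSpace_mono hij') hφ, ?_⟩
      exact hC.constantCoeff_eq_zero (Subtype.coe_lt_coe.1 (by omega)) hφ
    · rw [hC.mem_homInto_maxSpace] at hφ
      exact hC.mem_radRows.2 ⟨hφ.1, hφ.2 j⟩

omit hC in
theorem homInto_inf_maxSpace {i j : C.Idx} (hij : i ≤ j) :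
    C.homInto (C.pieceSpace i) ⊓ C.homInto (C.maxSpace j) = C.homInto (C.maxSpace i) := by
  rw [← homInto_inf, C.pieceSpace_inf_maxSpace hij]

omit hC in
theorem mulBy_injective {g : k⟦X⟧} (hg : g ≠ 0) :
    Function.Injective (Rows.mulBy (C := C) g) := fun _ _ h =>
  Rows.ext fun v => mul_left_cancel₀ hg (DFunLike.congr_fun h v)

theorem homInto_scale {g : k⟦X⟧} (hg : g ≠ 0) (X : Submodule k k⟦X⟧) :
    C.homInto (scale g X) = (C.homInto X).map (Rows.mulBy g) := by
  ext φ
  constructor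
  · intro h
    choose y hy hyφ using h
    refine ⟨C.ofComponents fun b => y (C.gen b), fun v => ?_, ?_⟩
    · have : C.ofComponents (fun b => y (C.gen b)) v = y v := by
        refine mul_left_cancel₀ hg ?_
        change _ = LinearMap.mulLeft k g (y v)
        rw [hyφ, hC.apply_eq_sum φ v, ofComponents_apply, Finset.mul_sum]
        refine Finset.sum_congr rfl fun b _ => ?_
        rw [← hyφ, LinearMap.mulLeft_apply, mul_left_comm]
      rw [this]
      exact hy v
    · refine hC.rows_ext fun b => ?_
      rw [Rows.mulBy_apply, ofComponents_gen, ← hyφ, LinearMap.mulLeft_apply]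
  · rintro ⟨ψ, hψ, rfl⟩ v
    exact ⟨ψ v, hψ v, rfl⟩

/-- Multiplication by `g ≠ 0` identifies `Hom(M, X)` with `Hom(M, gX)`. -/
def scaleEquiv {g : k⟦X⟧} (hg : g ≠ 0) (X : Submodule k k⟦X⟧) :
    C.homInto X ≃ₗ[C.Eᵐᵒᵖ] C.homInto (scale g X) :=
  (Submodule.equivMapOfInjective _ (mulBy_injective hg) _).trans
    (LinearEquiv.ofEq _ _ (hC.homInto_scale hg X).symm)

theorem scaleEquiv_apply {g : k⟦X⟧} (hg : g ≠ 0) (X : Submodule k k⟦X⟧) (φ : C.homInto X) :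
    (hC.scaleEquiv hg X φ : C.Rows) = Rows.mulBy g φ := rfl

theorem projDimLT_scale {g : k⟦X⟧} (hg : g ≠ 0) {X : Submodule k k⟦X⟧} {n : ℕ} :
    ProjDimLT C.Eᵐᵒᵖ (C.homInto (scale g X)) n ↔ ProjDimLT C.Eᵐᵒᵖ (C.homInto X) n :=
  ⟨fun h => h.of_equiv (hC.scaleEquiv hg X).symm, fun h => h.of_equiv (hC.scaleEquiv hg X)⟩

omit hC in
theorem projDimLT_S_iff {j : C.Idx} {n : ℕ} :
    ProjDimLT C.Eᵐᵒᵖ (C.S j) (n + 2) ↔ ProjDimLT C.Eᵐᵒᵖ (C.radRows j) (n + 1) :=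
  (projDimLT_quotient_iff (C.projective_P j) (C.radP j)).trans
    ⟨fun h => h.of_equiv (C.radEquiv j), fun h => h.of_equiv (C.radEquiv j).symm⟩

/-- The Yoneda lemma: linear maps from `Hom(M, R_a)` to rows are multiplications. -/
theorem linearMap_apply {a : C.Idx} (ρ : C.homInto (C.pieceSpace a) →ₗ[C.Eᵐᵒᵖ] C.Rows)
    (φ : C.homInto (C.pieceSpace a)) :
    ρ φ = Rows.mulBy (ρ (C.idRow a) (C.gen a)) φ := by
  classical
  set x := C.ofRows (Pi.single a φ) with hx
  have h1 : φ = MulOpposite.op x • C.idRow a := by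
    refine Subtype.ext (Rows.ext fun v => ?_)
    rw [Submodule.coe_smul, Rows.smul_apply, MulOpposite.unop_op, idRow_apply, hx, toEnd_ofRows,
      Pi.single_eq_same]
  have h2 : ρ φ = MulOpposite.op x • ρ (C.idRow a) := by rw [← map_smul, ← h1]
  refine Rows.ext fun v => ?_
  rw [h2, Rows.smul_apply, hC.apply_eq_sum, Rows.mulBy_apply, Finset.sum_eq_single a]
  · rw [mul_comm, MulOpposite.unop_op, hx, toEnd_ofRows, Pi.single_eq_same]
  · intro b _ hb
    rw [MulOpposite.unop_op, hx, toEnd_ofRows, Pi.single_eq_of_ne hb]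
    simp
  · simp

/-- The sum of `Hom(M, t^p R_a)` and `Hom(M, t^q R_b)` is not projective if their intersection
is nonzero and consists of maps of large order. -/
theorem not_projective_sup {a b : C.Idx} {p q s : ℕ} (hp : p < s) (hq : q < s)
    {X Y : Submodule k k⟦X⟧} (hX : X = scale (PowerSeries.X ^ p) (C.pieceSpace a))
    (hY : Y = scale (PowerSeries.X ^ q) (C.pieceSpace b))
    (hs : ∀ f ∈ X ⊓ Y, PowerSeries.X ^ s ∣ f) (hne : ∃ φ ∈ C.homInto (X ⊓ Y), φ ≠ 0) :
    ¬ ProjDimLT C.Eᵐᵒᵖ ↥(C.homInto X ⊔ C.homInto Y) 1 := by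
  intro hproj
  -- By Yoneda a map out of (t^p R_a) is multiplication by a fraction; its value on t^p lies in X ∩
  -- Y and so is divisible by t^s with s > p, whence the multiplier g is a series divisible by t.
  -- Two such multipliers cannot add up to the identity on the nonzero intersection.
  have key : ∀ (a : C.Idx) (p : ℕ), p < s → ∀ Z, Z = scale (PowerSeries.X ^ p) (C.pieceSpace a) →
      ∀ ρ : C.homInto Z →ₗ[C.Eᵐᵒᵖ] ↥(C.homInto X ⊓ C.homInto Y),
      ∃ g : k⟦X⟧, PowerSeries.X ∣ g ∧ ∀ φ : C.homInto Z, (ρ φ : C.Rows) = Rows.mulBy g φ := by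
    rintro a p hp Z rfl ρ
    have hX0 : (PowerSeries.X : k⟦X⟧) ^ p ≠ 0 := pow_ne_zero _ PowerSeries.X_ne_zero
    let ρ' : C.homInto (C.pieceSpace a) →ₗ[C.Eᵐᵒᵖ] C.Rows :=
      (Submodule.subtype _ ∘ₗ ρ) ∘ₗ (hC.scaleEquiv hX0 (C.pieceSpace a)).toLinearMap
    obtain ⟨g, hg⟩ := hs _ ⟨(ρ (hC.scaleEquiv hX0 _ (C.idRow a))).2.1 (C.gen a),
      (ρ (hC.scaleEquiv hX0 _ (C.idRow a))).2.2 (C.gen a)⟩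
    refine ⟨PowerSeries.X ^ (s - p) * g, Dvd.dvd.mul_right (dvd_pow_self _ (by omega)) _,
      fun φ => ?_⟩
    obtain ⟨ψ, rfl⟩ := (hC.scaleEquiv hX0 (C.pieceSpace a)).surjective φ
    have h := hC.linearMap_apply ρ' ψ
    change (ρ (hC.scaleEquiv hX0 _ ψ) : C.Rows) =
      Rows.mulBy ((ρ (hC.scaleEquiv hX0 _ (C.idRow a)) : C.Rows) (C.gen a)) ψ at h
    rw [h, hg, scaleEquiv_apply]
    refine Rows.ext fun v => ?_
    rw [Rows.mulBy_apply, Rows.mulBy_apply, Rows.mulBy_apply,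
      show s = (s - p) + p by omega, pow_add, Nat.add_sub_cancel]
    ring
  obtain ⟨ρ, σ, hρσ⟩ := exists_retraction_of_projective_sup hproj.projective
  obtain ⟨g, hg, hρ⟩ := key a p hp X hX ρ
  obtain ⟨g', hg', hσ⟩ := key b q hq Y hY σ
  obtain ⟨φ, hφ, hφ0⟩ := hne
  rw [homInto_inf] at hφ
  have h := congrArg (Subtype.val : _ → C.Rows) (hρσ ⟨φ, hφ⟩)
  rw [Submodule.coe_add, hρ, hσ] at h
  obtain ⟨v, hv⟩ : ∃ v, φ v ≠ 0 := by
    by_contra! hcon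
    exact hφ0 (Rows.ext hcon)
  have h' : (g + g') * φ v = 1 * φ v := by
    rw [one_mul, add_mul]
    exact DFunLike.congr_fun h v
  have h1 := mul_right_cancel₀ hv h'
  have h2 : (PowerSeries.X : k⟦X⟧) ∣ 1 := h1 ▸ dvd_add hg hg'
  rw [PowerSeries.X_dvd_iff, map_one] at h2
  exact one_ne_zero h2

end Strict

end RingChain

end Resolutions


/-! ### Chains whose maximal ideals are principal over the next ring. -/

section ArfChains

variable {k : Type u} [Field k]

theorem globalDim_eq_two {A : Type u} [Ring A] (h : globalDim A ≤ ((2 : ℕ) : ℕ∞))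
    (h' : ¬ globalDim A ≤ ((1 : ℕ) : ℕ∞)) : globalDim A = 2 := by
  refine le_antisymm h ?_
  rw [not_le] at h'
  exact ENat.WithBot.add_one_le_iff.2 h'

namespace RingChain

variable (C : RingChain k)

/-- The maximal ideal of every ring in the chain is a principal module over the next ring, and
the chain ends with `k⟦t⟧`. -/
structure Arf (s : ℕ → ℕ) : Prop extends C.Strict where
  two_le : 2 ≤ C.len
  last : C.ring C.len = ⊤
  maxSpace_eq : ∀ i j : C.Idx, (i : ℕ) + 1 = j →
    C.maxSpace i = scale (PowerSeries.X ^ s i) (C.pieceSpace j)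

namespace Arf

variable {C} {s : ℕ → ℕ} (hC : C.Arf s)
include hC

theorem maxSpace_last {j : C.Idx} (hj : (j : ℕ) = C.len) :
    C.maxSpace j = scale (PowerSeries.X ^ 1) (C.pieceSpace j) := by
  have htop : ∀ f, f ∈ C.ring j := fun f => by rw [hj, hC.last]; trivial
  ext f
  rw [mem_maxSpace, mem_scale, ← PowerSeries.X_dvd_iff, pow_one]
  constructor
  · rintro ⟨-, g, rfl⟩
    exact ⟨g, htop g, rfl⟩
  · rintro ⟨g, -, rfl⟩
    exact ⟨htop _, g, rfl⟩

theorem projDimLT_maxSpace (j : C.Idx) : ProjDimLT C.Eᵐᵒᵖ (C.homInto (C.maxSpace j)) 1 := by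
  by_cases hj : (j : ℕ) = C.len
  · rw [hC.maxSpace_last hj, hC.projDimLT_scale (pow_ne_zero _ PowerSeries.X_ne_zero)]
    exact C.projDimLT_piece j
  · rw [hC.maxSpace_eq j ⟨j + 1, by have := j.2; omega⟩ rfl,
      hC.projDimLT_scale (pow_ne_zero _ PowerSeries.X_ne_zero)]
    exact C.projDimLT_piece _

/-- All (m_j) are projective, so the radical of P_j is a sum of two projectives with projective
intersection (m_{j-1}); for j = 1 it is projective itself. -/
theorem projDimLT_S (j : C.Idx) : ProjDimLT C.Eᵐᵒᵖ (C.S j) 3 := by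
  refine Strict.projDimLT_S_iff.2 ?_
  by_cases hj : (j : ℕ) = 1
  · rw [hC.radRows_of_isMin fun b => Subtype.coe_le_coe.1 (by have := b.2; omega)]
    exact (hC.projDimLT_maxSpace j).mono (by omega)
  · obtain ⟨i, hi⟩ : ∃ i : C.Idx, (i : ℕ) + 1 = j := by
      have := j.2
      exact ⟨⟨j - 1, by omega⟩, by simp only; omega⟩
    rw [hC.radRows_eq_sup hi]
    refine .sup ?_ ((C.projDimLT_piece i).mono (by omega))
      ((hC.projDimLT_maxSpace j).mono (by omega))
    rw [Strict.homInto_inf_maxSpace (Subtype.coe_le_coe.1 (by omega))]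
    exact hC.projDimLT_maxSpace i

theorem globalDim_le_two : globalDim C.Eᵐᵒᵖ ≤ ((2 : ℕ) : ℕ∞) := by
  obtain ⟨z, hz⟩ := hC.detectsTorsion
  exact hz.globalDim_le 2 hC.projDimLT_S

/-- The radical of P_l is (R_{l-1}) + (tR_l), with intersection (t^s R_l), where s is the shift of
m_{l-1}. As s ≥ 2 exceeds both shifts 0 and 1, `not_projective_sup` applies. -/
theorem not_projDimLT_S_last {j : C.Idx} (hj : (j : ℕ) = C.len) (hs : 2 ≤ s (C.len - 1)) :
    ¬ ProjDimLT C.Eᵐᵒᵖ (C.S j) 2 := by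
  intro h
  have h2 := hC.two_le
  obtain ⟨i, hi⟩ : ∃ i : C.Idx, (i : ℕ) + 1 = j := ⟨⟨C.len - 1, by omega⟩, by simp only; omega⟩
  have hij : i ≤ j := Subtype.coe_le_coe.1 (by omega)
  have hi' : 2 ≤ s i := by rwa [show (i : ℕ) = C.len - 1 by omega]
  have hinf : C.pieceSpace i ⊓ C.maxSpace j = scale (PowerSeries.X ^ s i) (C.pieceSpace j) := by
    rw [C.pieceSpace_inf_maxSpace hij, hC.maxSpace_eq i j hi]
  have hX : (PowerSeries.X : k⟦X⟧) ^ s i ≠ 0 := pow_ne_zero _ PowerSeries.X_ne_zero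
  have h1 := Strict.projDimLT_S_iff.1 h
  rw [hC.radRows_eq_sup hi] at h1
  refine hC.not_projective_sup (a := i) (b := j) (p := 0) (q := 1) (s := s i) (by omega)
    (by omega) ?_ (hC.maxSpace_last hj) ?_ ?_ h1
  · ext f; simp [mem_scale]
  · rw [hinf]
    rintro _ ⟨f, -, rfl⟩
    exact Dvd.intro _ rfl
  · rw [hinf]
    refine ⟨_, (hC.scaleEquiv hX _ (C.idRow j)).2, fun h0 => hX ?_⟩
    have := DFunLike.congr_fun h0 (C.gen j)
    rw [hC.scaleEquiv_apply, Rows.mulBy_apply, idRow_apply, gen, Pi.single_eq_same] at this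
    simp at this

/-- The endomorphism ring of an Arf chain has global dimension two. -/
theorem globalDim_eq_two (hs : 2 ≤ s (C.len - 1)) : globalDim C.Eᵐᵒᵖ = 2 := by
  refine _root_.globalDim_eq_two hC.globalDim_le_two fun h => ?_
  have h2 := hC.two_le
  rw [globalDim_le_iff] at h
  exact hC.not_projDimLT_S_last (j := ⟨C.len, by omega⟩) rfl hs (h _)

theorem mulBy_mem {i j : C.Idx} (hij : (i : ℕ) + 1 = j) {φ : C.Rows}
    (hφ : φ ∈ C.homInto (C.pieceSpace j)) :
    Rows.mulBy (PowerSeries.X ^ s i) φ ∈ C.homInto (C.maxSpace i) := by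
  rw [hC.maxSpace_eq i j hij]
  exact fun v => ⟨_, hφ v, rfl⟩

theorem exists_mulBy {i j : C.Idx} (hij : (i : ℕ) + 1 = j) {φ : C.Rows}
    (hφ : φ ∈ C.homInto (C.maxSpace i)) :
    ∃ ψ ∈ C.homInto (C.pieceSpace j), Rows.mulBy (PowerSeries.X ^ s i) ψ = φ := by
  rwa [hC.maxSpace_eq i j hij, hC.homInto_scale (pow_ne_zero _ PowerSeries.X_ne_zero)] at hφ

/-- This is the Mayer–Vietoris sequence of (R_{j-1}) and (m_j) = t^h(R_{j+1}), whose intersection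
(m_{j-1}) = t^h(R_j) is again P_j. Both shifts must equal h for the same power of t to occur in the
two maps. -/
theorem exists_minimalProjectiveResolution {i j l : C.Idx} (hij : (i : ℕ) + 1 = j)
    (hjl : (j : ℕ) + 1 = l) {h : ℕ} (hh : 1 ≤ h) (hi : s i = h) (hj : s j = h) :
    ∃ (f₉ : (C.P i × C.P l) →ₗ[C.Eᵐᵒᵖ] C.P j) (f₁₀ : C.P j →ₗ[C.Eᵐᵒᵖ] (C.P i × C.P l)),
      (∀ φ ψ v, C.row (f₉ (φ, ψ)) v = C.row φ v + PowerSeries.X ^ h * C.row ψ v) ∧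
      (∀ φ v, C.row (f₁₀ φ).1 v = PowerSeries.X ^ h * C.row φ v) ∧
      (∀ φ v, C.row (f₁₀ φ).2 v = - C.row φ v) ∧
      IsMinimalProjectiveResolution (R := C.Eᵐᵒᵖ) (C.π j) f₉ f₁₀ := by
  have hij' : i ≤ j := Subtype.coe_le_coe.1 (by omega)
  have hjl' : j < l := Subtype.coe_lt_coe.1 (by omega)
  let incl : ∀ {X Y : Submodule k k⟦X⟧}, X ≤ Y → C.homInto X →ₗ[C.Eᵐᵒᵖ] C.homInto Y :=
    fun hXY => Submodule.inclusion (C.homInto_mono hXY)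
  let μj : C.homInto (C.pieceSpace l) →ₗ[C.Eᵐᵒᵖ] C.homInto (C.pieceSpace j) :=
    (Rows.mulBy (PowerSeries.X ^ h)).restrict fun φ hφ =>
      C.homInto_mono (C.maxSpace_le j) (hj ▸ hC.mulBy_mem hjl hφ)
  let μi : C.homInto (C.pieceSpace j) →ₗ[C.Eᵐᵒᵖ] C.homInto (C.pieceSpace i) :=
    (Rows.mulBy (PowerSeries.X ^ h)).restrict fun φ hφ =>
      C.homInto_mono (C.maxSpace_le i) (hi ▸ hC.mulBy_mem hij hφ)
  let f₉ : (C.P i × C.P l) →ₗ[C.Eᵐᵒᵖ] C.P j := (C.rowEquiv j).symm.toLinearMap ∘ₗ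
    ((incl (C.pieceSpace_mono hij') ∘ₗ (C.rowEquiv i).toLinearMap).coprod
      (μj ∘ₗ (C.rowEquiv l).toLinearMap))
  let f₁₀ : C.P j →ₗ[C.Eᵐᵒᵖ] (C.P i × C.P l) :=
    ((C.rowEquiv i).symm.toLinearMap ∘ₗ μi ∘ₗ (C.rowEquiv j).toLinearMap).prod
      (-((C.rowEquiv l).symm.toLinearMap ∘ₗ incl (C.pieceSpace_mono hjl'.le) ∘ₗ
        (C.rowEquiv j).toLinearMap))
  have hf₉ : ∀ φ ψ v, C.row (f₉ (φ, ψ)) v = C.row φ v + PowerSeries.X ^ h * C.row ψ v := by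
    intro φ ψ v
    rw [← rowEquiv_apply]
    change ((C.rowEquiv j ((C.rowEquiv j).symm _) : C.homInto _) : C.Rows) v = _
    rw [LinearEquiv.apply_symm_apply]
    rfl
  have hf₁₀ : ∀ φ v, C.row (f₁₀ φ).1 v = PowerSeries.X ^ h * C.row φ v := by
    intro φ v
    rw [← rowEquiv_apply]
    change ((C.rowEquiv i ((C.rowEquiv i).symm _) : C.homInto _) : C.Rows) v = _
    rw [LinearEquiv.apply_symm_apply]
    rfl
  have hf₁₀' : ∀ φ v, C.row (f₁₀ φ).2 v = - C.row φ v := by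
    intro φ v
    rw [← rowEquiv_apply]
    change ((C.rowEquiv l (-((C.rowEquiv l).symm _)) : C.homInto _) : C.Rows) v = _
    rw [map_neg, LinearEquiv.apply_symm_apply]
    rfl
  have hrow : ∀ {j : C.Idx} {φ ψ : C.P j}, (∀ v, C.row φ v = C.row ψ v) → φ = ψ :=
    fun {j φ ψ} hφψ => (C.rowEquiv j).injective (Subtype.ext (Rows.ext hφψ))
  have hex₁ : Function.Exact f₁₀ f₉ := by
    rintro ⟨x, y⟩
    constructor
    · intro h0
      have hxy : ∀ v, C.row x v + PowerSeries.X ^ h * C.row y v = 0 := fun v => by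
        rw [← hf₉, h0]; rfl
      -- x = -t^h y takes values in R_{j-1} ∩ m_j = m_{j-1} = t^h R_j, which supplies the preimage
      -- ψ.
      have hx : (C.rowEquiv i x : C.Rows) ∈ C.homInto (C.maxSpace i) := by
        rw [← Strict.homInto_inf_maxSpace hij']
        refine ⟨(C.rowEquiv i x).2, ?_⟩
        have : (C.rowEquiv i x : C.Rows) = -Rows.mulBy (PowerSeries.X ^ h) (C.rowEquiv l y) :=
          Rows.ext fun v => eq_neg_of_add_eq_zero_left (hxy v)
        rw [this, ← hj]
        exact Submodule.neg_mem _ (hC.mulBy_mem hjl (C.rowEquiv l y).2)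
      obtain ⟨ψ, hψ, hψx⟩ := hC.exists_mulBy hij hx
      rw [hi] at hψx
      have hzψ : ∀ v, C.row ((C.rowEquiv j).symm ⟨ψ, hψ⟩) v = ψ v := fun v => by
        rw [← rowEquiv_apply, LinearEquiv.apply_symm_apply]
      have hx' : ∀ v, PowerSeries.X ^ h * ψ v = C.row x v := fun v => DFunLike.congr_fun hψx v
      refine ⟨(C.rowEquiv j).symm ⟨ψ, hψ⟩, Prod.ext (hrow fun v => ?_) (hrow fun v => ?_)⟩
      · rw [hf₁₀, hzψ, hx']
      · rw [hf₁₀', hzψ]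
        refine mul_left_cancel₀ (pow_ne_zero h PowerSeries.X_ne_zero) ?_
        rw [mul_neg, hx']
        exact (eq_neg_of_add_eq_zero_right (hxy v)).symm
    · rintro ⟨z, hz⟩
      refine hrow fun v => ?_
      rw [hf₉, show x = (f₁₀ z).1 by rw [hz], show y = (f₁₀ z).2 by rw [hz], hf₁₀, hf₁₀', mul_neg,
        add_neg_cancel]
      rfl
  have := C.projective_P i
  have := C.projective_P l
  refine ⟨f₉, f₁₀, hf₉, hf₁₀, hf₁₀', C.projective_P j, inferInstance, C.projective_P j,
    Submodule.mkQ_surjective _, fun y => ?_, hex₁, fun x y hxy => ?_, ?_, ?_⟩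
  · rw [← LinearMap.mem_ker, ker_π]
    constructor
    · intro hy
      have hy' : (C.rowEquiv j y : C.Rows) ∈ C.radRows j :=
        hC.mem_radRows.2 ⟨(C.rowEquiv j y).2, hC.mem_radP_iff.1 hy⟩
      rw [hC.radRows_eq_sup hij] at hy'
      obtain ⟨u, hu, w, hw, huw⟩ := Submodule.mem_sup.1 hy'
      obtain ⟨ψ, hψ, rfl⟩ := hC.exists_mulBy hjl hw
      refine ⟨((C.rowEquiv i).symm ⟨u, hu⟩, (C.rowEquiv l).symm ⟨ψ, hψ⟩), hrow fun v => ?_⟩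
      rw [hf₉, ← rowEquiv_apply, ← rowEquiv_apply, ← rowEquiv_apply, LinearEquiv.apply_symm_apply,
        LinearEquiv.apply_symm_apply, ← huw, hj]
      rfl
    · rintro ⟨⟨x, z⟩, rfl⟩
      rw [hC.mem_radP_iff, hf₉, map_add, map_mul, map_pow, PowerSeries.constantCoeff_X,
        zero_pow (by omega), zero_mul, add_zero]
      exact hC.constantCoeff_eq_zero (Subtype.coe_lt_coe.1 (by omega)) (C.rowEquiv i x).2
  · refine hrow fun v => neg_injective ?_
    rw [← hf₁₀', ← hf₁₀', hxy]
  · rw [ker_π]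
    exact hC.isSuperfluous_radP j
  -- The image of f₁₀ is radical in both components: in the first because of the factor t^h, in the
  -- second because a map into R_j has no constant term on R_{j+1}.
  · refine ((hC.isSuperfluous_radP i).prod (hC.isSuperfluous_radP l)).mono fun x hx => ?_
    obtain ⟨z, rfl⟩ := (hex₁ x).1 hx
    constructor
    · refine hC.mem_radP_iff.2 ?_
      rw [hf₁₀, map_mul, map_pow, PowerSeries.constantCoeff_X, zero_pow (by omega), zero_mul]
    · refine hC.mem_radP_iff.2 ?_
      rw [hf₁₀', map_neg, neg_eq_zero]
      exact hC.constantCoeff_eq_zero hjl' (C.rowEquiv j z).2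

end Arf

end RingChain

end ArfChains


/-! ### Finiteness of the global dimension for every radical chain. -/

section RadicalChains

variable {k : Type u} [Field k]

theorem exists_eq_scale_of_ideal (X : Submodule k k⟦X⟧)
    (hX : ∀ r : k⟦X⟧, ∀ x ∈ X, r * x ∈ X) {e : ℕ} (he : PowerSeries.X ^ e ∈ X) :
    ∃ d, X = scale (PowerSeries.X ^ d) ⊤ := by
  classical
  have hex : ∃ d, (PowerSeries.X : k⟦X⟧) ^ d ∈ X := ⟨e, he⟩
  refine ⟨Nat.find hex, le_antisymm (fun f hf => ?_) ?_⟩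
  · rw [mem_scale]
    suffices PowerSeries.X ^ Nat.find hex ∣ f by
      obtain ⟨g, rfl⟩ := this
      exact ⟨g, trivial, rfl⟩
    rw [PowerSeries.X_pow_dvd_iff]
    intro m
    induction m using Nat.strong_induction_on with
    | _ m ih =>
      intro hm
      by_contra h0
      obtain ⟨g, rfl⟩ : PowerSeries.X ^ m ∣ f :=
        PowerSeries.X_pow_dvd_iff.2 fun i hi => ih i hi (hi.trans hm)
      have hg : PowerSeries.constantCoeff g ≠ 0 := by
        simpa [PowerSeries.coeff_X_pow_mul'] using h0
      refine Nat.find_min hex hm ?_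
      have := hX g⁻¹ _ hf
      rwa [mul_left_comm, PowerSeries.inv_mul_cancel _ hg, mul_one] at this
  · rintro _ ⟨g, -, rfl⟩
    rw [LinearMap.mulLeft_apply, mul_comm]
    exact hX _ _ (Nat.find_spec hex)

/-- The subspace of power series of order at least `i`. -/
def orderGE (k : Type u) [Field k] (i : ℕ) : Submodule k k⟦X⟧ := scale (PowerSeries.X ^ i) ⊤

theorem mem_orderGE {i : ℕ} {f : k⟦X⟧} : f ∈ orderGE k i ↔ PowerSeries.X ^ i ∣ f :=
  ⟨fun ⟨g, _, h⟩ => ⟨g, h.symm⟩, fun ⟨g, h⟩ => ⟨g, trivial, h.symm⟩⟩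

/-- The order filtration on a subspace has steps of dimension at most one. -/
theorem exists_inf_orderGE_le (X : Submodule k k⟦X⟧) (i : ℕ) :
    ∃ x ∈ X, X ⊓ orderGE k i = (X ⊓ orderGE k (i + 1)) ⊔ Submodule.span k {x} := by
  have hle : X ⊓ orderGE k (i + 1) ≤ X ⊓ orderGE k i :=
    inf_le_inf_left _ fun f hf => mem_orderGE.2 ((pow_dvd_pow _ (Nat.le_succ i)).trans
      (mem_orderGE.1 hf))
  have hmem : ∀ f ∈ orderGE k i, PowerSeries.coeff i f = 0 → f ∈ orderGE k (i + 1) := by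
    intro f hf h0
    rw [mem_orderGE, PowerSeries.X_pow_dvd_iff] at hf ⊢
    intro m hm
    rcases Nat.lt_succ_iff_lt_or_eq.1 hm with h | rfl
    · exact hf m h
    · exact h0
  by_cases h : ∃ x ∈ X ⊓ orderGE k i, PowerSeries.coeff i x ≠ 0
  · obtain ⟨x, hx, hx0⟩ := h
    refine ⟨x, hx.1, le_antisymm (fun f hf => ?_) (sup_le hle ?_)⟩
    · set c := PowerSeries.coeff i f * (PowerSeries.coeff i x)⁻¹ with hc
      have hfx : f - c • x ∈ X ⊓ orderGE k i := Submodule.sub_mem _ hf (Submodule.smul_mem _ _ hx)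
      refine Submodule.mem_sup.2 ⟨f - c • x, ⟨hfx.1, hmem _ hfx.2 ?_⟩, c • x,
        Submodule.smul_mem _ _ (Submodule.mem_span_singleton_self x), sub_add_cancel _ _⟩
      rw [map_sub, map_smul, smul_eq_mul, hc, inv_mul_cancel_right₀ hx0, sub_self]
    · rw [Submodule.span_singleton_le_iff_mem]
      exact hx
  · push Not at h
    refine ⟨0, X.zero_mem, le_antisymm (fun f hf => ?_) (sup_le hle ?_)⟩
    · exact Submodule.mem_sup_left ⟨hf.1, hmem f hf.2 (h f hf)⟩
    · rw [Submodule.span_singleton_le_iff_mem]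
      exact Submodule.zero_mem _

namespace RingChain

variable (C : RingChain k)

/-- A strict chain ending with `k⟦t⟧` such that every ring stabilizes the preceding maximal
ideal. -/
structure Radical : Prop extends C.Strict where
  last : C.ring C.len = ⊤
  mul_mem : ∀ i j : C.Idx, (i : ℕ) + 1 = j → ∀ f ∈ C.ring j, ∀ g ∈ C.maxSpace i,
    f * g ∈ C.maxSpace i

theorem sub_constantCoeff_mem {j : C.Idx} {f : k⟦X⟧} (hf : f ∈ C.ring j) :
    f - algebraMap k k⟦X⟧ (PowerSeries.constantCoeff f) ∈ C.maxSpace j := by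
  refine ⟨(C.ring j).sub_mem hf ((C.ring j).algebraMap_mem _), ?_⟩
  rw [map_sub, PowerSeries.algebraMap_apply]
  simp

/-- The largest subspace of `X` stable under `R_j`. -/
def stablePart (j : C.Idx) (X : Submodule k k⟦X⟧) : Submodule k k⟦X⟧ where
  carrier := {x | ∀ r ∈ C.ring j, r * x ∈ X}
  add_mem' h h' r hr := by rw [mul_add]; exact X.add_mem (h r hr) (h' r hr)
  zero_mem' r _ := by rw [mul_zero]; exact X.zero_mem
  smul_mem' c x h r hr := by rw [mul_smul_comm]; exact X.smul_mem c (h r hr)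

theorem stablePart_le (j : C.Idx) (X : Submodule k k⟦X⟧) : C.stablePart j X ≤ X := fun x hx => by
  simpa using hx 1 (C.ring j).one_mem

theorem mul_mem_stablePart {j : C.Idx} {X : Submodule k k⟦X⟧} :
    ∀ r ∈ C.ring j, ∀ x ∈ C.stablePart j X, r * x ∈ C.stablePart j X :=
  fun r hr x hx r' hr' => by rw [← mul_assoc]; exact hx _ ((C.ring j).mul_mem hr' hr)

namespace Radical

variable {C} (hC : C.Radical)
include hC

/-- R_j maps m_i into m_i ⊆ R_i, so r(mx) = (rm)x stays in X. -/
theorem mul_mem_stablePart_of_mem_maxSpace {i j : C.Idx} (hij : (i : ℕ) + 1 = j)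
    {X : Submodule k k⟦X⟧} (hX : ∀ r ∈ C.ring i, ∀ x ∈ X, r * x ∈ X) {m x : k⟦X⟧}
    (hm : m ∈ C.maxSpace i) (hx : x ∈ X) : m * x ∈ C.stablePart j X := fun r hr => by
  rw [← mul_assoc]
  exact hX _ (hC.mul_mem i j hij r hr m hm).1 x hx

/-- For x ∉ Y, since m_i X ⊆ Y, the space Y + kx is Y + R_i x, and Y ∩ R_i x = m_i x. Applying
Hom(M, -) preserves this sum, so Mayer–Vietoris bounds the dimension by those of (Y), (R_i) and
(m_i). -/
theorem projDimLT_sup_span {i j : C.Idx} (hij : (i : ℕ) + 1 = j)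
    {X : Submodule k k⟦X⟧} (hX : ∀ r ∈ C.ring i, ∀ x ∈ X, r * x ∈ X) {n : ℕ}
    (hmax : ProjDimLT C.Eᵐᵒᵖ (C.homInto (C.maxSpace i)) n) {Y : Submodule k k⟦X⟧}
    (hY : C.stablePart j X ≤ Y) (hYX : Y ≤ X) (hYn : ProjDimLT C.Eᵐᵒᵖ (C.homInto Y) (n + 1))
    {x : k⟦X⟧} (hx : x ∈ X) :
    ProjDimLT C.Eᵐᵒᵖ (C.homInto (Y ⊔ Submodule.span k {x})) (n + 1) := by
  by_cases hxY : x ∈ Y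
  · rwa [sup_eq_left.2 ((Submodule.span_singleton_le_iff_mem x Y).2 hxY)]
  have hx0 : x ≠ 0 := fun h => hxY (h ▸ Y.zero_mem)
  have hmul : ∀ m ∈ C.maxSpace i, ∀ y ∈ X, m * y ∈ Y := fun m hm y hy =>
    hY (hC.mul_mem_stablePart_of_mem_maxSpace hij hX hm hy)
  have hdecomp : ∀ (r y : k⟦X⟧), r * y = (r - algebraMap k k⟦X⟧ (PowerSeries.constantCoeff r)) * y +
      PowerSeries.constantCoeff r • y := fun r y => by
    rw [Algebra.smul_def]; ring
  have hinf : Y ⊓ scale x (C.pieceSpace i) = scale x (C.maxSpace i) := by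
    apply le_antisymm
    · rintro _ ⟨hf, r, hr, rfl⟩
      refine ⟨r, ⟨hr, ?_⟩, rfl⟩
      by_contra h0
      rw [LinearMap.mulLeft_apply, mul_comm, SetLike.mem_coe, hdecomp] at hf
      have h1 := (Submodule.add_mem_iff_right _ (hmul _ (C.sub_constantCoeff_mem hr) x hx)).1 hf
      exact hxY ((Submodule.smul_mem_iff _ h0).1 h1)
    · rintro _ ⟨m, hm, rfl⟩
      refine ⟨?_, m, hm.1, rfl⟩
      rw [LinearMap.mulLeft_apply, mul_comm]
      exact hmul m hm x hx
  have hsup : C.homInto (Y ⊔ Submodule.span k {x}) =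
      C.homInto Y ⊔ C.homInto (scale x (C.pieceSpace i)) := by
    apply le_antisymm
    · intro φ hφ
      have hφX : ∀ v, φ v ∈ X := fun v =>
        (sup_le hYX ((Submodule.span_singleton_le_iff_mem x X).2 hx)) (hφ v)
      have hφb : ∀ b, ∃ y ∈ Y, ∃ c : k, y + c • x = φ (C.gen b) := fun b => by
        obtain ⟨y, hy, z, hz, hyz⟩ := Submodule.mem_sup.1 (hφ (C.gen b))
        obtain ⟨c, rfl⟩ := Submodule.mem_span_singleton.1 hz
        exact ⟨y, hy, c, hyz⟩
      choose y hy c hyc using hφb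
      classical
      -- The x-part of φ is split off only on components b ≤ i, where R_b x ⊆ R_i x. On components b
      -- ≥ j the values of φ are already stable under R_j, hence lie in Y.
      set ψ : C.Rows := C.ofComponents fun b => if b ≤ i then c b • x else 0 with hψ
      have hψmem : ψ ∈ C.homInto (scale x (C.pieceSpace i)) := by
        rw [hC.mem_homInto_iff]
        intro b r hr
        rw [hψ, ofComponents_gen]
        split_ifs with hb
        · refine ⟨c b • r, (C.pieceSpace i).smul_mem _ (C.pieceSpace_mono hb hr), ?_⟩
          rw [LinearMap.mulLeft_apply, mul_smul_comm, mul_smul_comm, mul_comm]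
        · rw [mul_zero]; exact zero_mem _
      refine Submodule.mem_sup.2 ⟨φ - ψ, ?_, ψ, hψmem, sub_add_cancel _ _⟩
      rw [hC.mem_homInto_iff]
      intro b r hr
      rw [Rows.sub_apply, hψ, ofComponents_gen]
      split_ifs with hb
      · rw [← hyc, add_sub_cancel_right, hdecomp]
        exact Y.add_mem (hmul _ (C.sub_constantCoeff_mem (C.pieceSpace_mono hb hr)) _
          (hYX (hy b))) (Y.smul_mem _ (hy b))
      · rw [sub_zero]
        refine hY fun r' hr' => ?_
        have hjb : j ≤ b := by
          rw [not_le, ← Subtype.coe_lt_coe] at hb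
          exact Subtype.coe_le_coe.1 (by omega)
        rw [← mul_assoc, ← hC.apply_single φ b
          ⟨r' * r, (C.ring b).mul_mem (C.pieceSpace_mono hjb hr') hr⟩]
        exact hφX _
    · refine sup_le (C.homInto_mono le_sup_left) (C.homInto_mono ?_)
      rintro _ ⟨r, hr, rfl⟩
      rw [LinearMap.mulLeft_apply, mul_comm, hdecomp]
      exact Submodule.add_mem_sup (hmul _ (C.sub_constantCoeff_mem hr) x hx)
        (Submodule.smul_mem _ _ (Submodule.mem_span_singleton_self x))
  rw [hsup]
  refine .sup ?_ hYn ?_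
  · rw [← homInto_inf, hinf]
    exact (hC.projDimLT_scale hx0).2 hmax
  · exact (hC.projDimLT_scale hx0).2 ((C.projDimLT_piece i).mono (by omega))

theorem exists_orderGE_le_maxSpace (j : C.Idx) : ∃ e, orderGE k e ≤ C.maxSpace j := by
  obtain ⟨c, hc1, hc⟩ := hC.conductor
  refine ⟨c, ?_⟩
  rintro _ ⟨f, -, rfl⟩
  refine ⟨C.ring_one_le j (hc f), ?_⟩
  rw [LinearMap.mulLeft_apply, map_mul, map_pow, PowerSeries.constantCoeff_X, zero_pow (by omega),
    zero_mul]

/-- Induction on n = len - j. At the end X is an ideal t^d k⟦t⟧. Otherwise m_j and the largest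
R_{j+1}-stable part of X are covered by induction, and X arises from that part by adding finitely
many vectors, at no further cost. -/
theorem projDimLT_homInto (n : ℕ) (j : C.Idx) (hn : C.len = n + j) (X : Submodule k k⟦X⟧)
    (hX : ∀ r ∈ C.ring j, ∀ x ∈ X, r * x ∈ X) {e : ℕ} (he : orderGE k e ≤ X) :
    ProjDimLT C.Eᵐᵒᵖ (C.homInto X) (n + 1) := by
  induction n generalizing j X e with
  | zero =>
    have htop : C.ring j = ⊤ := by
      have h := hC.last
      rwa [show C.len = (j : ℕ) by omega] at h
    obtain ⟨d, rfl⟩ := exists_eq_scale_of_ideal X (fun r x hx => hX r (htop ▸ trivial) x hx)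
      (he (mem_orderGE.2 dvd_rfl))
    rw [hC.projDimLT_scale (pow_ne_zero _ PowerSeries.X_ne_zero)]
    have : C.pieceSpace j = ⊤ := by rw [pieceSpace, htop]; rfl
    rw [← this]
    exact C.projDimLT_piece j
  | succ n ih =>
    obtain ⟨l, hl⟩ : ∃ l : C.Idx, (j : ℕ) + 1 = l := ⟨⟨j + 1, by omega⟩, rfl⟩
    have hln : C.len = n + l := by omega
    obtain ⟨e', he'⟩ := hC.exists_orderGE_le_maxSpace j
    have hmax := ih l hln (C.maxSpace j) (fun r hr x hx => hC.mul_mem j l hl r hr x hx) he'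
    have hst : orderGE k e ≤ C.stablePart l X := fun f hf r _ =>
      he (mem_orderGE.2 ((mem_orderGE.1 hf).mul_left r))
    have hmin := (ih l hln (C.stablePart l X) C.mul_mem_stablePart hst).mono
      (Nat.le_succ (n + 1))
    -- The order filtration of X is climbed downwards from order e, below which at most one vector
    -- per order has to be added.
    have key : ∀ m, ProjDimLT C.Eᵐᵒᵖ
        (C.homInto (C.stablePart l X ⊔ (X ⊓ orderGE k (e - m)))) (n + 2) := by
      intro m
      induction m with
      | zero => rwa [Nat.sub_zero, sup_eq_left.2 (inf_le_right.trans hst)]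
      | succ m ihm =>
        by_cases hm : m < e
        · obtain ⟨x, hx, hxe⟩ := exists_inf_orderGE_le X (e - (m + 1))
          rw [show e - (m + 1) + 1 = e - m by omega] at hxe
          rw [hxe, ← sup_assoc]
          exact hC.projDimLT_sup_span hl hX hmax le_sup_left
            (sup_le (C.stablePart_le l X) inf_le_left) ihm hx
        · rwa [show e - (m + 1) = e - m by omega]
    have h := key e
    rwa [Nat.sub_self, show orderGE k 0 = ⊤ from eq_top_iff.2 fun f _ =>
      mem_orderGE.2 (by rw [pow_zero]; exact one_dvd f), inf_top_eq,
      sup_eq_right.2 (C.stablePart_le l X)] at h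

theorem projDimLT_maxSpace (j : C.Idx) :
    ProjDimLT C.Eᵐᵒᵖ (C.homInto (C.maxSpace j)) (C.len + 1) := by
  obtain ⟨e, he⟩ := hC.exists_orderGE_le_maxSpace j
  refine (hC.projDimLT_homInto (C.len - j) j (by have := j.2; omega) (C.maxSpace j)
    (fun r hr x hx => ⟨(C.ring j).mul_mem hr hx.1, ?_⟩) he).mono (by omega)
  rw [map_mul, hx.2, mul_zero]

theorem projDimLT_S (j : C.Idx) : ProjDimLT C.Eᵐᵒᵖ (C.S j) (C.len + 3) := by
  refine Strict.projDimLT_S_iff.2 ?_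
  by_cases hj : (j : ℕ) = 1
  · rw [hC.radRows_of_isMin fun b => Subtype.coe_le_coe.1 (by have := b.2; omega)]
    exact (hC.projDimLT_maxSpace j).mono (by omega)
  · obtain ⟨i, hi⟩ : ∃ i : C.Idx, (i : ℕ) + 1 = j := by
      have := j.2
      exact ⟨⟨j - 1, by omega⟩, by simp only; omega⟩
    rw [hC.radRows_eq_sup hi]
    refine .sup ?_ ((C.projDimLT_piece i).mono (by omega))
      ((hC.projDimLT_maxSpace j).mono (by omega))
    rw [Strict.homInto_inf_maxSpace (Subtype.coe_le_coe.1 (by omega))]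
    exact hC.projDimLT_maxSpace i

/-- The endomorphism ring of a radical chain has finite global dimension. -/
theorem globalDim_le : globalDim C.Eᵐᵒᵖ ≤ ((C.len + 2 : ℕ) : ℕ∞) := by
  obtain ⟨z, hz⟩ := hC.detectsTorsion
  exact hz.globalDim_le _ hC.projDimLT_S

end Radical

end RingChain

end RadicalChains


/-! ### Semigroup rings, their maximal ideals, and greedy chains in terms of semigroups. -/

section SemigroupRings

variable {k : Type u} [Field k]

theorem mem_semigroupRing {H : AddSubmonoid ℕ} {f : k⟦X⟧} :
    f ∈ semigroupRing k H ↔ ∀ m, m ∉ H → PowerSeries.coeff m f = 0 := Iff.rfl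

theorem X_pow_mem_semigroupRing {H : AddSubmonoid ℕ} {x : ℕ} :
    (PowerSeries.X : k⟦X⟧) ^ x ∈ semigroupRing k H ↔ x ∈ H := by
  rw [mem_semigroupRing]
  constructor
  · intro h
    by_contra hx
    have := h x hx
    rw [PowerSeries.coeff_X_pow_self] at this
    exact one_ne_zero this
  · intro hx m hm
    rw [PowerSeries.coeff_X_pow, if_neg]
    rintro rfl
    exact hm hx

theorem semigroupRing_le_iff {H K : AddSubmonoid ℕ} :
    semigroupRing k H ≤ semigroupRing k K ↔ H ≤ K :=
  ⟨fun h _ hx => X_pow_mem_semigroupRing.1 (h (X_pow_mem_semigroupRing.2 hx)),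
    fun h _ hf m hm => hf m fun hmH => hm (h hmH)⟩

theorem semigroupRing_eq_top_iff {H : AddSubmonoid ℕ} : semigroupRing k H = ⊤ ↔ H = ⊤ := by
  constructor
  · intro h
    refine eq_top_iff.2 fun x _ => (X_pow_mem_semigroupRing (k := k)).1 ?_
    rw [h]; trivial
  · rintro rfl
    exact eq_top_iff.2 fun f _ m hm => absurd trivial hm

theorem inv_mem_semigroupRing {H : AddSubmonoid ℕ} {f : k⟦X⟧} (hf : f ∈ semigroupRing k H) :
    f⁻¹ ∈ semigroupRing k H := by
  intro m
  induction m using Nat.strong_induction_on with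
  | _ m ih =>
    intro hm
    have hm0 : m ≠ 0 := fun h => hm (h ▸ H.zero_mem)
    rw [PowerSeries.coeff_inv, if_neg hm0, Finset.sum_eq_zero, mul_zero]
    intro p hp
    have hp : p.1 + p.2 = m := by simpa using hp
    split_ifs with hlt
    · by_cases h1 : p.1 ∈ H
      · rw [ih p.2 hlt fun h2 => hm (hp ▸ H.add_mem h1 h2), mul_zero]
      · rw [hf _ h1, zero_mul]
    · rfl

theorem mem_radSet_semigroupRing {H : AddSubmonoid ℕ} {f : k⟦X⟧} :
    f ∈ radSet (semigroupRing k H) ↔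
      f ∈ semigroupRing k H ∧ PowerSeries.constantCoeff f = 0 := by
  constructor
  · rintro ⟨h, hJ⟩
    refine ⟨h, ?_⟩
    by_contra h0
    rw [← Ideal.jacobson_bot, Ideal.mem_jacobson_bot] at hJ
    have hu := (hJ ⟨-f⁻¹, (semigroupRing k H).neg_mem (inv_mem_semigroupRing h)⟩).map
      (semigroupRing k H).val
    have : (semigroupRing k H).val (⟨f, h⟩ *
        ⟨-f⁻¹, (semigroupRing k H).neg_mem (inv_mem_semigroupRing h)⟩ + 1) = 0 := by
      rw [map_add, map_mul, map_one]
      change f * -f⁻¹ + 1 = 0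
      rw [mul_neg, PowerSeries.mul_inv_cancel _ h0, neg_add_cancel]
    rw [this] at hu
    exact not_isUnit_zero hu
  · rintro ⟨h, h0⟩
    refine ⟨h, ?_⟩
    rw [← Ideal.jacobson_bot, Ideal.mem_jacobson_bot]
    rintro ⟨y, hy⟩
    have hc : PowerSeries.constantCoeff (f * y + 1) ≠ 0 := by
      rw [map_add, map_mul, h0, zero_mul, zero_add, map_one]
      exact one_ne_zero
    have hmem : f * y + 1 ∈ semigroupRing k H :=
      (semigroupRing k H).add_mem ((semigroupRing k H).mul_mem h hy) (semigroupRing k H).one_mem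
    exact IsUnit.of_mul_eq_one ⟨(f * y + 1)⁻¹, inv_mem_semigroupRing hmem⟩
      (Subtype.ext (PowerSeries.mul_inv_cancel _ hc))

theorem mul_mem_radSet {H K : AddSubmonoid ℕ} (hK : ∀ x ∈ K, ∀ y ∈ H, y ≠ 0 → x + y ∈ H)
    {f g : k⟦X⟧} (hf : f ∈ semigroupRing k K) (hg : g ∈ radSet (semigroupRing k H)) :
    f * g ∈ radSet (semigroupRing k H) := by
  rw [mem_radSet_semigroupRing] at hg ⊢
  refine ⟨fun m hm => ?_, by rw [map_mul, hg.2, mul_zero]⟩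
  rw [PowerSeries.coeff_mul]
  refine Finset.sum_eq_zero fun p hp => ?_
  have hp : p.1 + p.2 = m := by simpa using hp
  by_cases h1 : p.1 ∈ K
  · by_cases h2 : p.2 ∈ H
    · by_cases h3 : p.2 = 0
      · rw [h3, PowerSeries.coeff_zero_eq_constantCoeff_apply, hg.2, mul_zero]
      · exact absurd (hp ▸ hK _ h1 _ h2 h3) hm
    · rw [hg.1 _ h2, mul_zero]
  · rw [hf _ h1, zero_mul]

theorem semigroupRing_le_endMax {H K : AddSubmonoid ℕ}
    (hK : ∀ x ∈ K, ∀ y ∈ H, y ≠ 0 → x + y ∈ H) :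
    semigroupRing k K ≤ endMax (semigroupRing k H) :=
  fun _ hf _ hg => mul_mem_radSet hK hf hg

theorem mem_radSet_iff_of_principal {H K : AddSubmonoid ℕ} {s : ℕ}
    (h : ∀ y, (y ∈ H ∧ y ≠ 0) ↔ ∃ x ∈ K, y = s + x) {f : k⟦X⟧} :
    (f ∈ semigroupRing k H ∧ PowerSeries.constantCoeff f = 0) ↔
      ∃ g ∈ semigroupRing k K, PowerSeries.X ^ s * g = f := by
  constructor
  · rintro ⟨hf, h0⟩
    have hz : ∀ m, (∀ x ∈ K, m ≠ s + x) → PowerSeries.coeff m f = 0 := fun m hm => by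
      by_cases hm0 : m = 0
      · rw [hm0, PowerSeries.coeff_zero_eq_constantCoeff_apply, h0]
      · refine hf m fun hmH => ?_
        obtain ⟨x, hx, hxm⟩ := (h m).1 ⟨hmH, hm0⟩
        exact hm x hx hxm
    obtain ⟨g, rfl⟩ : PowerSeries.X ^ s ∣ f :=
      PowerSeries.X_pow_dvd_iff.2 fun m hm => hz m fun x _ => by omega
    refine ⟨g, fun m hm => ?_, rfl⟩
    have := hz (m + s) fun x hx hxm => hm (by rwa [show m = x by omega])
    rwa [PowerSeries.coeff_X_pow_mul] at this
  · rintro ⟨g, hg, rfl⟩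
    have hz : ∀ m, (∀ x ∈ K, m ≠ s + x) → PowerSeries.coeff m (PowerSeries.X ^ s * g) = 0 :=
      fun m hm => by
        rw [PowerSeries.coeff_X_pow_mul']
        split_ifs with hs
        · exact hg _ fun hK => hm _ hK (by omega)
        · rfl
    refine ⟨fun m hm => hz m fun x hx hxm => hm ((h m).2 ⟨x, hx, hxm⟩).1, ?_⟩
    rw [← PowerSeries.coeff_zero_eq_constantCoeff_apply]
    exact hz 0 fun x hx hx0 => ((h 0).2 ⟨x, hx, hx0⟩).2 rfl

/-- The maximal ideal is t^s R(K); an endomorphism f satisfies f t^s ∈ t^s R(K), hence f ∈ R(K). -/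
theorem endMax_eq_of_principal {H K : AddSubmonoid ℕ} {s : ℕ}
    (h : ∀ y, (y ∈ H ∧ y ≠ 0) ↔ ∃ x ∈ K, y = s + x) :
    endMax (semigroupRing k H) = semigroupRing k K := by
  apply le_antisymm
  · intro f hf
    have hX : (PowerSeries.X : k⟦X⟧) ^ s ∈ radSet (semigroupRing k H) :=
      mem_radSet_semigroupRing.2 ((mem_radSet_iff_of_principal h).2
        ⟨1, (semigroupRing k K).one_mem, mul_one _⟩)
    obtain ⟨g, hg, hgf⟩ := (mem_radSet_iff_of_principal h).1 (mem_radSet_semigroupRing.1 (hf _ hX))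
    rw [mul_comm f] at hgf
    rwa [← mul_left_cancel₀ (pow_ne_zero _ PowerSeries.X_ne_zero) hgf]
  · refine semigroupRing_le_endMax fun x hx y hy hy0 => ?_
    obtain ⟨z, hz, rfl⟩ := (h y).1 ⟨hy, hy0⟩
    exact ((h _).2 ⟨x + z, K.add_mem hx hz, by omega⟩).1

theorem finite_compl_of_forall_ge {H : AddSubmonoid ℕ} {c : ℕ} (hc : ∀ x, c ≤ x → x ∈ H) :
    ((H : Set ℕ)ᶜ).Finite :=
  (Set.finite_lt_nat c).subset fun x hx => not_le.1 fun h => hx (hc x h)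

namespace RingChain

/-- A chain of semigroup rings with strictly increasing semigroups is strict. -/
theorem strict_of_semigroups {C : RingChain k} {K : ℕ → AddSubmonoid ℕ} (hlen : 1 ≤ C.len)
    (hK : ∀ j, 1 ≤ j → j ≤ C.len → C.ring j = semigroupRing k (K j)) {c : ℕ}
    (hc : ∀ x, c ≤ x → x ∈ K 1)
    (hlt : ∀ i j, 1 ≤ i → i < j → j ≤ C.len → ∃ x ∈ K j, x ∉ K i) : C.Strict where
  conductor := by
    refine ⟨c + 1, by omega, fun f => ?_⟩
    rw [hK 1 le_rfl hlen]
    intro m hm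
    rw [PowerSeries.coeff_X_pow_mul', if_neg]
    exact fun h => hm (hc m (by omega))
  inv_mem j f hf _ := by
    rw [hK j j.2.1 j.2.2] at hf ⊢
    exact inv_mem_semigroupRing hf
  lt i j hij := by
    obtain ⟨x, hx, hx'⟩ := hlt i j i.2.1 hij j.2.2
    refine ⟨PowerSeries.X ^ x, ?_, ?_⟩
    · rw [hK j j.2.1 j.2.2, X_pow_mem_semigroupRing]; exact hx
    · rw [hK i i.2.1 i.2.2, X_pow_mem_semigroupRing]; exact hx'

end RingChain

/-- A sequence `K 1, …, K l = ℕ` of numerical semigroups, all but the last one proper, such that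
`K j \ {0} = s j + K (j + 1)`. -/
structure PrincipalSequence (K : ℕ → AddSubmonoid ℕ) (s : ℕ → ℕ) (l : ℕ) : Prop where
  two_le : 2 ≤ l
  cofinite : ∃ c, ∀ x, c ≤ x → x ∈ K 1
  last : K l = ⊤
  ne_top : ∀ j, 1 ≤ j → j < l → K j ≠ ⊤
  step : ∀ j, 1 ≤ j → j < l → ∀ y, (y ∈ K j ∧ y ≠ 0) ↔ ∃ x ∈ K (j + 1), y = s j + x

namespace PrincipalSequence

variable {K : ℕ → AddSubmonoid ℕ} {s : ℕ → ℕ} {l : ℕ} (h : PrincipalSequence K s l)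
include h

theorem shift_mem {j : ℕ} (hj : 1 ≤ j) (hjl : j < l) : s j ∈ K j ∧ s j ≠ 0 :=
  (h.step j hj hjl _).2 ⟨0, (K (j + 1)).zero_mem, rfl⟩

theorem le_succ {j : ℕ} (hj : 1 ≤ j) (hjl : j < l) : K j ≤ K (j + 1) := fun x hx => by
  have hs := h.shift_mem hj hjl
  obtain ⟨y, hy, hxy⟩ := (h.step j hj hjl (s j + x)).1 ⟨(K j).add_mem hs.1 hx, by omega⟩
  rwa [show x = y by omega]

theorem mono {i j : ℕ} (hi : 1 ≤ i) (hij : i ≤ j) (hjl : j ≤ l) : K i ≤ K j := by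
  induction j, hij using Nat.le_induction with
  | base => exact le_rfl
  | succ j hij ih => exact (ih (by omega)).trans (h.le_succ (by omega) (by omega))

/-- If K_j ⊆ K_i, then also K_{i+1} ⊆ K_i, so s_i + x ∈ K_i implies x ∈ K_i. Descending from the
conductor would give K_i = ℕ. -/
theorem exists_notMem {i j : ℕ} (hi : 1 ≤ i) (hij : i < j) (hjl : j ≤ l) :
    ∃ x ∈ K j, x ∉ K i := by
  by_contra! hcon
  obtain ⟨c, hc⟩ := h.cofinite
  refine h.ne_top i hi (by omega) (eq_top_iff.2 fun x _ => ?_)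
  have hs := h.shift_mem hi (by omega)
  have key : ∀ n x, c ≤ n + x → x ∈ K i := fun n => by
    induction n with
    | zero => exact fun x hx => h.mono le_rfl hi (by omega) (hc x (by omega))
    | succ n ih =>
      intro x hx
      obtain ⟨y, hy, hxy⟩ := (h.step i hi (by omega) (s i + x)).1 ⟨ih _ (by omega), by omega⟩
      rw [show x = y by omega]
      exact hcon _ (h.mono (by omega) (by omega) hjl hy)
  exact key c x (by omega)

theorem greedyRing_eq {j : ℕ} (hj : 1 ≤ j) (hjl : j ≤ l) :
    greedyRing (semigroupRing k (K 1)) j = semigroupRing k (K j) := by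
  induction j, hj using Nat.le_induction with
  | base => rfl
  | succ j hj ih =>
    obtain ⟨j, rfl⟩ : ∃ i, j = i + 1 := ⟨j - 1, by omega⟩
    rw [greedyRing, ih (by omega)]
    exact endMax_eq_of_principal (h.step _ hj (by omega))

theorem greedyChain_len : (greedyChain (semigroupRing k (K 1))).len = l := by
  have h2 := h.two_le
  have hl : l ∈ {l | 1 ≤ l ∧ greedyRing (semigroupRing k (K 1)) l = ⊤} :=
    ⟨by omega, by rw [h.greedyRing_eq (by omega) le_rfl, semigroupRing_eq_top_iff, h.last]⟩
  refine le_antisymm (Nat.sInf_le hl) ?_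
  by_contra! hlt
  obtain ⟨h1, htop⟩ := Nat.sInf_mem ⟨l, hl⟩
  change (greedyChain (semigroupRing k (K 1))).len < l at hlt
  change 1 ≤ (greedyChain (semigroupRing k (K 1))).len at h1
  change greedyRing _ (greedyChain (semigroupRing k (K 1))).len = ⊤ at htop
  rw [h.greedyRing_eq h1 hlt.le, semigroupRing_eq_top_iff] at htop
  exact h.ne_top _ h1 hlt htop

theorem greedyChain_ring {j : ℕ} (hj : 1 ≤ j) (hjl : j ≤ l) :
    (greedyChain (semigroupRing k (K 1))).ring j = semigroupRing k (K j) :=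
  h.greedyRing_eq hj hjl

theorem arf : (greedyChain (semigroupRing k (K 1))).Arf s := by
  have hlen := h.greedyChain_len (k := k)
  have h2 := h.two_le
  obtain ⟨c, hc⟩ := h.cofinite
  refine ⟨RingChain.strict_of_semigroups (K := K) (by omega)
    (fun j hj hjl => h.greedyChain_ring hj (by omega)) hc
    (fun i j hi hij hj => h.exists_notMem hi hij (by omega)), by omega, ?_, fun i j hij => ?_⟩
  · rw [hlen, h.greedyChain_ring (by omega) le_rfl, semigroupRing_eq_top_iff, h.last]
  · have hi := i.2
    have hj := j.2
    ext f
    rw [RingChain.mem_maxSpace, h.greedyChain_ring hi.1 (by omega),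
      mem_radSet_iff_of_principal (h.step i hi.1 (by omega)), mem_scale]
    have : (greedyChain (semigroupRing k (K 1))).pieceSpace j =
        Subalgebra.toSubmodule (semigroupRing k (K (i + 1))) := by
      rw [RingChain.pieceSpace, ← hij, h.greedyChain_ring (by omega) (by omega)]
    rw [this]
    rfl

theorem isRadicalChain : (greedyChain (semigroupRing k (K 1))).IsRadicalChain := by
  have hlen := h.greedyChain_len (k := k)
  have h2 := h.two_le
  obtain ⟨c, hc⟩ := h.cofinite
  refine ⟨by omega, fun j hj hjl => ⟨K j, ?_, h.greedyChain_ring hj (by omega)⟩,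
    fun j hj hjl => ?_, (h.arf (k := k)).last, ?_⟩
  · exact finite_compl_of_forall_ge fun x hx => h.mono le_rfl hj (by omega) (hc x hx)
  · rw [h.greedyChain_ring (by omega) (by omega), h.greedyChain_ring hj (by omega),
      endMax_eq_of_principal (h.step j hj (by omega))]
  · rw [hlen, h.greedyChain_ring (by omega) (by omega), Ne, semigroupRing_eq_top_iff]
    exact h.ne_top _ (by omega) (by omega)

end PrincipalSequence

end SemigroupRings


/-! ### The ladder of semigroups -/

section Ladder

/-- The semigroup `{0, h, 2h, …, mh} ∪ [c + mh, ∞)`. -/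
def ladder (c h : ℕ) (hch : c ≤ h) (m : ℕ) : AddSubmonoid ℕ where
  carrier := {x | (∃ j, j ≤ m ∧ x = j * h) ∨ c + m * h ≤ x}
  zero_mem' := Or.inl ⟨0, Nat.zero_le _, (zero_mul h).symm⟩
  add_mem' := by
    rintro x y (⟨j, hj, rfl⟩ | hx) (⟨j', hj', rfl⟩ | hy)
    · rw [← add_mul]
      by_cases hle : j + j' ≤ m
      · exact Or.inl ⟨_, hle, rfl⟩
      · refine Or.inr ?_
        have := Nat.mul_le_mul_right h (show m + 1 ≤ j + j' by omega)
        rw [add_mul, one_mul] at this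
        omega
    · exact Or.inr (by omega)
    · exact Or.inr (by omega)
    · exact Or.inr (by omega)

variable {c h : ℕ} (hch : c ≤ h)

theorem mem_ladder {m x : ℕ} :
    x ∈ ladder c h hch m ↔ (∃ j, j ≤ m ∧ x = j * h) ∨ c + m * h ≤ x := Iff.rfl

theorem mem_ladder_zero {x : ℕ} : x ∈ ladder c h hch 0 ↔ x = 0 ∨ c ≤ x := by
  rw [mem_ladder]
  constructor
  · rintro (⟨j, hj, rfl⟩ | hx)
    · left; rw [Nat.le_zero.1 hj, zero_mul]
    · right; omega
  · rintro (rfl | hx)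
    · exact Or.inl ⟨0, le_rfl, (zero_mul h).symm⟩
    · right; omega

/-- This recursion says that the maximal ideal of R(L_{m+1}) is t^h R(L_m); later arguments rely on
it instead of the explicit list of exponents. -/
theorem mem_ladder_succ {m x : ℕ} :
    x ∈ ladder c h hch (m + 1) ↔ x = 0 ∨ ∃ y ∈ ladder c h hch m, x = h + y := by
  simp only [mem_ladder]
  constructor
  · rintro (⟨j, hj, rfl⟩ | hx)
    · rcases j with _ | j
      · left; exact zero_mul h
      · exact Or.inr ⟨j * h, Or.inl ⟨j, by omega, rfl⟩, by ring⟩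
    · rw [add_mul, one_mul] at hx
      exact Or.inr ⟨x - h, Or.inr (by omega), by omega⟩
  · rintro (rfl | ⟨y, ⟨j, hj, rfl⟩ | hy, rfl⟩)
    · exact Or.inl ⟨0, by omega, (zero_mul h).symm⟩
    · exact Or.inl ⟨j + 1, by omega, by ring⟩
    · right; rw [add_mul, one_mul]; omega

theorem add_mem_ladder_succ {m y : ℕ} (hy : y ∈ ladder c h hch m) :
    h + y ∈ ladder c h hch (m + 1) := (mem_ladder_succ hch).2 (Or.inr ⟨y, hy, rfl⟩)

theorem add_mem_ladder_succ_iff (hpos : 1 ≤ h) {m y : ℕ} :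
    h + y ∈ ladder c h hch (m + 1) ↔ y ∈ ladder c h hch m := by
  refine ⟨fun hy => ?_, add_mem_ladder_succ hch⟩
  obtain hy | ⟨z, hz, hyz⟩ := (mem_ladder_succ hch).1 hy
  · omega
  · rwa [show y = z by omega]

theorem ladder_succ_le (m : ℕ) : ladder c h hch (m + 1) ≤ ladder c h hch m := by
  induction m with
  | zero =>
    intro x hx
    rw [mem_ladder_succ] at hx
    rw [mem_ladder_zero]
    rcases hx with rfl | ⟨y, -, rfl⟩ <;> omega
  | succ m ih =>
    intro x hx
    rw [mem_ladder_succ] at hx ⊢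
    exact hx.imp_right fun ⟨y, hy, hxy⟩ => ⟨y, ih hy, hxy⟩

theorem ladder_antitone : Antitone (ladder c h hch) := antitone_nat_of_succ_le (ladder_succ_le hch)

theorem eq_zero_of_mem_ladder_succ {m x : ℕ} (hx : x ∈ ladder c h hch (m + 1)) (hxh : x < h) :
    x = 0 := by
  obtain h0 | ⟨y, -, rfl⟩ := (mem_ladder_succ hch).1 hx
  · exact h0
  · omega

theorem step_mem_ladder (m : ℕ) : h ∈ ladder c h hch m := by
  rcases m with _ | m
  · exact (mem_ladder_zero hch).2 (Or.inr hch)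
  · simpa using add_mem_ladder_succ hch (ladder c h hch m).zero_mem

/-- Successive members of the ladder differ. -/
theorem exists_mem_ladder_notMem_succ (hc : 2 ≤ c) (m : ℕ) :
    ∃ x ∈ ladder c h hch m, x ∉ ladder c h hch (m + 1) := by
  induction m with
  | zero =>
    rcases hch.lt_or_eq with hlt | heq
    · refine ⟨c, (mem_ladder_zero hch).2 (Or.inr le_rfl), fun hx => ?_⟩
      have := eq_zero_of_mem_ladder_succ hch hx hlt
      omega
    · refine ⟨h + 1, (mem_ladder_zero hch).2 (Or.inr (by omega)), fun hx => ?_⟩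
      rw [add_mem_ladder_succ_iff hch (by omega), mem_ladder_zero] at hx
      omega
  | succ m ih =>
    obtain ⟨x, hx, hx'⟩ := ih
    exact ⟨h + x, add_mem_ladder_succ hch hx, fun hx'' =>
      hx' ((add_mem_ladder_succ_iff hch (by omega)).1 hx'')⟩

/-- The semigroup `{0, 2h, …, (m + 1)h} ∪ [c + (m + 1)h, ∞)`, obtained from a ladder by removing
`h` (if `h ≥ 1`). -/
def punctured (m : ℕ) : AddSubmonoid ℕ where
  -- The clause `x = h → h = 0` replaces x ≠ h so that 0 remains an element when h = 0.
  carrier := {x | x ∈ ladder c h hch (m + 1) ∧ (x = h → h = 0)}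
  zero_mem' := ⟨zero_mem _, fun h => h.symm⟩
  add_mem' := by
    rintro x y ⟨hx, hx'⟩ ⟨hy, hy'⟩
    refine ⟨add_mem hx hy, fun hxy => ?_⟩
    by_contra h0
    have hx0 : x = 0 := eq_zero_of_mem_ladder_succ hch hx (by omega)
    have hy0 : y = 0 := eq_zero_of_mem_ladder_succ hch hy (by omega)
    omega

variable (hpos : 1 ≤ h)
include hpos

theorem mem_punctured {m x : ℕ} :
    x ∈ punctured hch m ↔ x ∈ ladder c h hch (m + 1) ∧ x ≠ h := by
  change _ ∧ _ ↔ _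
  refine and_congr_right fun _ => ⟨fun hx hxh => ?_, fun hx hxh => absurd hxh hx⟩
  have := hx hxh
  omega

theorem punctured_le (m : ℕ) : punctured hch m ≤ ladder c h hch (m + 1) :=
  fun _ hx => ((mem_punctured hch hpos).1 hx).1

/-- A nonzero element of L_{m+2} is h + y with y ∈ L_{m+1}; excluding h forces y ≠ 0, so a second h
splits off. -/
theorem mem_punctured_ne_zero {m x : ℕ} : (x ∈ punctured hch (m + 1) ∧ x ≠ 0) ↔
    ∃ y ∈ ladder c h hch m, x = 2 * h + y := by
  rw [mem_punctured hch hpos]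
  constructor
  · rintro ⟨⟨hx, hxh⟩, hx0⟩
    obtain h0 | ⟨y, hy, rfl⟩ := (mem_ladder_succ hch).1 hx
    · exact absurd h0 hx0
    obtain h0 | ⟨z, hz, rfl⟩ := (mem_ladder_succ hch).1 hy
    · omega
    · exact ⟨z, hz, by ring⟩
  · rintro ⟨y, hy, rfl⟩
    refine ⟨⟨?_, by omega⟩, by omega⟩
    have := add_mem_ladder_succ hch (add_mem_ladder_succ hch hy)
    rwa [← add_assoc, ← two_mul] at this

end Ladder

/-! ### The family A(i) and its greedy chains. -/

section Family

variable {k : Type u} [Field k]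

/-- The parameters are h = n/2 and c = a + 1 - 3n/2; the bounds on a amount to 2 ≤ c ≤ h. -/
theorem familySemigroup_eq_punctured {n a i : ℕ} (hn : Even n) (hn6 : 6 ≤ n)
    (ha : 3 * n / 2 + 1 ≤ a) (ha' : a ≤ 2 * n - 1) (hi : 2 ≤ i)
    (hch : a + 1 - 3 * (n / 2) ≤ n / 2) :
    familySemigroup n a i hn hn6 ha' (by omega) =
      punctured hch i := by
  obtain ⟨t, rfl⟩ : ∃ t, i = t + 2 := ⟨i - 2, by omega⟩
  have hh : 3 * n / 2 = 3 * (n / 2) := by obtain ⟨r, rfl⟩ := hn; omega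
  have hcond : familyConductor n a (t + 2) =
      a + 1 - 3 * (n / 2) + (t + 2 + 1) * (n / 2) := by
    rw [familyConductor, if_neg (by omega), Nat.add_sub_cancel,
      show (t + 2 + 1) * (n / 2) = t * (n / 2) + 3 * (n / 2) by ring]
    omega
  have hge := Nat.le_mul_of_pos_left (n / 2) (show 0 < t + 2 + 1 by omega)
  ext x
  rw [mem_punctured hch (by omega), mem_ladder]
  change (x = 0 ∨ (∃ j, 2 ≤ j ∧ j ≤ t + 2 + 1 ∧ x = j * (n / 2)) ∨
    familyConductor n a (t + 2) ≤ x) ↔ _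
  rw [hcond]
  constructor
  · rintro (rfl | ⟨j, hj, hj', rfl⟩ | hx)
    · exact ⟨Or.inl ⟨0, by omega, (zero_mul _).symm⟩, by omega⟩
    · refine ⟨Or.inl ⟨j, hj', rfl⟩, fun h => ?_⟩
      have := Nat.mul_le_mul_right (n / 2) hj
      omega
    · exact ⟨Or.inr hx, by omega⟩
  · rintro ⟨⟨j, hj, rfl⟩ | hx, hne⟩
    · rcases j with _ | _ | j
      · left; exact zero_mul _
      · exact absurd (by ring) hne
      · exact Or.inr (Or.inl ⟨j + 2, by omega, hj, rfl⟩)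
    · exact Or.inr (Or.inr hx)

/-- The semigroups of the greedy chain starting with a punctured ladder. -/
def greedySemigroup (c h : ℕ) (hch : c ≤ h) (i j : ℕ) : AddSubmonoid ℕ :=
  if j = 1 then punctured hch i else if j ≤ i + 1 then ladder c h hch (i + 1 - j) else ⊤

/-- The shifts of the greedy chain starting with a punctured ladder. -/
def greedyShift (c h i j : ℕ) : ℕ := if j = 1 then 2 * h else if j ≤ i then h else c

theorem ladder_cofinite {c h : ℕ} (hch : c ≤ h) (m x : ℕ) (hx : c + m * h ≤ x) :
    x ∈ ladder c h hch m := Or.inr hx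

theorem ladder_ne_top {c h : ℕ} (hch : c ≤ h) (hc : 2 ≤ c) (m : ℕ) : ladder c h hch m ≠ ⊤ := by
  intro htop
  have h1 : 1 ∈ ladder c h hch 0 := ladder_antitone hch (Nat.zero_le m) (htop ▸ trivial)
  rw [mem_ladder_zero] at h1
  omega

/-- The greedy semigroups are Q_i, L_{i-1}, …, L_0, ℕ with shifts 2h, h, …, h, c. Only the first and
the last shift can differ from h, which is why (a) needs 3 ≤ j ≤ l - 2. -/
theorem principalSequence_greedy {c h i : ℕ} (hch : c ≤ h) (hc : 2 ≤ c) (hi : 2 ≤ i) :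
    PrincipalSequence (greedySemigroup c h hch i) (greedyShift c h i) (i + 2) where
  two_le := by omega
  cofinite := by
    refine ⟨c + (i + 1) * h + (h + 1), fun x hx => ?_⟩
    rw [greedySemigroup, if_pos rfl, mem_punctured hch (by omega)]
    exact ⟨ladder_cofinite hch _ x (by omega), by omega⟩
  last := by rw [greedySemigroup, if_neg (by omega), if_neg (by omega)]
  ne_top j hj hjl htop := by
    rw [greedySemigroup] at htop
    split_ifs at htop with h1 h2
    · refine ladder_ne_top hch hc (i + 1) (eq_top_iff.2 ?_)
      rw [← htop]
      exact punctured_le hch (by omega) i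
    · exact ladder_ne_top hch hc _ htop
    · omega
  step j hj hjl y := by
    rw [greedySemigroup, greedySemigroup, greedyShift, if_neg (show ¬ j + 1 = 1 by omega)]
    split_ifs with h1 h2 h3 h4 h5 h6
    · obtain ⟨i, rfl⟩ : ∃ t, i = t + 1 := ⟨i - 1, by omega⟩
      rw [mem_punctured_ne_zero hch (by omega), show i + 1 + 1 - (j + 1) = i by omega]
    · omega
    · obtain ⟨m, hm⟩ : ∃ m, i + 1 - j = m + 1 := ⟨i - j, by omega⟩
      rw [hm, show i + 1 - (j + 1) = m by omega, mem_ladder_succ]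
      constructor
      · rintro ⟨rfl | h, h0⟩
        · exact absurd rfl h0
        · exact h
      · rintro ⟨x, hx, rfl⟩
        exact ⟨Or.inr ⟨x, hx, rfl⟩, by omega⟩
    · omega
    · omega
    · rw [show i + 1 - j = 0 by omega, mem_ladder_zero]
      constructor
      · rintro ⟨rfl | h, h0⟩
        · exact absurd rfl h0
        · exact ⟨y - c, trivial, by omega⟩
      · rintro ⟨x, -, rfl⟩
        exact ⟨Or.inr (by omega), by omega⟩
    all_goals omega

/-- The semigroups of the greedy chain starting with `{0, 2h} ∪ [3h, ∞)`. -/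
def firstGreedySemigroup (h : ℕ) (H : AddSubmonoid ℕ) (j : ℕ) : AddSubmonoid ℕ :=
  if j = 1 then H else if j = 2 then ladder h h le_rfl 0 else ⊤

/-- The case i = 1, where the greedy semigroups are {0, 2h} ∪ [3h, ∞), {0} ∪ [h, ∞), ℕ. -/
theorem principalSequence_first {h : ℕ} (hh : 2 ≤ h) {H : AddSubmonoid ℕ}
    (hH : ∀ x, x ∈ H ↔ x = 0 ∨ x = 2 * h ∨ 3 * h ≤ x) :
    PrincipalSequence (firstGreedySemigroup h H) (fun j => if j = 1 then 2 * h else h) 3 where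
  two_le := by omega
  cofinite := ⟨3 * h, fun x hx => (hH x).2 (Or.inr (Or.inr hx))⟩
  last := rfl
  ne_top j hj hjl htop := by
    obtain rfl | rfl : j = 1 ∨ j = 2 := by omega
    · have h1 : 1 ∈ H := by change H = ⊤ at htop; rw [htop]; trivial
      rw [hH] at h1
      omega
    · exact ladder_ne_top le_rfl hh 0 htop
  step j hj hjl y := by
    obtain rfl | rfl : j = 1 ∨ j = 2 := by omega
    · change y ∈ H ∧ _ ↔ ∃ x ∈ ladder h h le_rfl 0, y = 2 * h + x
      simp only [hH, mem_ladder_zero]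
      constructor
      · rintro ⟨hy, h0⟩
        exact ⟨y - 2 * h, by omega, by omega⟩
      · rintro ⟨x, hx, rfl⟩
        omega
    · change y ∈ ladder h h le_rfl 0 ∧ _ ↔ ∃ x ∈ (⊤ : AddSubmonoid ℕ), y = h + x
      rw [mem_ladder_zero]
      constructor
      · rintro ⟨hy, h0⟩
        exact ⟨y - h, trivial, by omega⟩
      · rintro ⟨x, -, rfl⟩
        omega

/-- The greedy chain of `A(i)` comes from a sequence of semigroups. -/
theorem exists_principalSequence {n a i : ℕ} (hn : Even n) (hn6 : 6 ≤ n)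
    (ha : 3 * n / 2 + 1 ≤ a) (ha' : a ≤ 2 * n - 1) (hi : 1 ≤ i) :
    ∃ (K : ℕ → AddSubmonoid ℕ) (s : ℕ → ℕ) (l : ℕ), PrincipalSequence K s l ∧
      K 1 = familySemigroup n a i hn hn6 ha' hi ∧ 2 ≤ s (l - 1) ∧
      ∀ j, 2 ≤ j → j + 2 ≤ l → 3 ≤ i → s j = n / 2 := by
  have hh : 3 * n / 2 = 3 * (n / 2) := by obtain ⟨r, rfl⟩ := hn; omega
  have hn2 : n = 2 * (n / 2) := by obtain ⟨r, rfl⟩ := hn; omega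
  by_cases hi2 : 2 ≤ i
  · have hch : a + 1 - 3 * (n / 2) ≤ n / 2 := by omega
    refine ⟨_, _, _, principalSequence_greedy (i := i) hch (by omega) hi2, ?_, ?_, ?_⟩
    · rw [familySemigroup_eq_punctured hn hn6 ha ha' hi2 hch]; rfl
    · rw [greedyShift, if_neg (by omega), if_neg (by omega)]
      omega
    · intro j hj hjl _
      rw [greedyShift, if_neg (by omega), if_pos (by omega)]
  · obtain rfl : i = 1 := by omega
    refine ⟨_, _, _, principalSequence_first (h := n / 2) (by omega)
      (H := familySemigroup n a 1 hn hn6 ha' hi) (fun x => ?_), rfl, ?_, fun j _ _ h => by omega⟩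
    · change (x = 0 ∨ (∃ j, 2 ≤ j ∧ j ≤ 1 + 1 ∧ x = j * (n / 2)) ∨
        familyConductor n a 1 ≤ x) ↔ _
      rw [familyConductor, if_pos rfl]
      refine or_congr_right (or_congr_left ⟨?_, fun hx => ⟨2, le_rfl, le_rfl, hx⟩⟩)
      rintro ⟨j, hj, hj', rfl⟩
      rw [show j = 2 by omega]
    · change 2 ≤ n / 2
      omega

end Family


/-! ### Radical chains given by sequences of semigroups -/

section RadicalSequences

/-- A sequence of semigroups `K 1 ⊂ ⋯ ⊂ K l = ℕ` defining a radical chain of semigroup rings. -/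
structure RadicalSequence (K : ℕ → AddSubmonoid ℕ) (l : ℕ) : Prop where
  mono : Monotone K
  two_le : 2 ≤ l
  cofinite : ∃ c, ∀ x, c ≤ x → x ∈ K 1
  last : K l = ⊤
  exists_notMem : ∀ j, 1 ≤ j → j < l → ∃ x ∈ K (j + 1), x ∉ K j
  add_mem : ∀ j, 1 ≤ j → j < l → ∀ x ∈ K (j + 1), ∀ y ∈ K j, y ≠ 0 → x + y ∈ K j

/-- The chain of semigroup rings of a monotone sequence of semigroups. -/
def semigroupChain (k : Type u) [Field k] (K : ℕ → AddSubmonoid ℕ) (hK : Monotone K) (l : ℕ) :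
    RingChain k where
  len := l
  ring j := semigroupRing k (K j)
  mono _ _ _ hij _ := semigroupRing_le_iff.2 (hK hij)

namespace RadicalSequence

variable {k : Type u} [Field k] {K : ℕ → AddSubmonoid ℕ} {l : ℕ} (h : RadicalSequence K l)
include h

theorem radical : (semigroupChain k K h.mono l).Radical := by
  obtain ⟨c, hc⟩ := h.cofinite
  have h2 := h.two_le
  refine ⟨RingChain.strict_of_semigroups (K := K) (by change 1 ≤ l; omega) (fun _ _ _ => rfl) hc
    fun i j hi hij hj => ?_, ?_, fun i j hij f hf g hg => ?_⟩
  · change j ≤ l at hj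
    obtain ⟨x, hx, hx'⟩ := h.exists_notMem i hi (by omega)
    exact ⟨x, h.mono hij hx, hx'⟩
  · exact semigroupRing_eq_top_iff.2 h.last
  · have hj := j.2.2
    change (j : ℕ) ≤ l at hj
    rw [← hij] at hf
    have := mul_mem_radSet (h.add_mem i i.2.1 (by omega)) hf (mem_radSet_semigroupRing.2 hg)
    exact mem_radSet_semigroupRing.1 this

theorem isRadicalChain : (semigroupChain k K h.mono l).IsRadicalChain := by
  obtain ⟨c, hc⟩ := h.cofinite
  have h2 := h.two_le
  refine ⟨h2, fun j hj _ => ⟨K j, finite_compl_of_forall_ge fun x hx => h.mono hj (hc x hx), rfl⟩,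
    fun j hj hjl => semigroupRing_le_endMax (h.add_mem j hj hjl),
    semigroupRing_eq_top_iff.2 h.last, fun htop => ?_⟩
  obtain ⟨x, -, hx⟩ := h.exists_notMem (l - 1) (by omega) (by omega)
  exact hx ((semigroupRing_eq_top_iff.1 htop) ▸ trivial)

end RadicalSequence

end RadicalSequences

/-! ### A radical chain of large global dimension -/

section SlowChain

variable {c h : ℕ} (hch : c ≤ h)

/-- The semigroups of a chain of punctured ladders, followed by the end of a greedy chain. -/
def slowSemigroup (i j : ℕ) : AddSubmonoid ℕ :=
  if j + 1 ≤ i then punctured hch (i + 1 - j)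
  else if j ≤ i + 1 then ladder c h hch (i + 1 - j) else ⊤

theorem add_mem_ladder_of_mem {m x y : ℕ} (hx : x ∈ ladder c h hch m)
    (hy : y ∈ ladder c h hch (m + 1)) (hy0 : y ≠ 0) : x + y ∈ ladder c h hch (m + 1) := by
  obtain h0 | ⟨z, hz, rfl⟩ := (mem_ladder_succ hch).1 hy
  · exact absurd h0 hy0
  · rw [add_left_comm]
    exact add_mem_ladder_succ hch (add_mem hx hz)

theorem two_mul_step_add_mem {m x y : ℕ} (hpos : 1 ≤ h) (hx : x ∈ ladder c h hch m)
    (hy : y ∈ punctured hch (m + 1)) (hy0 : y ≠ 0) : x + y ∈ punctured hch (m + 1) := by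
  obtain ⟨z, hz, rfl⟩ := (mem_punctured_ne_zero hch hpos).1 ⟨hy, hy0⟩
  exact ((mem_punctured_ne_zero hch hpos).2 ⟨x + z, add_mem hx hz, by ring⟩).1

theorem punctured_succ_le (hpos : 1 ≤ h) (m : ℕ) : punctured hch (m + 1) ≤ punctured hch m :=
  fun x hx => by
    rw [mem_punctured hch hpos] at hx ⊢
    exact ⟨ladder_succ_le hch _ hx.1, hx.2⟩

/-- The nonzero part of Q_{m+1} is 2h + L_m, hence stable under all of L_m. This contains Q_m, so
the chain may pass to Q_m instead of L_m, and it may pass from Q_2 to L_1. The steps are strict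
because L_{m+1} ≠ L_m and h lies in every L_m. -/
theorem radicalSequence_slow (hc : 2 ≤ c) (hh : 3 ≤ h) {i : ℕ} (hi : 2 ≤ i) :
    RadicalSequence (slowSemigroup hch i) (i + 2) := by
  have hpos : 1 ≤ h := by omega
  have hlad : ∀ m, ∃ x ∈ ladder c h hch m, x ∉ ladder c h hch (m + 1) :=
    exists_mem_ladder_notMem_succ hch hc
  refine ⟨monotone_nat_of_le_succ fun j => ?_, by omega, ?_, ?_, fun j hj hjl => ?_,
    fun j hj hjl => ?_⟩
  · rw [slowSemigroup, slowSemigroup]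
    split_ifs with h1 h2 h3 h4 h5
    · rw [show i + 1 - j = i + 1 - (j + 1) + 1 by omega]
      exact punctured_succ_le hch hpos _
    · exact (punctured_le hch hpos _).trans (ladder_antitone hch (by omega))
    · exact le_top
    · omega
    · exact ladder_antitone hch (by omega)
    · exact le_top
    all_goals first | omega | exact le_top
  · refine ⟨c + (i + 1) * h + (h + 1), fun x hx => ?_⟩
    rw [slowSemigroup, if_pos (by omega), mem_punctured hch hpos]
    exact ⟨ladder_cofinite hch _ x (by rw [Nat.add_sub_cancel]; omega), by omega⟩
  · rw [slowSemigroup, if_neg (by omega), if_neg (by omega)]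
  · rw [slowSemigroup, slowSemigroup]
    obtain h1 | rfl | rfl | rfl : j + 2 ≤ i ∨ i = j + 1 ∨ i = j ∨ j = i + 1 := by omega
    · obtain ⟨m, hm⟩ : ∃ m, i + 1 - (j + 1) = m + 1 := ⟨i - j - 1, by omega⟩
      obtain ⟨x, hx, hx'⟩ := hlad (m + 2)
      rw [if_pos (by omega), if_pos (by omega), hm, show i + 1 - j = m + 2 by omega]
      refine ⟨x, (mem_punctured hch hpos).2 ⟨hx, ?_⟩, fun hx'' =>
        hx' ((mem_punctured hch hpos).1 hx'').1⟩
      rintro rfl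
      exact hx' (step_mem_ladder hch _)
    · rw [if_neg (by omega), if_pos (by omega), if_pos (by omega)]
      exact ⟨h, step_mem_ladder hch _, fun hx => ((mem_punctured hch hpos).1 hx).2 rfl⟩
    · rw [if_neg (by omega), if_pos (by omega), if_neg (by omega), if_pos (by omega),
        Nat.sub_self, Nat.add_sub_cancel_left]
      exact hlad 0
    · rw [if_neg (by omega), if_neg (by omega), if_neg (by omega), if_pos (by omega), Nat.sub_self]
      refine ⟨1, trivial, fun hx => ?_⟩
      rw [mem_ladder_zero] at hx
      omega
  · rw [slowSemigroup, slowSemigroup]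
    intro x hx y hy hy0
    obtain h1 | rfl | rfl | rfl : j + 2 ≤ i ∨ i = j + 1 ∨ i = j ∨ j = i + 1 := by omega
    · obtain ⟨m, hm⟩ : ∃ m, i + 1 - j = m + 1 := ⟨i - j, by omega⟩
      rw [if_pos (by omega), show i + 1 - (j + 1) = m by omega] at hx
      rw [if_pos (by omega), hm] at hy ⊢
      exact two_mul_step_add_mem hch hpos (ladder_succ_le hch _ (punctured_le hch hpos _ hx)) hy hy0
    · rw [if_neg (by omega), if_pos (by omega), Nat.add_sub_cancel_left] at hx
      rw [if_pos (by omega), show j + 1 + 1 - j = 1 + 1 by omega] at hy ⊢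
      exact two_mul_step_add_mem hch hpos hx hy hy0
    · rw [if_neg (by omega), if_pos (by omega), Nat.sub_self] at hx
      rw [if_neg (by omega), if_pos (by omega), Nat.add_sub_cancel_left] at hy ⊢
      exact add_mem_ladder_of_mem hch hx hy hy0
    · rw [if_neg (by omega), if_pos (by omega), Nat.sub_self, mem_ladder_zero] at hy ⊢
      omega

/-- The slow chain of semigroup rings. -/
def slowChain (k : Type u) [Field k] (hc : 2 ≤ c) (hh : 3 ≤ h) {i : ℕ} (hi : 2 ≤ i) :
    RingChain k :=
  semigroupChain k (slowSemigroup hch i) (radicalSequence_slow hch hc hh hi).mono (i + 2)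

end SlowChain

/-! ### Lower bounds for the global dimension of the slow chain. -/

section Lower

variable {k : Type u} [Field k]

theorem add_mem_of_coeff_ne_zero {H K : AddSubmonoid ℕ} {f : k⟦X⟧} {u d : ℕ}
    (hf : ∀ r ∈ semigroupRing k K, r * f ∈ semigroupRing k H) (hu : u ∈ K)
    (hd : PowerSeries.coeff d f ≠ 0) : d + u ∈ H := by
  by_contra hn
  have := hf _ (X_pow_mem_semigroupRing.2 hu) _ hn
  rw [PowerSeries.coeff_X_pow_mul] at this
  exact hd this

theorem mem_scale_X_pow {H : AddSubmonoid ℕ} {s : ℕ} {f : k⟦X⟧} :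
    f ∈ scale (PowerSeries.X ^ s) (Subalgebra.toSubmodule (semigroupRing k H)) ↔
      ∀ m, PowerSeries.coeff m f ≠ 0 → ∃ x ∈ H, m = s + x := by
  rw [mem_scale]
  constructor
  · rintro ⟨g, hg, rfl⟩ m hm
    rw [PowerSeries.coeff_X_pow_mul'] at hm
    split_ifs at hm with hs
    · refine ⟨m - s, ?_, by omega⟩
      by_contra hH
      exact hm (hg _ hH)
    · exact absurd rfl hm
  · intro hf
    obtain ⟨g, rfl⟩ : PowerSeries.X ^ s ∣ f := PowerSeries.X_pow_dvd_iff.2 fun m hm => by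
      by_contra hne
      obtain ⟨x, -, rfl⟩ := hf m hne
      omega
    refine ⟨g, fun m hm => ?_, rfl⟩
    by_contra hne
    obtain ⟨x, hx, hxm⟩ := hf (m + s) (by rwa [PowerSeries.coeff_X_pow_mul])
    exact hm (by rwa [show m = x by omega])

variable {c h : ℕ} (hch : c ≤ h) (hc : 2 ≤ c) (hh : 3 ≤ h) {i : ℕ} (hi : 2 ≤ i)

theorem ladder_one_le_slowSemigroup {j : ℕ} (hj : h ∈ slowSemigroup hch i j) (hpos : 1 ≤ h) :
    ladder c h hch 1 ≤ slowSemigroup hch i j := by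
  rw [slowSemigroup] at hj ⊢
  split_ifs at hj ⊢ with h1 h2
  · exact absurd rfl ((mem_punctured hch hpos).1 hj).2
  · exact ladder_antitone hch (by omega)
  · exact le_top

include hc in
-- The members of the chain containing h are L_1, L_0 and ℕ, and none of them fits into L_2.
theorem step_notMem_slowSemigroup (hpos : 1 ≤ h) {j m : ℕ}
    (hle : slowSemigroup hch i j ≤ ladder c h hch (m + 2)) : h ∉ slowSemigroup hch i j := by
  intro hj
  obtain ⟨x, hx, hx'⟩ := exists_mem_ladder_notMem_succ hch hc 1
  exact hx' (ladder_antitone hch (by omega) (hle (ladder_one_le_slowSemigroup hch hj hpos hx)))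

/-- The index of a punctured ladder in the slow chain. -/
def slowIdx {r : ℕ} (hr : 2 ≤ r) (hri : r ≤ i) : (slowChain hch k hc hh hi).Idx :=
  ⟨i + 1 - r, by omega, by change _ ≤ i + 2; omega⟩

theorem pieceSpace_slowIdx {r : ℕ} (hr : 2 ≤ r) (hri : r ≤ i) :
    (slowChain hch k hc hh hi).pieceSpace (slowIdx hch hc hh hi hr hri) =
      Subalgebra.toSubmodule (semigroupRing k (punctured hch r)) := by
  change Subalgebra.toSubmodule (semigroupRing k (slowSemigroup hch i (i + 1 - r))) = _
  rw [slowSemigroup, if_pos (by omega), show i + 1 - (i + 1 - r) = r by omega]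

theorem slowChain_strict : (slowChain hch k hc hh hi).Strict :=
  (radicalSequence_slow hch hc hh hi).radical.toStrict

/-- On exponents the statement is L_{r+4} = Q_{r+3} ∪ (h + Q_{r+2}), where only h is missing from
Q_{r+3}. The content is that the t^h-part of a homomorphism is itself a homomorphism M → t^h
R(Q_{r+2}); this uses that no small member of the chain contains h. -/
theorem homInto_ladder {r : ℕ} :
    (slowChain hch k hc hh hi).homInto
        (Subalgebra.toSubmodule (semigroupRing k (ladder c h hch (r + 4)))) =
      (slowChain hch k hc hh hi).homInto
        (Subalgebra.toSubmodule (semigroupRing k (punctured hch (r + 3)))) ⊔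
      (slowChain hch k hc hh hi).homInto (scale (PowerSeries.X ^ h)
        (Subalgebra.toSubmodule (semigroupRing k (punctured hch (r + 2))))) := by
  have hpos : 1 ≤ h := by omega
  have hC := slowChain_strict (k := k) hch hc hh hi
  set C := slowChain hch k hc hh hi with hCdef
  have hle : scale (PowerSeries.X ^ h)
      (Subalgebra.toSubmodule (semigroupRing k (punctured hch (r + 2)))) ≤
      Subalgebra.toSubmodule (semigroupRing k (ladder c h hch (r + 4))) := by
    intro f hf m hm
    by_contra hne
    obtain ⟨x, hx, rfl⟩ := mem_scale_X_pow.1 hf m hne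
    exact hm (add_mem_ladder_succ hch (punctured_le hch hpos _ hx))
  apply le_antisymm
  · intro φ hφ
    have hφ' : ∀ b : C.Idx, ∀ u ∈ semigroupRing k (slowSemigroup hch i b),
        u * φ (C.gen b) ∈ semigroupRing k (ladder c h hch (r + 4)) :=
      hC.mem_homInto_iff.1 hφ
    set y : C.Rows := C.ofComponents fun b =>
      PowerSeries.coeff h (φ (C.gen b)) • PowerSeries.X ^ h with hy
    have hymem : y ∈ C.homInto (scale (PowerSeries.X ^ h)
        (Subalgebra.toSubmodule (semigroupRing k (punctured hch (r + 2))))) := by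
      rw [hC.mem_homInto_iff]
      intro b u hu
      rw [hy, RingChain.ofComponents_gen]
      by_cases h0 : PowerSeries.coeff h (φ (C.gen b)) = 0
      · rw [h0, zero_smul, mul_zero]
        exact zero_mem _
      -- A nonzero coefficient at t^h forces h + K_b ⊆ L_{r+4}, so K_b ⊆ L_{r+3}; then h ∉ K_b, and
      -- K_b ⊆ Q_{r+2}.
      have hle' : slowSemigroup hch i b ≤ ladder c h hch (r + 3) := fun v hv =>
        (add_mem_ladder_succ_iff hch hpos).1 (add_mem_of_coeff_ne_zero (hφ' b) hv h0)
      have hlt : slowSemigroup hch i b ≤ punctured hch (r + 2) := fun v hv =>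
        (mem_punctured hch hpos).2 ⟨hle' hv, fun hvh =>
          step_notMem_slowSemigroup hch hc hpos hle' (hvh ▸ hv)⟩
      rw [mul_smul_comm]
      refine Submodule.smul_mem _ _ ⟨u, semigroupRing_le_iff.2 hlt hu, ?_⟩
      rw [LinearMap.mulLeft_apply, mul_comm]
    refine Submodule.mem_sup.2 ⟨φ - y, ?_, y, hymem, sub_add_cancel _ _⟩
    have hsub : φ - y ∈ C.homInto
        (Subalgebra.toSubmodule (semigroupRing k (ladder c h hch (r + 4)))) :=
      Submodule.sub_mem _ hφ (C.homInto_mono hle hymem)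
    rw [hC.mem_homInto_iff] at hsub ⊢
    intro b u hu m hm
    rw [mem_punctured hch hpos, not_and_not_right] at hm
    by_cases hml : m ∈ ladder c h hch (r + 4)
    swap
    · exact hsub b u hu m hml
    obtain rfl := hm hml
    set f := φ (C.gen b) with hf
    have hf1 : f ∈ semigroupRing k (ladder c m hch (r + 4)) := by
      simpa using hφ' b 1 (one_mem _)
    obtain ⟨g, hg⟩ : PowerSeries.X ^ m ∣ f - PowerSeries.C (PowerSeries.constantCoeff f) :=
      PowerSeries.X_pow_dvd_iff.2 fun d hd => by
        rw [map_sub, PowerSeries.coeff_C]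
        split_ifs with hd0
        · rw [hd0, PowerSeries.coeff_zero_eq_constantCoeff_apply, sub_self]
        · rw [sub_zero]
          exact hf1 d fun hdl => hd0 (eq_zero_of_mem_ladder_succ hch hdl hd)
    -- Here m = h. As f has no exponents strictly between 0 and h, the coefficient of uf at t^h is
    -- u_h f_0 + u_0 f_h. The second term is removed by y; the first vanishes, since f_0 ≠ 0 would
    -- give K_b ⊆ L_{r+4} and so h ∉ K_b.
    have hprod : PowerSeries.coeff m u * PowerSeries.constantCoeff f = 0 := by
      by_contra hne
      obtain ⟨hu0, hf0⟩ := mul_ne_zero_iff.1 hne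
      have hmb : m ∈ slowSemigroup hch i b := by
        by_contra hmb
        exact hu0 (hu m hmb)
      refine step_notMem_slowSemigroup (m := r + 2) hch hc hpos (fun v hv => ?_) hmb
      have := add_mem_of_coeff_ne_zero (d := 0) (hφ' b) hv
        (by rwa [PowerSeries.coeff_zero_eq_constantCoeff_apply])
      rwa [zero_add] at this
    have hcm : PowerSeries.coeff m f = PowerSeries.constantCoeff g := by
      have := congrArg (PowerSeries.coeff m) hg
      rw [map_sub, PowerSeries.coeff_C, if_neg (by omega), sub_zero,
        PowerSeries.coeff_X_pow_mul', if_pos le_rfl, Nat.sub_self] at this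
      rw [this, PowerSeries.coeff_zero_eq_constantCoeff_apply]
    rw [RingChain.Rows.sub_apply, hy, RingChain.ofComponents_gen, ← hf, hcm, mul_sub,
      map_sub, mul_smul_comm, map_smul, sub_eq_iff_eq_add.1 hg, mul_add, map_add,
      PowerSeries.coeff_mul_C, hprod, mul_left_comm,
      PowerSeries.coeff_X_pow_mul', if_pos le_rfl, PowerSeries.coeff_mul_X_pow', if_pos le_rfl,
      Nat.sub_self, PowerSeries.coeff_zero_eq_constantCoeff_apply, map_mul, smul_eq_mul,
      PowerSeries.coeff_zero_eq_constantCoeff_apply]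
    ring
  · refine sup_le (RingChain.homInto_mono _ ?_) (RingChain.homInto_mono _ hle)
    exact semigroupRing_le_iff.2 (punctured_le hch hpos _)

/-- The only element of h + Q_{r+2} outside 3h + L_{r+1} is h itself, and h ∉ Q_{r+3}. -/
theorem punctured_inf_scale {r : ℕ} (hpos : 1 ≤ h) :
    Subalgebra.toSubmodule (semigroupRing k (punctured hch (r + 3))) ⊓
      scale (PowerSeries.X ^ h)
        (Subalgebra.toSubmodule (semigroupRing k (punctured hch (r + 2)))) =
      scale (PowerSeries.X ^ (3 * h))
        (Subalgebra.toSubmodule (semigroupRing k (ladder c h hch (r + 1)))) := by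
  ext f
  rw [Submodule.mem_inf, mem_scale_X_pow, mem_scale_X_pow]
  constructor
  · rintro ⟨hf, hf'⟩ m hm
    obtain ⟨x, hx, rfl⟩ := hf' m hm
    have hx0 : x ≠ 0 := by
      rintro rfl
      exact hm (hf _ fun hp => ((mem_punctured hch hpos).1 hp).2 rfl)
    obtain ⟨y, hy, rfl⟩ := (mem_punctured_ne_zero hch hpos).1 ⟨hx, hx0⟩
    exact ⟨y, hy, by ring⟩
  · intro hf
    refine ⟨fun m hm => ?_, fun m hm => ?_⟩
    · by_contra hne
      obtain ⟨x, hx, rfl⟩ := hf m hne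
      refine hm ((mem_punctured_ne_zero hch hpos).2 ⟨h + x, add_mem_ladder_succ hch hx, by ring⟩).1
    · obtain ⟨x, hx, rfl⟩ := hf m hm
      exact ⟨2 * h + x, ((mem_punctured_ne_zero hch hpos).2 ⟨x, hx, rfl⟩).1, by ring⟩

/-- By `homInto_ladder` with r = 3q, the module is a sum of two projectives, as Q_{3q+3} and
Q_{3q+2} occur in the chain. Their intersection is isomorphic to the module for q - 1, which gives
the induction. For q = 0 the sum is not projective, the intersection having order 3h against the
shifts 0 and h. -/
theorem not_projDimLT_ladder (q : ℕ) (hq : 3 * q + 3 ≤ i) :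
    ¬ ProjDimLT (slowChain hch k hc hh hi).Eᵐᵒᵖ ((slowChain hch k hc hh hi).homInto
      (Subalgebra.toSubmodule (semigroupRing k (ladder c h hch (3 * q + 4))))) (q + 1) := by
  have hpos : 1 ≤ h := by omega
  have hC := slowChain_strict (k := k) hch hc hh hi
  have hX : ∀ d, (PowerSeries.X : k⟦X⟧) ^ d ≠ 0 := fun d => pow_ne_zero _ PowerSeries.X_ne_zero
  have hp3 := pieceSpace_slowIdx (k := k) hch hc hh hi (show 2 ≤ 3 * q + 3 by omega) hq
  have hp2 := pieceSpace_slowIdx (k := k) hch hc hh hi (show 2 ≤ 3 * q + 2 by omega) (by omega)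
  rw [homInto_ladder]
  induction q with
  | zero =>
    refine hC.not_projective_sup (p := 0) (q := h) (s := 3 * h) (by omega) (by omega)
      (a := slowIdx hch hc hh hi (by omega) hq)
      (b := slowIdx hch hc hh hi (show 2 ≤ 3 * 0 + 2 by omega) (by omega)) ?_ ?_ ?_ ?_
    · rw [hp3]
      ext f
      rw [mem_scale_X_pow]
      exact ⟨fun hf m hm => ⟨m, by by_contra hn; exact hm (hf m hn), (zero_add m).symm⟩,
        fun hf m hm => by
          by_contra hne
          obtain ⟨x, hx, rfl⟩ := hf m hne
          exact hm (by rwa [zero_add])⟩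
    · rw [hp2]
    · rw [punctured_inf_scale hch hpos]
      rintro _ ⟨g, -, rfl⟩
      exact dvd_mul_right _ _
    · rw [punctured_inf_scale hch hpos, hC.homInto_scale (hX _)]
      -- R(L_1) is the ring with index i, so its identity row multiplied by t^{3h} is a nonzero
      -- element of the intersection.
      let j : (slowChain hch k hc hh hi).Idx := ⟨i, by omega, by change i ≤ i + 2; omega⟩
      have hj : (slowChain hch k hc hh hi).pieceSpace j =
          Subalgebra.toSubmodule (semigroupRing k (ladder c h hch (3 * 0 + 1))) := by
        change Subalgebra.toSubmodule (semigroupRing k (slowSemigroup hch i i)) = _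
        rw [slowSemigroup, if_neg (by omega), if_pos (by omega), Nat.add_sub_cancel_left]
      refine ⟨_, ⟨((slowChain hch k hc hh hi).idRow j : RingChain.Rows _), ?_, rfl⟩, fun h0 => ?_⟩
      · rw [SetLike.mem_coe, ← hj]
        exact ((slowChain hch k hc hh hi).idRow j).2
      have h1 := DFunLike.congr_fun h0 ((slowChain hch k hc hh hi).gen j)
      rw [RingChain.Rows.mulBy_apply, RingChain.idRow_apply, RingChain.gen, Pi.single_eq_same] at h1
      exact hX _ ((mul_one _).symm.trans h1)
  | succ q ih =>
    intro hproj
    refine ih (by omega) (pieceSpace_slowIdx (k := k) hch hc hh hi (by omega) (by omega))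
      (pieceSpace_slowIdx (k := k) hch hc hh hi (by omega) (by omega)) ?_
    rw [← homInto_ladder, ← hC.projDimLT_scale (hX (3 * h)),
      show 3 * q + 4 = 3 * (q + 1) + 1 by ring,
      ← punctured_inf_scale hch hpos, RingChain.homInto_inf]
    refine hproj.inf ?_ ?_
    · rw [← hp3]
      exact (RingChain.projDimLT_piece _ _).mono (by omega)
    · rw [hC.projDimLT_scale (hX _), ← hp2]
      exact (RingChain.projDimLT_piece _ _).mono (by omega)

/-- The upper bound for radical chains excludes an infinite value, so the lower bound yields an
actual element of the spectrum. -/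
theorem exists_globalDim_slowChain {N : ℕ} (hN : 3 * N + 3 ≤ i) :
    ∃ d : ℕ, N + 1 ≤ d ∧ globalDim (slowChain hch k hc hh hi).Eᵐᵒᵖ = ((d : ℕ∞) : WithBot ℕ∞) := by
  have hle := (radicalSequence_slow hch hc hh hi).radical (k := k).globalDim_le
  change globalDim (slowChain hch k hc hh hi).Eᵐᵒᵖ ≤ _ at hle
  have hgt : ¬ globalDim (slowChain hch k hc hh hi).Eᵐᵒᵖ ≤ ((N : ℕ∞) : WithBot ℕ∞) := fun h =>
    not_projDimLT_ladder hch hc hh hi N hN (globalDim_le_iff.1 h _)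
  generalize globalDim (slowChain hch k hc hh hi).Eᵐᵒᵖ = g at hle hgt
  rcases g with _ | _ | d
  · exact absurd bot_le hgt
  · exact absurd (top_le_iff.1 (WithBot.coe_le_coe.1 hle)) (ENat.natCast_ne_top _)
  · refine ⟨d, ?_, rfl⟩
    by_contra hlt
    exact hgt (WithBot.coe_le_coe.2 (Nat.cast_le.2 (by omega)))

end Lower

end

/-! ### The resolutions, the greedy global dimension and the unbounded spread. -/

theorem theorem5p10 (k : Type u) [Field k] [CharZero k] (n a : ℕ) (hn : Even n) (hn6 : 6 ≤ n)
    (ha : 3 * n / 2 + 1 ≤ a) (ha' : a ≤ 2 * n - 1) :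
    -- (a)
    (∀ (i : ℕ) (hi : 3 ≤ i) (C : RingChain k),
      C = greedyChain (startingRing k n a i hn hn6 ha' (by omega)) →
      ∀ (j : ℕ) (hj : 3 ≤ j) (hjl : j + 2 ≤ C.len),
        IsSimpleModule C.Eᵐᵒᵖ (C.S ⟨j, by omega⟩) ∧
        ∃ (f₉ : (C.P ⟨j - 1, by omega⟩ × C.P ⟨j + 1, by omega⟩) →ₗ[C.Eᵐᵒᵖ] C.P ⟨j, by omega⟩)
          (f₁₀ : C.P ⟨j, by omega⟩ →ₗ[C.Eᵐᵒᵖ]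
            (C.P ⟨j - 1, by omega⟩ × C.P ⟨j + 1, by omega⟩)),
          (∀ φ ψ v, C.row (f₉ (φ, ψ)) v = C.row φ v + PowerSeries.X ^ (n / 2) * C.row ψ v) ∧
          (∀ φ v, C.row (f₁₀ φ).1 v = PowerSeries.X ^ (n / 2) * C.row φ v) ∧
          (∀ φ v, C.row (f₁₀ φ).2 v = - C.row φ v) ∧
          IsMinimalProjectiveResolution (R := C.Eᵐᵒᵖ) (C.π ⟨j, by omega⟩)
            f₉ f₁₀) ∧
    -- (b)
    (∀ (i : ℕ) (hi : 1 ≤ i),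
      globalDim (greedyChain (startingRing k n a i hn hn6 ha' hi)).Eᵐᵒᵖ = 2) ∧
    -- the global spectra of the rings of the family have unbounded spread
    (∀ N : ℕ, ∃ (i : ℕ) (hi : 1 ≤ i),
      2 ∈ globalSpectrum (startingRing k n a i hn hn6 ha' hi) ∧
      ∃ d ∈ globalSpectrum (startingRing k n a i hn hn6 ha' hi), 2 + N ≤ d) := by
  have hh : 3 * n / 2 = 3 * (n / 2) := by obtain ⟨r, rfl⟩ := hn; omega
  have hn2 : n = 2 * (n / 2) := by obtain ⟨r, rfl⟩ := hn; omega
  refine ⟨fun i hi C hC j hj hjl => ?_, fun i hi => ?_, fun N => ?_⟩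
  · obtain ⟨K, s, l, hK, hK1, -, hs⟩ := exists_principalSequence hn hn6 ha ha' (i := i) (by omega)
    rw [startingRing, ← hK1] at hC
    subst hC
    have hlen := hK.greedyChain_len (k := k)
    have hA := hK.arf (k := k)
    refine ⟨hA.toStrict.isSimpleModule_S _, hA.exists_minimalProjectiveResolution ?_ rfl
      (by omega) (hs _ ?_ ?_ hi) (hs _ ?_ ?_ hi)⟩
    all_goals dsimp only; omega
  · obtain ⟨K, s, l, hK, hK1, hs, -⟩ := exists_principalSequence hn hn6 ha ha' hi
    rw [startingRing, ← hK1]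
    refine (hK.arf (k := k)).globalDim_eq_two ?_
    rwa [hK.greedyChain_len]
  · obtain ⟨K, s, l, hK, hK1, hs, -⟩ :=
      -- 3N + 6 = 3(N + 1) + 3 is the smallest index at which the slow chain is known to have global
      -- dimension at least N + 2.
      exists_principalSequence hn hn6 ha ha' (i := 3 * N + 6) (by omega)
    refine ⟨3 * N + 6, by omega, ?_, ?_⟩
    · rw [startingRing, ← hK1]
      refine ⟨_, hK.isRadicalChain, rfl, (hK.arf (k := k)).globalDim_eq_two ?_⟩
      rwa [hK.greedyChain_len]
    · have hch : a + 1 - 3 * (n / 2) ≤ n / 2 := by omega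
      obtain ⟨d, hd, hdim⟩ := exists_globalDim_slowChain (k := k) hch (by omega) (by omega)
        (i := 3 * N + 6) (by omega) (N := N + 1) (by omega)
      refine ⟨d, ⟨_, (radicalSequence_slow hch (by omega) (by omega) (by omega)).isRadicalChain,
        ?_, hdim⟩, by omega⟩
      rw [startingRing, familySemigroup_eq_punctured hn hn6 ha ha' (by omega) hch]
      change semigroupRing k (slowSemigroup hch (3 * N + 6) 1) = _
      rw [slowSemigroup, if_pos (by omega), Nat.add_sub_cancel]
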